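/- Let $(M,g)$ be a smooth Riemannian manifold (Hausdorff, second countable, without boundary, possibly noncompact, $m=\dim M\geq 0$; completeness is not assumed) with Riemannian volume measure $\mathrm{vol}_g$, let $E\to M$ be a smooth Hermitian vector bundle of finite rank, and let $\nabla$ be a smooth (complex linear, not necessarily Hermitian) covariant derivative on $E$. For $j\ge 1$ let $\nabla^j_g$ be the $j$-th iterated covariant derivative, a linear differential operator of order $j$ from $E$ to $(T^*M)^{\otimes j}\otimes E$, where the bundles $(T^*M)^{\otimes i}\otimes E$ carry the tensor covariant derivative built from the Levi-Civita connection and $\nabla$, together with the Hermitian metric induced by $g$ and the metric of $E$. For a locally integrable Borel section $f$ of $E$, $\nabla^j_gf$ is understood in the sense of distributions: a locally integrable section $h$ equals $\nabla^j_g f$ iff $\int_M\langle(\nabla^j_g)^\dagger\psi,f\rangle\,d\mathrm{vol}_g=\int_M\langle\psi,h\rangle\,d\mathrm{vol}_g$ for all compactly supported smooth sections $\psi$ of $(T^*M)^{\otimes j}\otimes E$, where $(\nabla^j_g)^\dagger$ is the formal adjoint. Sections which agree almost everywhere are identified. Let $p\in[1,\infty)$ and let $s\geq 0$ be an integer. Let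 $W^{s,p}_{\nabla,g}(M,E)$ be the space of all $f\in L^p(M,E)$ such that $\nabla^j_g f\in L^p$ for $j=1,\dots,s$, with the norm $$\|f\|_{\nabla,g,p}=\Big(\|f\|_{L^p}^p+\sum_{j=1}^s\|\nabla^j_gf\|_{L^p}^p\Big)^{1/p},$$ and let $W^{s,p}_{\nabla,g,\mathrm{loc}}(M,E)$ be the space defined in the same way with $L^p_{\mathrm{loc}}$ in place of $L^p$. Let $W^{s,p}_{\mathrm{loc}}(M,E)$ be the space of Borel sections $f$ such that for every smooth chart $U$ of $M$ and every smooth frame $e_1,\dots,e_\ell$ of $E$ over $U$ the components of $f$ with respect to $(e_a)$, read in the coordinates of $U$, belong to the usual local Sobolev space $W^{s,p}_{\mathrm{loc}}$ (weak partial derivatives up to order $s$ in $L^p_{\mathrm{loc}}$). Then: 1. $W^{s,p}_{\nabla,g}(M,E)\subset W^{s,p}_{\mathrm{loc}}(M,E)$, and also $W^{s,p}_{\nabla,g,\mathrm{loc}}(M,E)\subset W^{s,p}_{\mathrm{loc}}(M,E)$. 2. For every $f\in W^{s,p}_{\nabla,g}(M,E)$ there is a sequence $(f_n)$ of smooth sections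 in $W^{s,p}_{\nabla,g}(M,E)$ with $\|f_n-f\|_{\nabla,g,p}\to0$. Likewise, for every $f\in W^{s,p}_{\nabla,g,\mathrm{loc}}(M,E)$ there is a sequence $(f_n)$ of smooth sections in $W^{s,p}_{\nabla,g,\mathrm{loc}}(M,E)$ with $\|f_n-f\|_{\nabla,g,p}\to0$. 3. If $f$ in either space has compact essential support, then the $f_n$ can be chosen to be smooth with compact support (hence in $W^{s,p}_{\nabla,g}(M,E)$). -/

import Mathlib

open scoped Manifold ContDiff Bundle ENNReal Topology
open Bundle MeasureTheory

noncomputable section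

namespace CovSobolev

/-! ### Euclidean space: local Sobolev spaces through weak derivatives -/

section Euclidean

variable {m : ℕ}

/-- `u ∈ L^p_loc(Ω)`. -/
def MemLpLocOn (p : ℝ≥0∞) (Ω : Set (EuclideanSpace ℝ (Fin m)))
    (u : EuclideanSpace ℝ (Fin m) → ℂ) : Prop :=
  ∀ K : Set (EuclideanSpace ℝ (Fin m)), IsCompact K → K ⊆ Ω → MemLp u p (volume.restrict K)

/-- The iterated partial derivative `∂_{α 0} ⋯ ∂_{α (k-1)} η`. -/
def partialDeriv {k : ℕ} (α : Fin k → Fin m) (η : EuclideanSpace ℝ (Fin m) → ℝ)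
    (y : EuclideanSpace ℝ (Fin m)) : ℝ :=
  iteratedFDeriv ℝ k η y (fun i => EuclideanSpace.single (α i) (1 : ℝ))

/-- `v = ∂^α u` in the sense of distributions on `Ω` (for `u`, `v` locally integrable). -/
def IsWeakPartialDeriv (Ω : Set (EuclideanSpace ℝ (Fin m))) {k : ℕ} (α : Fin k → Fin m)
    (u v : EuclideanSpace ℝ (Fin m) → ℂ) : Prop :=
  ∀ η : EuclideanSpace ℝ (Fin m) → ℝ, ContDiff ℝ ∞ η → HasCompactSupport η → tsupport η ⊆ Ω →
    ∫ y, (partialDeriv α η y : ℂ) * u y = (-1 : ℂ) ^ k * ∫ y, (η y : ℂ) * v y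

/-- `u ∈ W^{s,p}_loc(Ω)`. -/
def MemSobolevLocOn (s : ℕ) (p : ℝ≥0∞) (Ω : Set (EuclideanSpace ℝ (Fin m)))
    (u : EuclideanSpace ℝ (Fin m) → ℂ) : Prop :=
  MemLpLocOn p Ω u ∧ ∀ k : ℕ, k ≤ s → ∀ α : Fin k → Fin m,
    ∃ v, MemLpLocOn p Ω v ∧ IsWeakPartialDeriv Ω α u v

end Euclidean

/-! ### Riemannian geometry -/

section Riemannian

variable {m : ℕ} (M : Type*) [TopologicalSpace M] [ChartedSpace (EuclideanSpace ℝ (Fin m)) M]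
  [IsManifold (𝓡 m) ∞ M] [RiemannianBundle (fun x : M => TangentSpace (𝓡 m) x)]

variable {M} in
/-- Smooth vector fields. -/
def IsSmoothVF (X : Π x : M, TangentSpace (𝓡 m) x) : Prop :=
  ContMDiff (𝓡 m) (𝓡 m).tangent ∞ (fun x => (⟨x, X x⟩ : TangentBundle (𝓡 m) M))

variable {M} in
/-- The right-hand side of the Koszul formula, which equals `2 g(∇_X Y, Z)` for the Levi-Civita
connection `∇`. -/
def koszul (X Y Z : Π x : M, TangentSpace (𝓡 m) x) (x : M) : ℝ :=
  mvfderiv (𝓡 m) (fun y => inner ℝ (Y y) (Z y)) x (X x)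
    + mvfderiv (𝓡 m) (fun y => inner ℝ (Z y) (X y)) x (Y x)
    - mvfderiv (𝓡 m) (fun y => inner ℝ (X y) (Y y)) x (Z x)
    + inner ℝ (VectorField.mlieBracket (𝓡 m) X Y x) (Z x)
    - inner ℝ (VectorField.mlieBracket (𝓡 m) Y Z x) (X x)
    + inner ℝ (VectorField.mlieBracket (𝓡 m) Z X x) (Y x)

/-- An orthonormal basis of the tangent space at `x`. -/
def tangentONB {M : Type*} [TopologicalSpace M] [ChartedSpace (EuclideanSpace ℝ (Fin m)) M]
    [IsManifold (𝓡 m) ∞ M] [RiemannianBundle (fun x : M => TangentSpace (𝓡 m) x)] (x : M) :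
    OrthonormalBasis (Fin (Module.finrank ℝ (TangentSpace (𝓡 m) x))) ℝ (TangentSpace (𝓡 m) x) :=
  haveI : FiniteDimensional ℝ (TangentSpace (𝓡 m) x) :=
    inferInstanceAs (FiniteDimensional ℝ (EuclideanSpace ℝ (Fin m)))
  stdOrthonormalBasis ℝ (TangentSpace (𝓡 m) x)

variable {M} in
/-- The Levi-Civita connection of the metric: `leviCivita Y x v = ∇_v Y`. It is the vector with
`2 g(∇_v Y, z) = koszul` for all `z`, where `v` and `z` are extended to vector fields near `x`. -/
def leviCivita (Y : Π x : M, TangentSpace (𝓡 m) x) (x : M) (v : TangentSpace (𝓡 m) x) :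
    TangentSpace (𝓡 m) x :=
  ∑ i, ((1 / 2 : ℝ) * koszul (FiberBundle.extend (EuclideanSpace ℝ (Fin m)) v) Y
    (FiberBundle.extend (EuclideanSpace ℝ (Fin m)) (tangentONB x i)) x) • tangentONB x i

variable {M} in
/-- The coordinate vector `∂_i` of the chart `e` at the point with coordinates `y`. -/
def coordVec (e : OpenPartialHomeomorph M (EuclideanSpace ℝ (Fin m))) (i : Fin m)
    (y : EuclideanSpace ℝ (Fin m)) : TangentSpace (𝓡 m) (e.symm y) :=
  mfderiv (𝓡 m) (𝓡 m) e.symm y (EuclideanSpace.single i (1 : ℝ))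

variable {M} in
/-- The Riemannian density `√det (g(∂_i, ∂_j))` of the chart `e`. -/
def volDensity (e : OpenPartialHomeomorph M (EuclideanSpace ℝ (Fin m)))
    (y : EuclideanSpace ℝ (Fin m)) : ℝ :=
  √(Matrix.det (Matrix.of fun i j : Fin m => (inner ℝ (coordVec e i y) (coordVec e j y) : ℝ)))

variable [MeasurableSpace M]

/-- The Riemannian volume measure. For each smooth chart `e` take the measure on its source which
has density `√det (g_ij)` with respect to Lebesgue measure in the coordinates; any two of these
measures agree on the intersection of the sources, so their supremum is the measure glued from
them, which is given by `√det (g_ij) dx` in every chart. -/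
def volG : Measure M :=
  ⨆ e ∈ IsManifold.maximalAtlas (𝓡 m) ∞ M,
    Measure.map e.symm ((volume.restrict e.target).withDensity
      fun y => ENNReal.ofReal (volDensity e y))

end Riemannian

/-! ### Sections of a Hermitian bundle and covariant derivatives -/

section Bundle

variable {m : ℕ} {M : Type*} [TopologicalSpace M] [ChartedSpace (EuclideanSpace ℝ (Fin m)) M]
  [IsManifold (𝓡 m) ∞ M] [RiemannianBundle (fun x : M => TangentSpace (𝓡 m) x)]
  [MeasurableSpace M]
  (F : Type*) [NormedAddCommGroup F] [NormedSpace ℂ F]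
  {V : M → Type*} [TopologicalSpace (TotalSpace F V)]
  [∀ x, NormedAddCommGroup (V x)] [∀ x, InnerProductSpace ℂ (V x)] [FiberBundle F V]

/-- The Hermitian inner products of the fibres depend smoothly on the base point. -/
def IsSmoothHermitian [VectorBundle ℝ F V] : Prop :=
  ∃ h : Π x : M, V x →L[ℝ] V x →L[ℝ] ℂ,
    ContMDiff (𝓡 m) ((𝓡 m).prod 𝓘(ℝ, F →L[ℝ] F →L[ℝ] ℂ)) ∞
      (fun x => TotalSpace.mk' (F →L[ℝ] F →L[ℝ] ℂ) x (h x)) ∧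
    ∀ (x : M) (v w : V x), inner ℂ v w = h x v w

/-- Smooth sections. -/
def IsSmoothSection (f : Π x : M, V x) : Prop :=
  ContMDiff (𝓡 m) ((𝓡 m).prod 𝓘(ℝ, F)) ∞ (fun x => TotalSpace.mk' F x (f x))

/-- Borel sections. Elements of `L^p` and of Sobolev spaces are represented by Borel sections; all
notions below depend only on the almost everywhere class. -/
def IsBorelSection (f : Π x : M, V x) : Prop :=
  @Measurable M (TotalSpace F V) _ (borel _) (fun x => TotalSpace.mk' F x (f x))

/-- Vanishing outside a compact set. -/
def HasCompactSupp {W : M → Type*} [∀ x, Zero (W x)] (f : Π x : M, W x) : Prop :=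
  ∃ K : Set M, IsCompact K ∧ ∀ x, x ∉ K → f x = 0

/-- Compact essential support. -/
def HasCompactEssSupp (f : Π x : M, V x) : Prop :=
  ∃ K : Set M, IsCompact K ∧ ∀ᵐ x ∂(volG (m := m) M), x ∉ K → f x = 0

variable (V) in
/-- Sections of `(T*M)^{⊗ j} ⊗ E`, as fields of `j`-linear maps on the tangent spaces. -/
abbrev TensorField (j : ℕ) : Type _ :=
  Π x : M, MultilinearMap ℝ (fun _ : Fin j => TangentSpace (𝓡 m) x) (V x)

/-- Smooth sections of `(T*M)^{⊗ j} ⊗ E`. -/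
def IsSmoothTensor {j : ℕ} (ψ : TensorField (m := m) V j) : Prop :=
  ∀ X : Fin j → Π x : M, TangentSpace (𝓡 m) x, (∀ i, IsSmoothVF (X i)) →
    IsSmoothSection (m := m) F (fun x => ψ x (fun i => X i x))

/-- Borel sections of `(T*M)^{⊗ j} ⊗ E`. -/
def IsBorelTensor {j : ℕ} (ψ : TensorField (m := m) V j) : Prop :=
  ∀ X : Fin j → Π x : M, TangentSpace (𝓡 m) x, (∀ i, IsSmoothVF (X i)) →
    IsBorelSection F (fun x => ψ x (fun i => X i x))

/-- The canonical Hermitian inner product of `(T*_xM)^{⊗ j} ⊗ E_x`. -/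
def tensorInner {j : ℕ} {x : M} (A B : (Fin j → TangentSpace (𝓡 m) x) → V x) : ℂ :=
  ∑ a : Fin j → Fin (Module.finrank ℝ (TangentSpace (𝓡 m) x)),
    inner ℂ (A fun k => tangentONB x (a k)) (B fun k => tangentONB x (a k))

/-- The norm on `(T*_xM)^{⊗ j} ⊗ E_x` given by `tensorInner`. -/
def tensorNorm {j : ℕ} {x : M} (A : (Fin j → TangentSpace (𝓡 m) x) → V x) : ℝ :=
  √(∑ a : Fin j → Fin (Module.finrank ℝ (TangentSpace (𝓡 m) x)),
    ‖A fun k => tangentONB x (a k)‖ ^ 2)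

variable {F}

/-- The covariant derivative `cov`, a connection on the underlying real bundle, is complex linear. -/
def IsComplexLinear (cov : CovariantDerivative (𝓡 m) F V) : Prop :=
  ∀ (σ : Π x : M, V x) (x : M),
    MDifferentiableAt (𝓡 m) ((𝓡 m).prod 𝓘(ℝ, F)) (fun y => TotalSpace.mk' F y (σ y)) x →
    ∀ v : TangentSpace (𝓡 m) x, cov (fun y => Complex.I • σ y) x v = Complex.I • cov σ x v

/-- The tensor covariant derivative of the Levi-Civita connection and `cov`, from sections of
`(T*M)^{⊗ j} ⊗ E` to sections of `(T*M)^{⊗ (j+1)} ⊗ E`: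
`(∇A)(v₀, …, v_j) = ∇_{v₀}(A(X₁, …, X_j)) - ∑ₖ A(v₁, …, ∇_{v₀}Xₖ, …, v_j)`, where `Xₖ` is a vector
field which is smooth near `x` and has the value `vₖ` at `x`. -/
def covDerivTensor (cov : CovariantDerivative (𝓡 m) F V) {j : ℕ}
    (A : Π x : M, (Fin j → TangentSpace (𝓡 m) x) → V x) :
    Π x : M, (Fin (j + 1) → TangentSpace (𝓡 m) x) → V x := fun x v =>
  cov (fun y => A y fun k => FiberBundle.extend (EuclideanSpace ℝ (Fin m)) (v k.succ) y) x (v 0)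
    - ∑ k : Fin j, A x (Function.update (fun l => v l.succ) k
        (leviCivita (FiberBundle.extend (EuclideanSpace ℝ (Fin m)) (v k.succ)) x (v 0)))

/-- The iterated covariant derivative `∇^j f` of a smooth section `f`. -/
def iterCovDeriv (cov : CovariantDerivative (𝓡 m) F V) (f : Π x : M, V x) :
    (j : ℕ) → Π x : M, (Fin j → TangentSpace (𝓡 m) x) → V x
  | 0 => fun x _ => f x
  | j + 1 => covDerivTensor cov (iterCovDeriv cov f j)

/-- `χ = (∇^j)† ψ`, where `(∇^j)†` is the formal adjoint of the differential operator `∇^j`. For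
each compactly supported smooth `ψ` there is exactly one such compactly supported smooth `χ`. -/
def IsFormalAdjoint (cov : CovariantDerivative (𝓡 m) F V) (j : ℕ) (ψ : TensorField (m := m) V j)
    (χ : Π x : M, V x) : Prop :=
  ∀ φ : Π x : M, V x, IsSmoothSection (m := m) F φ →
    ∫ x, inner ℂ (χ x) (φ x) ∂(volG (m := m) M) =
      ∫ x, tensorInner (fun v => ψ x v) (iterCovDeriv cov φ j x) ∂(volG (m := m) M)

/-- `g = ∇^j f` in the sense of distributions, for locally integrable `f` and `g`: one has
`∫ ⟨(∇^j)† ψ, f⟩ = ∫ ⟨ψ, g⟩` for all compactly supported smooth `ψ`. -/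
def IsWeakCovDeriv (cov : CovariantDerivative (𝓡 m) F V) (j : ℕ) (f : Π x : M, V x)
    (g : TensorField (m := m) V j) : Prop :=
  IsBorelSection F f ∧ LocallyIntegrable (fun x => ‖f x‖) (volG (m := m) M) ∧
  IsBorelTensor F g ∧ LocallyIntegrable (fun x => tensorNorm (g x)) (volG (m := m) M) ∧
  ∀ (ψ : TensorField (m := m) V j) (χ : Π x : M, V x),
    IsSmoothTensor F ψ → HasCompactSupp ψ → IsSmoothSection (m := m) F χ → HasCompactSupp χ →
    IsFormalAdjoint cov j ψ χ →
      ∫ x, inner ℂ (χ x) (f x) ∂(volG (m := m) M) = ∫ x, tensorInner (fun v => ψ x v) (g x) ∂(volG (m := m) M)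

/-- The global covariant Sobolev space: `f ∈ L^p` with `∇^1 f, …, ∇^s f ∈ L^p`. -/
def MemCovSobolev (cov : CovariantDerivative (𝓡 m) F V) (s : ℕ) (p : ℝ≥0∞)
    (f : Π x : M, V x) : Prop :=
  IsBorelSection F f ∧ MemLp (fun x => ‖f x‖) p (volG (m := m) M) ∧
  ∀ j ∈ Finset.Icc 1 s, ∃ g : TensorField (m := m) V j,
    IsWeakCovDeriv cov j f g ∧ MemLp (fun x => tensorNorm (g x)) p (volG (m := m) M)

/-- The local version: `f ∈ L^p_loc` with `∇^1 f, …, ∇^s f ∈ L^p_loc`. -/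
def MemCovSobolevLoc (cov : CovariantDerivative (𝓡 m) F V) (s : ℕ) (p : ℝ≥0∞)
    (f : Π x : M, V x) : Prop :=
  IsBorelSection F f ∧
  (∀ K : Set M, IsCompact K → MemLp (fun x => ‖f x‖) p ((volG (m := m) M).restrict K)) ∧
  ∀ j ∈ Finset.Icc 1 s, ∃ g : TensorField (m := m) V j, IsWeakCovDeriv cov j f g ∧
    ∀ K : Set M, IsCompact K → MemLp (fun x => tensorNorm (g x)) p ((volG (m := m) M).restrict K)

/-- `‖∇^j f‖_{L^p}`, which is `∞` if the distribution `∇^j f` is not a locally integrable section.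
As `∇^j f` is unique up to null sets, the infimum only selects it. -/
def weakCovDerivNorm (cov : CovariantDerivative (𝓡 m) F V) (j : ℕ) (p : ℝ≥0∞)
    (f : Π x : M, V x) : ℝ≥0∞ :=
  ⨅ (g : TensorField (m := m) V j) (_ : IsWeakCovDeriv cov j f g),
    eLpNorm (fun x => tensorNorm (g x)) p (volG (m := m) M)

/-- The Sobolev norm `(‖f‖_p^p + ∑_{j=1}^s ‖∇^j f‖_p^p)^{1/p}`, for `p < ∞`. -/
def covSobolevNorm (cov : CovariantDerivative (𝓡 m) F V) (s : ℕ) (p : ℝ≥0∞)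
    (f : Π x : M, V x) : ℝ≥0∞ :=
  (eLpNorm (fun x => ‖f x‖) p (volG (m := m) M) ^ p.toReal
    + ∑ j ∈ Finset.Icc 1 s, weakCovDerivNorm cov j p f ^ p.toReal) ^ (1 / p.toReal)

variable (F)

/-- `fr` is a smooth local frame over `U` of the complex bundle. -/
structure IsSmoothFrameOn {ℓ : ℕ} (fr : Fin ℓ → Π x : M, V x) (U : Set M) : Prop where
  linearIndependent : ∀ x ∈ U, LinearIndependent ℂ (fun a => fr a x)
  span_eq_top : ∀ x ∈ U, Submodule.span ℂ (Set.range fun a => fr a x) = ⊤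
  contMDiffOn : ∀ a, ContMDiffOn (𝓡 m) ((𝓡 m).prod 𝓘(ℝ, F)) ∞
    (fun x => TotalSpace.mk' F x (fr a x)) U

/-- `f ∈ W^{s,p}_loc(M, E)`: for every chart `e` whose source admits a smooth frame, the components
of `f` are in `W^{s,p}_loc` in the coordinates. -/
def MemSobolevLoc (s : ℕ) (p : ℝ≥0∞) (f : Π x : M, V x) : Prop :=
  IsBorelSection F f ∧
  ∀ e ∈ IsManifold.maximalAtlas (𝓡 m) ∞ M, ∀ (ℓ : ℕ) (fr : Fin ℓ → Π x : M, V x),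
    IsSmoothFrameOn (m := m) F fr e.source →
    ∀ c : Fin ℓ → M → ℂ, (∀ x ∈ e.source, f x = ∑ a, c a x • fr a x) →
    ∀ a, MemSobolevLocOn s p e.target (fun y => c a (e.symm y))

end Bundle

end CovSobolev

end

/-! Everything is reduced to a first order system in Euclidean space. In a chart with a frame, the
components `H_j` of `∇^j f` for smooth `f` satisfy `H_{j+1,(i,κ)} = ∂_i H_{j,κ} + ∑ Q H_j`, where
the smooth coefficients `Q` come from the connection form of `∇` and the Christoffel symbols
(`isTower_derivComps`). Such families are called towers. Any statement about `∇^j` then becomes one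
about ordinary partial derivatives plus lower order terms.

Inclusion in `W^{s,p}_loc`. A distributional derivative `∇^j f` is defined by pairing with the full
adjoint `(∇^j)†`. For test tensors supported in a chart this adjoint is the `j`-fold composition of
the adjoints of single steps (`isFormalAdjoint_testTensor`). Comparing the identities of orders `j +
1` and `j` isolates one step, so the components of the weak derivatives solve the system weakly
(`IsWeakTower.of_adj`, `IsCovJet.isWeakTower`). Each weak partial derivative of an order `j`
component is therefore a combination of components of orders `j` and `j + 1`, and a bootstrap gives
Sobolev regularity (`IsWeakTower.sob`).

Local approximation. Only the components of `f` itself are mollified. Since these are in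
`W^{s,p}_loc`, all their derivatives up to order `s` converge on compact sets, and the system passes
the convergence on to the components of every `∇^j` (`IsWeakTower.exists_approx`,
`IsCovJet.exists_local_approx`).

Gluing, in the manner of Meyers and Serrin. Put `u = ∑ θ_i u_i` with a partition of unity and local
approximations `u_i` whose errors are small relative to the norm of multiplication by `θ_i`. A
Leibniz rule for weak derivatives is not needed: for smooth `v` one has `u - v = ∑ θ_i (u_i - v)`
near a given point, all terms are smooth, and letting `v` run through local approximations of `f`
that converge almost everywhere bounds `|∇^j u - ∇^j f|` by the local errors
(`derivDist_finsum_le`). A countable Minkowski inequality sums them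
(`IsCovJet.exists_smooth_approx`). The error is small in the global norm even when `f` is only
locally in the space, so the same sequence serves both spaces. Weak derivatives vanish almost
everywhere on open sets where `f` does (`IsCovJet.ae_eq_zero`), so the `u_i` away from the support
of `f` may be taken to be zero; this gives compact supports. -/

namespace CovSobolev

/-! ### Test functions and first order weak derivatives -/

section EuclideanTools

variable {m : ℕ}

/-- The partial derivative `∂_i f`. -/
noncomputable def pd (i : Fin m) (f : EuclideanSpace ℝ (Fin m) → ℂ)
    (y : EuclideanSpace ℝ (Fin m)) : ℂ :=
  fderiv ℝ f y (EuclideanSpace.single i (1 : ℝ))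

/-- Complex valued test functions on `Ω`. -/
structure IsTest (Ω : Set (EuclideanSpace ℝ (Fin m))) (η : EuclideanSpace ℝ (Fin m) → ℂ) :
    Prop where
  contDiff : ContDiff ℝ ∞ η
  hasCompactSupport : HasCompactSupport η
  tsupport_subset : tsupport η ⊆ Ω

/-- `v = ∂_i u` in the sense of distributions on `Ω`. -/
def WeakPD (Ω : Set (EuclideanSpace ℝ (Fin m))) (i : Fin m)
    (u v : EuclideanSpace ℝ (Fin m) → ℂ) : Prop :=
  ∀ η, IsTest Ω η → ∫ y, pd i η y * u y = -∫ y, η y * v y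

variable {Ω : Set (EuclideanSpace ℝ (Fin m))} {p : ℝ≥0∞}

lemma pd_contDiff {i : Fin m} {f : EuclideanSpace ℝ (Fin m) → ℂ} (hf : ContDiff ℝ ∞ f) :
    ContDiff ℝ ∞ (pd i f) :=
  (hf.fderiv_right (m := ∞) (by simp)).clm_apply contDiff_const

lemma pd_contDiffOn {i : Fin m} {f : EuclideanSpace ℝ (Fin m) → ℂ} (hΩ : IsOpen Ω)
    (hf : ContDiffOn ℝ ∞ f Ω) : ContDiffOn ℝ ∞ (pd i f) Ω :=
  (hf.fderiv_of_isOpen hΩ (m := ∞) (by simp)).clm_apply contDiffOn_const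

lemma pd_congr {i : Fin m} {f g : EuclideanSpace ℝ (Fin m) → ℂ} (hΩ : IsOpen Ω)
    (h : ∀ y ∈ Ω, f y = g y) {y : EuclideanSpace ℝ (Fin m)} (hy : y ∈ Ω) :
    pd i f y = pd i g y := by
  have : f =ᶠ[𝓝 y] g := Filter.eventuallyEq_of_mem (hΩ.mem_nhds hy) h
  simp [pd, this.fderiv_eq]

lemma differentiableAt_of_contDiffOn {f : EuclideanSpace ℝ (Fin m) → ℂ} (hΩ : IsOpen Ω)
    (hf : ContDiffOn ℝ ∞ f Ω) {y : EuclideanSpace ℝ (Fin m)} (hy : y ∈ Ω) :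
    DifferentiableAt ℝ f y :=
  (hf.contDiffAt (hΩ.mem_nhds hy)).differentiableAt (by simp)

lemma pd_mul {i : Fin m} {f g : EuclideanSpace ℝ (Fin m) → ℂ} {y : EuclideanSpace ℝ (Fin m)}
    (hf : DifferentiableAt ℝ f y) (hg : DifferentiableAt ℝ g y) :
    pd i (fun z => f z * g z) y = pd i f y * g y + f y * pd i g y := by
  simp only [pd]
  rw [fderiv_fun_mul hf hg]
  simp
  ring

lemma pd_add {i : Fin m} {f g : EuclideanSpace ℝ (Fin m) → ℂ} {y : EuclideanSpace ℝ (Fin m)}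
    (hf : DifferentiableAt ℝ f y) (hg : DifferentiableAt ℝ g y) :
    pd i (fun z => f z + g z) y = pd i f y + pd i g y := by
  simp only [pd]
  rw [fderiv_fun_add hf hg]
  simp

namespace IsTest

variable {η η' : EuclideanSpace ℝ (Fin m) → ℂ}

lemma zero : IsTest Ω (fun _ => 0) :=
  ⟨contDiff_const, HasCompactSupport.zero, by simp [tsupport, Function.support]⟩

lemma add (h : IsTest Ω η) (h' : IsTest Ω η') : IsTest Ω (fun y => η y + η' y) :=
  ⟨h.1.add h'.1, h.2.add h'.2,
    (tsupport_add η η').trans (Set.union_subset h.3 h'.3)⟩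

lemma sum {ι : Type*} (s : Finset ι) {η : ι → EuclideanSpace ℝ (Fin m) → ℂ}
    (h : ∀ k ∈ s, IsTest Ω (η k)) : IsTest Ω (fun y => ∑ k ∈ s, η k y) := by
  classical
  induction s using Finset.induction_on with
  | empty => simpa using zero
  | insert a s ha ih =>
    simp only [Finset.sum_insert ha]
    exact (h a (by simp)).add (ih fun k hk => h k (by simp [hk]))

/-- Nothing is known about `f` outside `Ω`, but there the product vanishes on a whole neighbourhood
of each point because the closed support of `η` lies in `Ω`. -/
lemma mul_left (hΩ : IsOpen Ω) {f : EuclideanSpace ℝ (Fin m) → ℂ} (hf : ContDiffOn ℝ ∞ f Ω)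
    (h : IsTest Ω η) : IsTest Ω (fun y => f y * η y) := by
  have hs : tsupport (fun y => f y * η y) ⊆ tsupport η :=
    closure_mono (fun y hy => by
      simp only [Function.mem_support] at hy ⊢
      exact right_ne_zero_of_mul hy)
  refine ⟨?_, h.2.mul_left, hs.trans h.3⟩
  rw [contDiff_iff_contDiffAt]
  intro y
  by_cases hy : y ∈ Ω
  · exact (hf.contDiffAt (hΩ.mem_nhds hy)).mul h.1.contDiffAt
  · have : (fun y => f y * η y) =ᶠ[𝓝 y] fun _ => 0 :=
      notMem_tsupport_iff_eventuallyEq.1 fun hc => hy (h.3 (hs hc))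
    exact contDiffAt_const.congr_of_eventuallyEq this

lemma neg (h : IsTest Ω η) : IsTest Ω (fun y => -η y) :=
  ⟨h.1.neg, h.2.neg, by
    have : tsupport (fun y => -η y) = tsupport η := by
      simp only [tsupport]; congr 1; ext y; simp
    rw [this]; exact h.3⟩

lemma pd (h : IsTest Ω η) (i : Fin m) : IsTest Ω (pd i η) := by
  refine ⟨pd_contDiff h.1, h.2.fderiv_apply (𝕜 := ℝ) _, ?_⟩
  exact (tsupport_fderiv_apply_subset ℝ _).trans h.3

lemma integrable_mul (h : IsTest Ω η) (hp : 1 ≤ p) {u : EuclideanSpace ℝ (Fin m) → ℂ}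
    (hu : MemLpLocOn p Ω u) : Integrable (fun y => η y * u y) := by
  have hK := h.2.isCompact
  have h1 : IntegrableOn u (tsupport η) := by
    have : IsFiniteMeasure (volume.restrict (tsupport η)) :=
      ⟨by simpa using hK.measure_lt_top⟩
    exact (hu _ hK h.3).integrable hp
  have h2 : IntegrableOn (fun y => η y * u y) (tsupport η) := by
    obtain ⟨C, hC⟩ := h.1.continuous.bounded_above_of_compact_support h.2
    exact h1.bdd_mul h.1.continuous.aestronglyMeasurable (Filter.Eventually.of_forall hC)
  rw [← integrableOn_iff_integrable_of_support_subset (s := tsupport η)]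
  · exact h2
  · intro y hy
    exact subset_tsupport _ (left_ne_zero_of_mul hy)

end IsTest

lemma MemLpLocOn.of_continuousOn {u : EuclideanSpace ℝ (Fin m) → ℂ}
    (hu : ContinuousOn u Ω) : MemLpLocOn p Ω u := by
  intro K hK hKΩ
  have : IsFiniteMeasure (volume.restrict K) := ⟨by simpa using hK.measure_lt_top⟩
  obtain ⟨C, hC⟩ := hK.exists_bound_of_continuousOn (hu.mono hKΩ)
  refine MemLp.of_bound ((hu.mono hKΩ).aestronglyMeasurable hK.measurableSet) C ?_
  exact ae_restrict_of_forall_mem hK.measurableSet hC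

lemma MemLpLocOn.add {u v : EuclideanSpace ℝ (Fin m) → ℂ}
    (hu : MemLpLocOn p Ω u) (hv : MemLpLocOn p Ω v) : MemLpLocOn p Ω (fun y => u y + v y) :=
  fun K hK hKΩ => (hu K hK hKΩ).add (hv K hK hKΩ)

lemma MemLpLocOn.sub {u v : EuclideanSpace ℝ (Fin m) → ℂ}
    (hu : MemLpLocOn p Ω u) (hv : MemLpLocOn p Ω v) : MemLpLocOn p Ω (fun y => u y - v y) :=
  fun K hK hKΩ => (hu K hK hKΩ).sub (hv K hK hKΩ)

lemma MemLpLocOn.sum {ι : Type*} (s : Finset ι) {u : ι → EuclideanSpace ℝ (Fin m) → ℂ}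
    (hu : ∀ k ∈ s, MemLpLocOn p Ω (u k)) : MemLpLocOn p Ω (fun y => ∑ k ∈ s, u k y) :=
  fun K hK hKΩ => memLp_finsetSum s fun k hk => hu k hk K hK hKΩ

lemma MemLpLocOn.mul_left {f u : EuclideanSpace ℝ (Fin m) → ℂ} (hf : ContinuousOn f Ω)
    (hu : MemLpLocOn p Ω u) : MemLpLocOn p Ω (fun y => f y * u y) := by
  intro K hK hKΩ
  obtain ⟨C, hC⟩ := hK.exists_bound_of_continuousOn (hf.mono hKΩ)
  refine (hu K hK hKΩ).of_le_mul (c := C)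
    (((hf.mono hKΩ).aestronglyMeasurable hK.measurableSet).mul (hu K hK hKΩ).1) ?_
  refine ae_restrict_of_forall_mem hK.measurableSet fun y hy => ?_
  rw [norm_mul]
  exact mul_le_mul_of_nonneg_right (hC y hy) (norm_nonneg _)

lemma MemLpLocOn.congr {u v : EuclideanSpace ℝ (Fin m) → ℂ}
    (hu : MemLpLocOn p Ω u) (h : ∀ᵐ y, y ∈ Ω → u y = v y) : MemLpLocOn p Ω v := by
  intro K hK hKΩ
  refine (memLp_congr_ae ?_).1 (hu K hK hKΩ)
  rw [Filter.EventuallyEq, ae_restrict_iff' hK.measurableSet]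
  exact h.mono fun y hy hyK => hy (hKΩ hyK)

lemma MemLpLocOn.locallyIntegrableOn {u : EuclideanSpace ℝ (Fin m) → ℂ} (hΩ : IsOpen Ω)
    (hp : 1 ≤ p) (hu : MemLpLocOn p Ω u) : LocallyIntegrableOn u Ω := by
  rw [locallyIntegrableOn_iff hΩ.isLocallyClosed]
  intro K hKΩ hK
  have : IsFiniteMeasure (volume.restrict K) := ⟨by simpa using hK.measure_lt_top⟩
  exact (hu K hK hKΩ).integrable hp

lemma integral_test_mul_congr {u v η : EuclideanSpace ℝ (Fin m) → ℂ} (hη : IsTest Ω η)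
    (h : ∀ᵐ y, y ∈ Ω → u y = v y) : ∫ y, η y * u y = ∫ y, η y * v y := by
  refine integral_congr_ae (h.mono fun y hy => ?_)
  by_cases hyt : y ∈ tsupport η
  · simp only [hy (hη.3 hyt)]
  · simp only [image_eq_zero_of_notMem_tsupport hyt, zero_mul]

/-- The fundamental lemma of the calculus of variations; real test functions, viewed as complex
ones, already suffice. -/
lemma ae_eq_of_integral_test {u v : EuclideanSpace ℝ (Fin m) → ℂ} (hΩ : IsOpen Ω) (hp : 1 ≤ p)
    (hu : MemLpLocOn p Ω u) (hv : MemLpLocOn p Ω v)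
    (h : ∀ η, IsTest Ω η → ∫ y, η y * u y = ∫ y, η y * v y) :
    ∀ᵐ y, y ∈ Ω → u y = v y := by
  have := hΩ.ae_eq_zero_of_integral_contDiff_smul_eq_zero (μ := volume)
    ((hu.sub hv).locallyIntegrableOn hΩ hp) (fun g hg hgc hgs => by
      have hη : IsTest Ω (fun y => (g y : ℂ)) :=
        ⟨Complex.ofRealCLM.contDiff.comp hg, hgc.comp_left (g := ((↑) : ℝ → ℂ)) (by simp), by
          refine (closure_mono fun y hy => ?_).trans hgs
          simpa using hy⟩
      have h1 := h _ hη
      rw [← sub_eq_zero, ← integral_sub (hη.integrable_mul hp hu) (hη.integrable_mul hp hv)] at h1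
      rw [← h1]
      congr 1 with y
      simp [mul_sub])
  exact this.mono fun y hy hyΩ => sub_eq_zero.1 (hy hyΩ)

/-- Integration by parts against a test function. -/
lemma integral_pd_mul (hΩ : IsOpen Ω) {i : Fin m} {η f : EuclideanSpace ℝ (Fin m) → ℂ}
    (hη : IsTest Ω η) (hf : ContDiffOn ℝ ∞ f Ω) :
    ∫ y, pd i η y * f y = -∫ y, η y * pd i f y := by
  have h1 : IsTest Ω (fun y => f y * η y) := hη.mul_left hΩ hf
  -- A derivative of a compactly supported function integrates to zero: this is integration by parts
  -- against the constant `1`.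
  have h2 : ∫ y, pd i (fun y => f y * η y) y = 0 := by
    have := integral_bilinear_hasLineDerivAt_right_eq_neg_left_of_integrable
      (μ := (volume : Measure (EuclideanSpace ℝ (Fin m)))) (f := fun _ => (1 : ℂ))
      (f' := fun _ => (0 : ℂ))
      (g := fun y => f y * η y) (g' := pd i (fun y => f y * η y))
      (v := EuclideanSpace.single i (1 : ℝ)) (B := ContinuousLinearMap.mul ℝ ℂ)
      (by simp)
      (by simpa using! (h1.pd i).1.continuous.integrable_of_hasCompactSupport (h1.pd i).2)
      (by simpa using! h1.1.continuous.integrable_of_hasCompactSupport h1.2)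
      (fun y _ => by simpa using (hasFDerivAt_const (𝕜 := ℝ) (1 : ℂ) y).hasLineDerivAt _)
      (fun y _ => (h1.1.differentiable (by simp) y).hasFDerivAt.hasLineDerivAt _)
    simpa using this
  have h3 : ∀ y, pd i (fun y => f y * η y) y = η y * pd i f y + pd i η y * f y := by
    intro y
    by_cases hy : y ∈ Ω
    · rw [pd_mul (differentiableAt_of_contDiffOn hΩ hf hy) (hη.1.differentiable (by simp) y)]
      ring
    · have hy1 : y ∉ tsupport η := fun hc => hy (hη.3 hc)
      have hy2 : y ∉ tsupport (pd i η) := fun hc => hy ((hη.pd i).3 hc)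
      have hy3 : y ∉ tsupport (pd i fun y => f y * η y) := fun hc => hy ((h1.pd i).3 hc)
      simp [image_eq_zero_of_notMem_tsupport hy1, image_eq_zero_of_notMem_tsupport hy2,
        image_eq_zero_of_notMem_tsupport hy3]
  simp only [h3] at h2
  rw [integral_add] at h2
  · linear_combination h2
  · exact hη.integrable_mul (p := 1) le_rfl
      (MemLpLocOn.of_continuousOn (pd_contDiffOn hΩ hf).continuousOn)
  · exact (hη.pd i).integrable_mul (p := 1) le_rfl (MemLpLocOn.of_continuousOn hf.continuousOn)

lemma WeakPD.of_contDiffOn (hΩ : IsOpen Ω) {i : Fin m} {f : EuclideanSpace ℝ (Fin m) → ℂ}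
    (hf : ContDiffOn ℝ ∞ f Ω) : WeakPD Ω i f (pd i f) :=
  fun _ hη => integral_pd_mul hΩ hη hf

lemma WeakPD.add {i : Fin m} {u v u' v' : EuclideanSpace ℝ (Fin m) → ℂ} (hp : 1 ≤ p)
    (hu : MemLpLocOn p Ω u) (hv : MemLpLocOn p Ω v) (hu' : MemLpLocOn p Ω u')
    (hv' : MemLpLocOn p Ω v') (h : WeakPD Ω i u u') (h' : WeakPD Ω i v v') :
    WeakPD Ω i (fun y => u y + v y) (fun y => u' y + v' y) := by
  intro η hη
  simp only [mul_add]
  rw [integral_add ((hη.pd i).integrable_mul hp hu) ((hη.pd i).integrable_mul hp hv),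
    integral_add (hη.integrable_mul hp hu') (hη.integrable_mul hp hv'), h η hη, h' η hη]
  ring

/-- The smooth factor is absorbed into the test function: the weak identity for `u` is tested with
`f η`, and the classical product rule is applied to `∂_i (f η)`. -/
lemma WeakPD.mul_left (hΩ : IsOpen Ω) {i : Fin m} {f u u' : EuclideanSpace ℝ (Fin m) → ℂ}
    (hp : 1 ≤ p) (hf : ContDiffOn ℝ ∞ f Ω) (hu : MemLpLocOn p Ω u) (hu' : MemLpLocOn p Ω u')
    (h : WeakPD Ω i u u') :
    WeakPD Ω i (fun y => f y * u y) (fun y => pd i f y * u y + f y * u' y) := by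
  intro η hη
  have h1 : IsTest Ω (fun y => f y * η y) := hη.mul_left hΩ hf
  have h2 := h _ h1
  have h3 : ∀ y, pd i (fun y => f y * η y) y * u y
      = pd i η y * (f y * u y) + η y * (pd i f y * u y) := by
    intro y
    by_cases hy : y ∈ Ω
    · rw [pd_mul (differentiableAt_of_contDiffOn hΩ hf hy) (hη.1.differentiable (by simp) y)]
      ring
    · have hy1 : y ∉ tsupport η := fun hc => hy (hη.3 hc)
      have hy2 : y ∉ tsupport (pd i η) := fun hc => hy ((hη.pd i).3 hc)
      have hy3 : y ∉ tsupport (pd i fun y => f y * η y) := fun hc => hy ((h1.pd i).3 hc)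
      simp [image_eq_zero_of_notMem_tsupport hy1, image_eq_zero_of_notMem_tsupport hy2,
        image_eq_zero_of_notMem_tsupport hy3]
  have i1 := (hη.pd i).integrable_mul hp (hu.mul_left hf.continuousOn)
  have i2 := hη.integrable_mul hp (hu.mul_left (pd_contDiffOn (i := i) hΩ hf).continuousOn)
  have i3 := hη.integrable_mul hp (hu'.mul_left hf.continuousOn)
  simp only [h3] at h2
  rw [integral_add i1 i2] at h2
  simp only [mul_add]
  rw [integral_add i2 i3]
  have h4 : ∫ y, f y * η y * u' y = ∫ y, η y * (f y * u' y) := by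
    congr 1 with y; ring
  rw [h4] at h2
  linear_combination h2

lemma WeakPD.congr {i : Fin m} {u v u' v' : EuclideanSpace ℝ (Fin m) → ℂ}
    (h : WeakPD Ω i u v) (hu : ∀ᵐ y, y ∈ Ω → u y = u' y) (hv : ∀ᵐ y, y ∈ Ω → v y = v' y) :
    WeakPD Ω i u' v' := by
  intro η hη
  rw [← integral_test_mul_congr (hη.pd i) hu, ← integral_test_mul_congr hη hv]
  exact h η hη

lemma WeakPD.unique {i : Fin m} {u v v' : EuclideanSpace ℝ (Fin m) → ℂ} (hΩ : IsOpen Ω)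
    (hp : 1 ≤ p) (hv : MemLpLocOn p Ω v) (hv' : MemLpLocOn p Ω v')
    (h : WeakPD Ω i u v) (h' : WeakPD Ω i u v') : ∀ᵐ y, y ∈ Ω → v y = v' y :=
  ae_eq_of_integral_test hΩ hp hv hv' fun η hη => by
    have := (h η hη).symm.trans (h' η hη)
    exact neg_injective this

end EuclideanTools


/-! ### First order systems of component functions -/

section Towers

variable {m ℓ : ℕ}

/-- Index of a component of a section of `(T*M)^{⊗ j} ⊗ E`. -/
abbrev Idx (m ℓ j : ℕ) : Type := (Fin j → Fin m) × Fin ℓ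

/-- The index `(i, κ)`. -/
def Idx.cons {j : ℕ} (i : Fin m) (κ : Idx m ℓ j) : Idx m ℓ (j + 1) := (Fin.cons i κ.1, κ.2)

lemma Idx.cons_tail {j : ℕ} (κ : Idx m ℓ (j + 1)) :
    Idx.cons (κ.1 0) (Fin.tail κ.1, κ.2) = κ := by
  ext : 1
  · exact Fin.cons_self_tail κ.1
  · rfl

lemma Idx.sum_succ {j : ℕ} {A : Type*} [AddCommMonoid A] (f : Idx m ℓ (j + 1) → A) :
    ∑ κ, f κ = ∑ i, ∑ κ, f (Idx.cons i κ) := by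
  rw [← Fintype.sum_prod_type']
  refine (Fintype.sum_equiv (ι := Fin m × Idx m ℓ j)
    ⟨fun x => Idx.cons x.1 x.2, fun κ => (κ.1 0, (Fin.tail κ.1, κ.2)), fun x => ?_, fun κ => ?_⟩
    _ _ fun x => rfl).symm
  · simp [Idx.cons]
  · exact Idx.cons_tail κ

/-- Zeroth order coefficients of a first order system. -/
abbrev Coefs (m ℓ : ℕ) : Type :=
  ∀ j, Fin m → Idx m ℓ j → Idx m ℓ j → EuclideanSpace ℝ (Fin m) → ℂ

/-- A family of component functions of all orders. -/
abbrev Comps (m ℓ : ℕ) : Type := ∀ j, Idx m ℓ j → EuclideanSpace ℝ (Fin m) → ℂ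

/-- Smooth solutions of `H_{j+1, (i, κ)} = ∂_i H_{j, κ} + ∑ Q H_j` on `Ω`. -/
structure IsTower (Ω : Set (EuclideanSpace ℝ (Fin m))) (Q : Coefs m ℓ) (H : Comps m ℓ) : Prop where
  smooth : ∀ j κ, ContDiffOn ℝ ∞ (H j κ) Ω
  step : ∀ j i κ, ∀ y ∈ Ω, H (j + 1) (Idx.cons i κ) y
    = pd i (H j κ) y + ∑ κ', Q j i κ κ' y * H j κ' y

/-- Weak solutions of the same system, up to order `s`. -/
structure IsWeakTower (Ω : Set (EuclideanSpace ℝ (Fin m))) (Q : Coefs m ℓ) (s : ℕ) (p : ℝ≥0∞)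
    (G : Comps m ℓ) : Prop where
  memLp : ∀ j ≤ s, ∀ κ, MemLpLocOn p Ω (G j κ)
  step : ∀ j < s, ∀ i κ, WeakPD Ω i (G j κ)
    (fun y => G (j + 1) (Idx.cons i κ) y - ∑ κ', Q j i κ κ' y * G j κ' y)

/-- The formal adjoint of one step of the system. -/
noncomputable def adjStep (Q : Coefs m ℓ) (j : ℕ)
    (η : Idx m ℓ (j + 1) → EuclideanSpace ℝ (Fin m) → ℂ) :
    Idx m ℓ j → EuclideanSpace ℝ (Fin m) → ℂ := fun κ y =>
  ∑ i, (-pd i (η (Idx.cons i κ)) y + ∑ κ', Q j i κ' κ y * η (Idx.cons i κ') y)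

/-- The formal adjoint of `j` steps of the system. -/
noncomputable def adj (Q : Coefs m ℓ) : (j : ℕ) → (Idx m ℓ j → EuclideanSpace ℝ (Fin m) → ℂ) →
    (Idx m ℓ 0 → EuclideanSpace ℝ (Fin m) → ℂ)
  | 0, η => η
  | j + 1, η => adj Q j (adjStep Q j η)

variable {Ω : Set (EuclideanSpace ℝ (Fin m))} {p : ℝ≥0∞} {Q : Coefs m ℓ}

lemma IsTest.adjStep (hΩ : IsOpen Ω) (hQ : ∀ j i κ κ', ContDiffOn ℝ ∞ (Q j i κ κ') Ω) {j : ℕ}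
    {η : Idx m ℓ (j + 1) → EuclideanSpace ℝ (Fin m) → ℂ} (hη : ∀ κ, IsTest Ω (η κ))
    (κ : Idx m ℓ j) : IsTest Ω (adjStep Q j η κ) :=
  IsTest.sum _ fun i _ => ((hη _).pd i).neg.add
    (IsTest.sum _ fun κ' _ => (hη _).mul_left hΩ (hQ _ _ _ _))

lemma IsTest.adj (hΩ : IsOpen Ω) (hQ : ∀ j i κ κ', ContDiffOn ℝ ∞ (Q j i κ κ') Ω) :
    ∀ {j : ℕ} {η : Idx m ℓ j → EuclideanSpace ℝ (Fin m) → ℂ}, (∀ κ, IsTest Ω (η κ)) →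
    ∀ κ, IsTest Ω (adj Q j η κ)
  | 0, _, hη => hη
  | j + 1, η, hη => IsTest.adj (η := CovSobolev.adjStep Q j η) hΩ hQ (IsTest.adjStep hΩ hQ hη)

/-- `∑ ∫ (adjStep η) G` written out in terms of the right hand side of the system. -/
lemma sum_integral_adjStep (hQ : ∀ j i κ κ', ContDiffOn ℝ ∞ (Q j i κ κ') Ω)
    (hp : 1 ≤ p) {j : ℕ} {η : Idx m ℓ (j + 1) → EuclideanSpace ℝ (Fin m) → ℂ}
    (hη : ∀ κ, IsTest Ω (η κ)) {G : Idx m ℓ j → EuclideanSpace ℝ (Fin m) → ℂ}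
    (hG : ∀ κ, MemLpLocOn p Ω (G κ)) :
    ∑ κ, ∫ y, adjStep Q j η κ y * G κ y = ∑ i, ∑ κ, (-(∫ y, pd i (η (Idx.cons i κ)) y * G κ y)
      + ∫ y, η (Idx.cons i κ) y * ∑ κ', Q j i κ κ' y * G κ' y) := by
  have h1 : ∀ κ, ∫ y, adjStep Q j η κ y * G κ y
      = ∑ i, (-(∫ y, pd i (η (Idx.cons i κ)) y * G κ y)
        + ∑ κ', ∫ y, η (Idx.cons i κ') y * (Q j i κ' κ y * G κ y)) := by
    intro κ
    have i1 : ∀ i, Integrable fun y => pd i (η (Idx.cons i κ)) y * G κ y := fun i =>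
      ((hη _).pd i).integrable_mul hp (hG κ)
    have i2 : ∀ i κ', Integrable fun y => η (Idx.cons i κ') y * (Q j i κ' κ y * G κ y) :=
      fun i κ' => (hη _).integrable_mul hp ((hG κ).mul_left (hQ _ _ _ _).continuousOn)
    have h2 : ∀ y, adjStep Q j η κ y * G κ y = ∑ i, (-(pd i (η (Idx.cons i κ)) y * G κ y)
        + ∑ κ', η (Idx.cons i κ') y * (Q j i κ' κ y * G κ y)) := by
      intro y
      simp only [CovSobolev.adjStep, Finset.sum_mul, add_mul]
      refine Finset.sum_congr rfl fun i _ => ?_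
      congr 1
      · ring
      · exact Finset.sum_congr rfl fun κ' _ => by ring
    simp only [h2]
    rw [integral_finsetSum]
    · refine Finset.sum_congr rfl fun i _ => ?_
      rw [integral_add (f := fun y => -(pd i (η (Idx.cons i κ)) y * G κ y)) (i1 i).neg
        (integrable_finsetSum _ fun κ' _ => i2 i κ'), integral_neg,
        integral_finsetSum _ fun κ' _ => i2 i κ']
    · exact fun i _ => (i1 i).neg.add (integrable_finsetSum _ fun κ' _ => i2 i κ')
  simp only [h1]
  rw [Finset.sum_comm]
  refine Finset.sum_congr rfl fun i _ => ?_
  rw [Finset.sum_add_distrib, Finset.sum_add_distrib]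
  congr 1
  rw [Finset.sum_comm]
  refine Finset.sum_congr rfl fun κ _ => ?_
  rw [← integral_finsetSum _ fun κ' _ =>
    (hη _).integrable_mul hp ((hG κ').mul_left (hQ _ _ _ _).continuousOn)]
  simp only [Finset.mul_sum]

/-- A single integration by parts, with the coefficient matrix transposed by interchanging the two
component sums. -/
lemma IsTower.sum_integral_adjStep (hΩ : IsOpen Ω)
    (hQ : ∀ j i κ κ', ContDiffOn ℝ ∞ (Q j i κ κ') Ω) {H : Comps m ℓ} (hH : IsTower Ω Q H) {j : ℕ}
    {η : Idx m ℓ (j + 1) → EuclideanSpace ℝ (Fin m) → ℂ} (hη : ∀ κ, IsTest Ω (η κ)) :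
    ∑ κ, ∫ y, η κ y * H (j + 1) κ y = ∑ κ, ∫ y, adjStep Q j η κ y * H j κ y := by
  have hL : ∀ j κ, MemLpLocOn 1 Ω (H j κ) := fun j κ =>
    MemLpLocOn.of_continuousOn (hH.smooth j κ).continuousOn
  rw [CovSobolev.sum_integral_adjStep hQ le_rfl hη (hL j), Idx.sum_succ]
  refine Finset.sum_congr rfl fun i _ => Finset.sum_congr rfl fun κ _ => ?_
  rw [integral_pd_mul hΩ (hη _) (hH.smooth j κ), neg_neg, ← integral_add]
  · refine (integral_test_mul_congr (hη _) (Filter.Eventually.of_forall fun y hy => ?_)).trans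
      (integral_congr_ae (Filter.Eventually.of_forall fun y => mul_add _ _ _))
    exact hH.step j i κ y hy
  · exact (hη _).integrable_mul (p := 1) le_rfl
      (MemLpLocOn.of_continuousOn (pd_contDiffOn hΩ (hH.smooth j κ)).continuousOn)
  · exact (hη _).integrable_mul (p := 1) le_rfl
      (MemLpLocOn.sum _ fun κ' _ => (hL j κ').mul_left (hQ _ _ _ _).continuousOn)

/-- The steps are moved onto the test functions one at a time, beginning with the last derivative
taken. This identifies `adj` as the coordinate form of the formal adjoint of `∇^j`. -/
lemma IsTower.sum_integral_adj (hΩ : IsOpen Ω)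
    (hQ : ∀ j i κ κ', ContDiffOn ℝ ∞ (Q j i κ κ') Ω) {H : Comps m ℓ} (hH : IsTower Ω Q H) :
    ∀ {j : ℕ} {η : Idx m ℓ j → EuclideanSpace ℝ (Fin m) → ℂ}, (∀ κ, IsTest Ω (η κ)) →
    ∑ κ, ∫ y, η κ y * H j κ y = ∑ κ, ∫ y, adj Q j η κ y * H 0 κ y
  | 0, _, _ => rfl
  | j + 1, η, hη => by
    rw [hH.sum_integral_adjStep hΩ hQ hη]
    exact hH.sum_integral_adj hΩ hQ fun κ => IsTest.adjStep hΩ hQ hη κ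

/-- A family which satisfies the integrated form of the system is a weak solution. -/
lemma IsWeakTower.of_adj (hΩ : IsOpen Ω) (hQ : ∀ j i κ κ', ContDiffOn ℝ ∞ (Q j i κ κ') Ω)
    (hp : 1 ≤ p) {s : ℕ} {G : Comps m ℓ} (hG : ∀ j ≤ s, ∀ κ, MemLpLocOn p Ω (G j κ))
    (h : ∀ j ≤ s, ∀ η : Idx m ℓ j → EuclideanSpace ℝ (Fin m) → ℂ, (∀ κ, IsTest Ω (η κ)) →
      ∑ κ, ∫ y, η κ y * G j κ y = ∑ κ, ∫ y, adj Q j η κ y * G 0 κ y) :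
    IsWeakTower Ω Q s p G := by
  classical
  refine ⟨hG, fun j hj i κ η hη => ?_⟩
  -- Only one component of `ζ` is nonzero. Both `ζ` at order `j + 1` and its one-step adjoint at
  -- order `j` are admissible, and `adj` sends them to the same family. Hence the two pairings
  -- agree, and their equality is the single equation to be proved.
  set ζ : Idx m ℓ (j + 1) → EuclideanSpace ℝ (Fin m) → ℂ :=
    fun κ' => if κ' = Idx.cons i κ then η else fun _ => 0 with hζ
  have hζt : ∀ κ', IsTest Ω (ζ κ') := by
    intro κ'
    simp only [hζ]
    split_ifs
    exacts [hη, IsTest.zero]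
  have h1 := h (j + 1) hj ζ hζt
  have h2 := h j hj.le (adjStep Q j ζ) (fun κ' => IsTest.adjStep hΩ hQ hζt κ')
  have h3 := (h1.trans h2.symm).trans (sum_integral_adjStep hQ hp hζt (hG j hj.le))
  rw [Idx.sum_succ, ← sub_eq_zero, ← Finset.sum_sub_distrib] at h3
  simp only [← Finset.sum_sub_distrib] at h3
  have hinj : ∀ i' κ', Idx.cons i' κ' = Idx.cons i κ → i' = i ∧ κ' = κ := by
    intro i' κ' hc
    simp only [Idx.cons, Prod.mk.injEq] at hc
    obtain ⟨h4, h5⟩ := Fin.cons_inj.1 hc.1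
    exact ⟨h4, Prod.ext h5 hc.2⟩
  rw [Finset.sum_eq_single i, Finset.sum_eq_single κ] at h3
  · simp only [hζ, if_true] at h3
    simp only [mul_sub]
    rw [integral_sub]
    · linear_combination h3
    · exact hη.integrable_mul hp (hG _ hj _)
    · exact hη.integrable_mul hp
        (MemLpLocOn.sum _ fun κ' _ => (hG j hj.le κ').mul_left (hQ _ _ _ _).continuousOn)
  · intro κ' _ hne
    have : ζ (Idx.cons i κ') = fun _ => 0 := if_neg fun hc => hne (hinj _ _ hc).2
    simp [this, pd]
  · simp
  · intro i' _ hne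
    refine Finset.sum_eq_zero fun κ' _ => ?_
    have : ζ (Idx.cons i' κ') = fun _ => 0 := if_neg fun hc => hne (hinj _ _ hc).1
    simp [this, pd]
  · simp

/-- If order `j` vanishes, the next order is a weak derivative of the zero function, up to terms
which also vanish; uniqueness of weak derivatives finishes the induction. -/
lemma IsWeakTower.eq_zero {s : ℕ} (hΩ : IsOpen Ω) (hp : 1 ≤ p)
    (hQ : ∀ j i κ κ', ContDiffOn ℝ ∞ (Q j i κ κ') Ω) {G : Comps m ℓ}
    (hG : IsWeakTower Ω Q s p G) (h0 : ∀ κ, ∀ᵐ y, y ∈ Ω → G 0 κ y = 0) :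
    ∀ j ≤ s, ∀ κ, ∀ᵐ y, y ∈ Ω → G j κ y = 0 := by
  intro j
  induction j with
  | zero => exact fun _ => h0
  | succ j ih =>
    intro hj κ
    have ih' := ih (by omega)
    rw [← Idx.cons_tail κ]
    set i := κ.1 0
    set κ₀ : Idx m ℓ j := (Fin.tail κ.1, κ.2)
    have h1 := (hG.step j (by omega) i κ₀).congr (ih' κ₀)
      (v' := fun y => G (j + 1) (Idx.cons i κ₀) y - ∑ κ', Q j i κ₀ κ' y * G j κ' y)
      (Filter.Eventually.of_forall fun y _ => rfl)
    have h2 : WeakPD Ω i (fun _ => 0) (fun _ => 0) := by intro η _; simp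
    have h3 := WeakPD.unique hΩ hp ((hG.memLp (j + 1) hj _).sub
      (MemLpLocOn.sum _ fun κ' _ => (hG.memLp j (by omega) κ').mul_left
        (hQ j i κ₀ κ').continuousOn))
      (MemLpLocOn.of_continuousOn continuousOn_const) h1 h2
    have h4 : ∀ᵐ y, ∀ κ', y ∈ Ω → G j κ' y = 0 := ae_all_iff.2 ih'
    filter_upwards [h3, h4] with y hy hy' hyΩ
    have := hy hyΩ
    rw [Finset.sum_eq_zero fun κ' _ => by rw [hy' κ' hyΩ, mul_zero], sub_zero] at this
    exact this

/-! ### Local Sobolev spaces defined by recursion -/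

/-- `W^{k,p}_loc(Ω)` by recursion on `k`. -/
def Sob (Ω : Set (EuclideanSpace ℝ (Fin m))) (p : ℝ≥0∞) :
    ℕ → (EuclideanSpace ℝ (Fin m) → ℂ) → Prop
  | 0, u => MemLpLocOn p Ω u
  | k + 1, u => MemLpLocOn p Ω u ∧ ∀ i, ∃ v, WeakPD Ω i u v ∧ Sob Ω p k v

lemma Sob.memLp : ∀ {k : ℕ} {u : EuclideanSpace ℝ (Fin m) → ℂ}, Sob Ω p k u → MemLpLocOn p Ω u
  | 0, _, h => h
  | _ + 1, _, h => h.1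

lemma Sob.of_succ : ∀ {k : ℕ} {u : EuclideanSpace ℝ (Fin m) → ℂ}, Sob Ω p (k + 1) u → Sob Ω p k u
  | 0, _, h => h.1
  | _ + 1, _, h => ⟨h.1, fun i => let ⟨v, hv, hv'⟩ := h.2 i; ⟨v, hv, hv'.of_succ⟩⟩

lemma Sob.add (hp : 1 ≤ p) : ∀ {k : ℕ} {u v : EuclideanSpace ℝ (Fin m) → ℂ},
    Sob Ω p k u → Sob Ω p k v → Sob Ω p k (fun y => u y + v y)
  | 0, _, _, h, h' => MemLpLocOn.add h h'
  | _ + 1, _, _, h, h' => ⟨h.1.add h'.1, fun i => by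
      obtain ⟨u₁, hu, hu'⟩ := h.2 i
      obtain ⟨v₁, hv, hv'⟩ := h'.2 i
      exact ⟨_, hu.add hp h.1 h'.1 hu'.memLp hv'.memLp hv, hu'.add hp hv'⟩⟩

lemma Sob.mul_left (hΩ : IsOpen Ω) (hp : 1 ≤ p) : ∀ {k : ℕ} {f u : EuclideanSpace ℝ (Fin m) → ℂ},
    ContDiffOn ℝ ∞ f Ω → Sob Ω p k u → Sob Ω p k (fun y => f y * u y)
  | 0, _, _, hf, h => MemLpLocOn.mul_left hf.continuousOn h
  | _ + 1, _, _, hf, h => ⟨h.1.mul_left hf.continuousOn, fun i => by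
      obtain ⟨u₁, hu, hu'⟩ := h.2 i
      exact ⟨_, hu.mul_left hΩ hp hf h.1 hu'.memLp,
        (Sob.mul_left hΩ hp (pd_contDiffOn hΩ hf) h.of_succ).add hp
          (Sob.mul_left hΩ hp hf hu')⟩⟩

lemma Sob.of_contDiffOn (hΩ : IsOpen Ω) : ∀ {k : ℕ} {f : EuclideanSpace ℝ (Fin m) → ℂ},
    ContDiffOn ℝ ∞ f Ω → Sob Ω p k f
  | 0, _, hf => MemLpLocOn.of_continuousOn hf.continuousOn
  | _ + 1, _, hf => ⟨MemLpLocOn.of_continuousOn hf.continuousOn, fun i =>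
      ⟨_, WeakPD.of_contDiffOn (i := i) hΩ hf, Sob.of_contDiffOn hΩ (pd_contDiffOn hΩ hf)⟩⟩

lemma Sob.sum (hΩ : IsOpen Ω) (hp : 1 ≤ p) {k : ℕ} {ι : Type*} (s : Finset ι)
    {u : ι → EuclideanSpace ℝ (Fin m) → ℂ} (h : ∀ a ∈ s, Sob Ω p k (u a)) :
    Sob Ω p k (fun y => ∑ a ∈ s, u a y) := by
  classical
  induction s using Finset.induction_on with
  | empty => simpa using Sob.of_contDiffOn hΩ (f := fun _ => 0) contDiffOn_const
  | insert a s ha ih =>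
    simp only [Finset.sum_insert ha]
    exact (h a (by simp)).add hp (ih fun k hk => h k (by simp [hk]))

/-- Covariant order is traded for Sobolev order. The system expresses `∂_i G_j` through `G_{j+1}`
and `G_j` with smooth coefficients, and both have Sobolev order `k` by induction, so `G_j` has order
`k + 1`. The induction on `k` must therefore run over all `j` simultaneously. -/
lemma IsWeakTower.sob (hΩ : IsOpen Ω) (hQ : ∀ j i κ κ', ContDiffOn ℝ ∞ (Q j i κ κ') Ω)
    (hp : 1 ≤ p) {s : ℕ} {G : Comps m ℓ} (hG : IsWeakTower Ω Q s p G) :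
    ∀ k j, j + k ≤ s → ∀ κ, Sob Ω p k (G j κ) := by
  intro k
  induction k with
  | zero => exact fun j hj κ => hG.memLp j (by omega) κ
  | succ k ih =>
    intro j hj κ
    refine ⟨hG.memLp j (by omega) κ, fun i => ⟨_, hG.step j (by omega) i κ, ?_⟩⟩
    have h1 : Sob Ω p k (fun y => G (j + 1) (Idx.cons i κ) y
        + ∑ κ', (-Q j i κ κ' y) * G j κ' y) :=
      (ih (j + 1) (by omega) _).add hp (Sob.sum hΩ hp _ fun κ' _ =>
        Sob.mul_left hΩ hp (hQ _ _ _ _).neg (ih j (by omega) κ'))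
    simpa [Finset.sum_neg_distrib, sub_eq_add_neg] using h1

lemma IsTest.of_real {η : EuclideanSpace ℝ (Fin m) → ℝ} (h : ContDiff ℝ ∞ η)
    (hc : HasCompactSupport η) (hs : tsupport η ⊆ Ω) : IsTest Ω (fun y => (η y : ℂ)) :=
  ⟨Complex.ofRealCLM.contDiff.comp h, hc.comp_left (g := ((↑) : ℝ → ℂ)) (by simp),
    (closure_mono fun y hy => by simpa using hy).trans hs⟩

lemma contDiff_partialDeriv {k : ℕ} (α : Fin k → Fin m) {η : EuclideanSpace ℝ (Fin m) → ℝ}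
    (h : ContDiff ℝ ∞ η) : ContDiff ℝ ∞ (partialDeriv α η) := by
  have h1 : ContDiff ℝ ∞ (iteratedFDeriv ℝ k η) :=
    h.iteratedFDeriv_right (m := ∞) (by exact_mod_cast le_top)
  exact (ContinuousMultilinearMap.apply ℝ (fun _ : Fin k => EuclideanSpace ℝ (Fin m)) ℝ
    (fun i => EuclideanSpace.single (α i) (1 : ℝ))).contDiff.comp h1

lemma tsupport_partialDeriv_subset {k : ℕ} (α : Fin k → Fin m)
    (η : EuclideanSpace ℝ (Fin m) → ℝ) : tsupport (partialDeriv α η) ⊆ tsupport η := by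
  refine (closure_mono fun y hy => ?_).trans (tsupport_iteratedFDeriv_subset (𝕜 := ℝ) k)
  simp only [Function.mem_support, partialDeriv] at hy ⊢
  exact fun hc => hy (by rw [hc]; simp)

lemma partialDeriv_succ {k : ℕ} (α : Fin (k + 1) → Fin m) {η : EuclideanSpace ℝ (Fin m) → ℝ}
    (h : ContDiff ℝ ∞ η) (y : EuclideanSpace ℝ (Fin m)) :
    (partialDeriv α η y : ℂ) = pd (α 0) (fun z => (partialDeriv (Fin.tail α) η z : ℂ)) y := by
  have h1 : ContDiff ℝ ∞ (iteratedFDeriv ℝ k η) :=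
    h.iteratedFDeriv_right (m := ∞) (by exact_mod_cast le_top)
  have h2 := (h1.differentiable (by simp) y).hasFDerivAt
  have h3 := (Complex.ofRealCLM.hasFDerivAt).comp y
    (((ContinuousMultilinearMap.apply ℝ (fun _ : Fin k => EuclideanSpace ℝ (Fin m)) ℝ
      (fun i => EuclideanSpace.single (Fin.tail α i) (1 : ℝ))).hasFDerivAt).comp y h2)
  have h4 : fderiv ℝ (fun z => (partialDeriv (Fin.tail α) η z : ℂ)) y = _ := h3.fderiv
  rw [pd, h4, partialDeriv, iteratedFDeriv_succ_apply_left]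
  rfl

/-- The outermost derivative `∂_{α 0}` of the test function is removed first, with `∂^{tail α} η` as
a new test function; every removal contributes one sign. -/
lemma Sob.exists_isWeakPartialDeriv : ∀ {k s : ℕ} {u : EuclideanSpace ℝ (Fin m) → ℂ}, k ≤ s →
    Sob Ω p s u → ∀ α : Fin k → Fin m, ∃ v, MemLpLocOn p Ω v ∧ IsWeakPartialDeriv Ω α u v
  | 0, s, u, _, h, α => ⟨u, h.memLp, fun η _ _ _ => by simp [partialDeriv]⟩
  | k + 1, 0, u, hk, _, _ => by omega
  | k + 1, s + 1, u, hk, h, α => by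
    obtain ⟨v₁, hv₁, hs₁⟩ := h.2 (α 0)
    obtain ⟨v, hv, hw⟩ := hs₁.exists_isWeakPartialDeriv (k := k) (by omega) (Fin.tail α)
    refine ⟨v, hv, fun η h1 h2 h3 => ?_⟩
    have hT : IsTest Ω (fun z => (partialDeriv (Fin.tail α) η z : ℂ)) :=
      IsTest.of_real (contDiff_partialDeriv _ h1)
        (h2.of_isClosed_subset (isClosed_tsupport _) (tsupport_partialDeriv_subset _ η))
        ((tsupport_partialDeriv_subset _ η).trans h3)
    simp only [partialDeriv_succ α h1]
    rw [hv₁ _ hT, hw η h1 h2 h3]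
    ring

lemma Sob.memSobolevLocOn {s : ℕ} {u : EuclideanSpace ℝ (Fin m) → ℂ} (h : Sob Ω p s u) :
    MemSobolevLocOn s p Ω u :=
  ⟨h.memLp, fun _ hk α => h.exists_isWeakPartialDeriv hk α⟩

/-! ### Multiplication of solutions by functions -/

/-- Linear differential operators of order at most `k`, written in terms of the components. -/
inductive TowerOp (Ω : Set (EuclideanSpace ℝ (Fin m))) :
    ℕ → (Comps m ℓ → EuclideanSpace ℝ (Fin m) → ℂ) → Prop
  | comp {k : ℕ} (j : ℕ) (hj : j ≤ k) (κ : Idx m ℓ j) : TowerOp Ω k fun H => H j κ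
  | zero {k : ℕ} : TowerOp Ω k fun _ _ => 0
  | add {k : ℕ} {L L'} : TowerOp Ω k L → TowerOp Ω k L' → TowerOp Ω k fun H y => L H y + L' H y
  | mul {k : ℕ} {L} (a : EuclideanSpace ℝ (Fin m) → ℂ) : ContDiffOn ℝ ∞ a Ω → TowerOp Ω k L →
      TowerOp Ω k fun H y => a y * L H y

namespace TowerOp

variable {L : Comps m ℓ → EuclideanSpace ℝ (Fin m) → ℂ} {k : ℕ}

lemma mono {k' : ℕ} (h : TowerOp Ω k L) (hk : k ≤ k') : TowerOp Ω k' L := by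
  induction h with
  | comp j hj κ => exact comp j (hj.trans hk) κ
  | zero => exact zero
  | add _ _ ih ih' => exact add ih ih'
  | mul a ha _ ih => exact mul a ha ih

lemma sum {ι : Type*} (s : Finset ι) {L : ι → Comps m ℓ → EuclideanSpace ℝ (Fin m) → ℂ}
    (h : ∀ a ∈ s, TowerOp Ω k (L a)) : TowerOp Ω k fun H y => ∑ a ∈ s, L a H y := by
  classical
  induction s using Finset.induction_on with
  | empty => simpa using zero
  | insert a s ha ih =>
    simp only [Finset.sum_insert ha]
    exact add (h a (by simp)) (ih fun k hk => h k (by simp [hk]))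

lemma contDiffOn (h : TowerOp Ω k L) {H : Comps m ℓ} (hH : IsTower Ω Q H) :
    ContDiffOn ℝ ∞ (L H) Ω := by
  induction h with
  | comp j hj κ => exact hH.smooth j κ
  | zero => exact contDiffOn_const
  | add _ _ ih ih' => exact ih.add ih'
  | mul a ha _ ih => exact ha.mul ih

/-- Along towers a partial derivative of a component can be eliminated through the system. The
resulting operator contains no derivatives but involves components of one order higher, and it is
the same for all towers. -/
lemma pd (hΩ : IsOpen Ω) (hQ : ∀ j i κ κ', ContDiffOn ℝ ∞ (Q j i κ κ') Ω) (h : TowerOp Ω k L)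
    (i : Fin m) : ∃ L', TowerOp Ω (k + 1) L' ∧ ∀ H, IsTower Ω Q H → ∀ y ∈ Ω,
      pd i (L H) y = L' H y := by
  induction h with
  | comp j hj κ =>
    refine ⟨fun H y => H (j + 1) (Idx.cons i κ) y + ∑ κ', (-Q j i κ κ' y) * H j κ' y,
      add (comp (j + 1) (by omega) _) (sum _ fun κ' _ => mul _ (hQ _ _ _ _).neg
        (comp j (by omega) κ')), fun H hH y hy => ?_⟩
    simp only
    rw [hH.step j i κ y hy]
    simp [Finset.sum_neg_distrib]
  | zero => exact ⟨_, zero, fun H _ y _ => by simp [CovSobolev.pd]⟩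
  | add h h' ih ih' =>
    obtain ⟨L₁, h1, h1'⟩ := ih
    obtain ⟨L₂, h2, h2'⟩ := ih'
    refine ⟨_, add h1 h2, fun H hH y hy => ?_⟩
    rw [pd_add (differentiableAt_of_contDiffOn hΩ (h.contDiffOn hH) hy)
      (differentiableAt_of_contDiffOn hΩ (h'.contDiffOn hH) hy), h1' H hH y hy, h2' H hH y hy]
  | mul a ha h ih =>
    obtain ⟨L₁, h1, h1'⟩ := ih
    refine ⟨_, add (mul _ (pd_contDiffOn (i := i) hΩ ha) (h.mono (Nat.le_succ _))) (mul a ha h1),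
      fun H hH y hy => ?_⟩
    rw [pd_mul (differentiableAt_of_contDiffOn hΩ ha hy)
      (differentiableAt_of_contDiffOn hΩ (h.contDiffOn hH) hy), h1' H hH y hy]

/-- Since these operators contain no derivatives, they are bounded pointwise by the components. The
constant depends only on the coefficients on `K` and not on `H`. -/
lemma bound {K : Set (EuclideanSpace ℝ (Fin m))} (hK : IsCompact K) (hKΩ : K ⊆ Ω)
    (h : TowerOp Ω k L) : ∃ C : ℝ, 0 ≤ C ∧ ∀ H, ∀ y ∈ K,
      ‖L H y‖ ≤ C * ∑ j ∈ Finset.range (k + 1), ∑ κ, ‖H j κ y‖ := by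
  induction h with
  | comp j hj κ =>
    refine ⟨1, zero_le_one, fun H y _ => ?_⟩
    rw [one_mul]
    refine le_trans ?_ (Finset.single_le_sum (f := fun j => ∑ κ, ‖H j κ y‖)
      (fun _ _ => Finset.sum_nonneg fun _ _ => norm_nonneg _) (show j ∈ _ from Finset.mem_range.2 (by omega)))
    exact Finset.single_le_sum (f := fun κ => ‖H j κ y‖) (fun _ _ => norm_nonneg _)
      (Finset.mem_univ κ)
  | zero => exact ⟨0, le_rfl, fun H y _ => by simp⟩
  | add _ _ ih ih' =>
    obtain ⟨C, hC, h1⟩ := ih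
    obtain ⟨C', hC', h2⟩ := ih'
    refine ⟨C + C', add_nonneg hC hC', fun H y hy => ?_⟩
    rw [add_mul]
    exact (norm_add_le _ _).trans (add_le_add (h1 H y hy) (h2 H y hy))
  | mul a ha _ ih =>
    obtain ⟨C, hC, h1⟩ := ih
    obtain ⟨A, hA⟩ := hK.exists_bound_of_continuousOn (ha.continuousOn.mono hKΩ)
    refine ⟨max A 0 * C, mul_nonneg (le_max_right _ _) hC, fun H y hy => ?_⟩
    rw [norm_mul, mul_assoc]
    exact mul_le_mul ((hA y hy).trans (le_max_left _ _)) (h1 H y hy) (norm_nonneg _)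
      (le_max_right _ _)

end TowerOp

/-- The components of `∇^j (θ f)` are differential operators applied to those of `f`. -/
lemma exists_towerOp_mul (hΩ : IsOpen Ω) (hQ : ∀ j i κ κ', ContDiffOn ℝ ∞ (Q j i κ κ') Ω)
    {θ : EuclideanSpace ℝ (Fin m) → ℂ} (hθ : ContDiffOn ℝ ∞ θ Ω) (j : ℕ) :
    ∀ κ : Idx m ℓ j, ∃ L, TowerOp Ω j L ∧ ∀ H H', IsTower Ω Q H → IsTower Ω Q H' →
      (∀ κ, ∀ y ∈ Ω, H' 0 κ y = θ y * H 0 κ y) → ∀ y ∈ Ω, H' j κ y = L H y := by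
  induction j with
  | zero => exact fun κ => ⟨_, .mul θ hθ (.comp 0 le_rfl κ), fun H H' _ _ h y hy => h κ y hy⟩
  | succ j ih =>
    intro κ
    rw [← Idx.cons_tail κ]
    set i := κ.1 0
    set κ₀ : Idx m ℓ j := (Fin.tail κ.1, κ.2)
    choose L hL hL' using ih
    obtain ⟨L₁, h1, h1'⟩ := (hL κ₀).pd hΩ hQ i
    refine ⟨_, .add h1 (.sum Finset.univ fun κ' _ => .mul _ (hQ j i κ₀ κ')
      ((hL κ').mono (Nat.le_succ j))), fun H H' hH hH' h y hy => ?_⟩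
    rw [hH'.step j i κ₀ y hy, pd_congr hΩ (hL' κ₀ H H' hH hH' h) hy, h1' H hH y hy]
    congr 1
    exact Finset.sum_congr rfl fun κ' _ => by rw [hL' κ' H H' hH hH' h y hy]

/-- This replaces an explicit Leibniz formula for `∇^j (θ f)`: a pointwise bound with a constant
independent of the section is all that gluing requires. -/
lemma exists_bound_tower_mul (hΩ : IsOpen Ω) (hQ : ∀ j i κ κ', ContDiffOn ℝ ∞ (Q j i κ κ') Ω)
    {θ : EuclideanSpace ℝ (Fin m) → ℂ} (hθ : ContDiffOn ℝ ∞ θ Ω)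
    {K : Set (EuclideanSpace ℝ (Fin m))} (hK : IsCompact K) (hKΩ : K ⊆ Ω) (j : ℕ) :
    ∃ C : ℝ, 0 ≤ C ∧ ∀ H H', IsTower Ω Q H → IsTower Ω Q H' →
      (∀ κ, ∀ y ∈ Ω, H' 0 κ y = θ y * H 0 κ y) → ∀ κ : Idx m ℓ j, ∀ y ∈ K,
      ‖H' j κ y‖ ≤ C * ∑ j' ∈ Finset.range (j + 1), ∑ κ', ‖H j' κ' y‖ := by
  choose L hL hL' using exists_towerOp_mul (Q := Q) (ℓ := ℓ) hΩ hQ hθ j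
  choose C hC hC' using fun κ => (hL κ).bound hK hKΩ
  refine ⟨∑ κ, C κ, Finset.sum_nonneg fun κ _ => hC κ, fun H H' hH hH' h κ y hy => ?_⟩
  rw [hL' κ H H' hH hH' h y (hKΩ hy)]
  refine (hC' κ H y hy).trans (mul_le_mul_of_nonneg_right ?_
    (Finset.sum_nonneg fun _ _ => Finset.sum_nonneg fun _ _ => norm_nonneg _))
  exact Finset.single_le_sum (fun κ _ => hC κ) (Finset.mem_univ κ)

end Towers


/-! ### Mollification -/

section Mollification

variable {m : ℕ}

/-- Mollification of `w` with the normed bump function of `φ`. -/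
noncomputable def moll (φ : ContDiffBump (0 : EuclideanSpace ℝ (Fin m)))
    (w : EuclideanSpace ℝ (Fin m) → ℂ) : EuclideanSpace ℝ (Fin m) → ℂ :=
  convolution w (fun t => (φ.normed volume t : ℂ)) (ContinuousLinearMap.mul ℝ ℂ) volume

variable (φ : ContDiffBump (0 : EuclideanSpace ℝ (Fin m))) {w : EuclideanSpace ℝ (Fin m) → ℂ}

lemma moll_apply (x : EuclideanSpace ℝ (Fin m)) :
    moll φ w x = ∫ t, (φ.normed volume (x - t) : ℂ) * w t := by
  simp [moll, convolution_def, mul_comm]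

/-- The form with a real kernel on the left is the one to which the estimates for bump function
convolutions apply. -/
lemma moll_eq_lsmul : moll φ w
    = convolution (φ.normed volume) w (ContinuousLinearMap.lsmul ℝ ℝ) volume := by
  ext x
  rw [moll_apply, convolution_eq_swap]
  simp

lemma contDiff_normedC : ContDiff ℝ ∞ (fun t => (φ.normed volume t : ℂ)) :=
  Complex.ofRealCLM.contDiff.comp φ.contDiff_normed

lemma hasCompactSupport_normedC : HasCompactSupport (fun t => (φ.normed volume t : ℂ)) :=
  φ.hasCompactSupport_normed.comp_left (g := ((↑) : ℝ → ℂ)) (by simp)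

lemma contDiff_moll (hw : LocallyIntegrable w) : ContDiff ℝ ∞ (moll φ w) :=
  (hasCompactSupport_normedC φ).contDiff_convolution_right (n := (⊤ : ℕ∞)) _ hw (contDiff_normedC φ)

lemma pd_moll (hw : LocallyIntegrable w) (i : Fin m) (x : EuclideanSpace ℝ (Fin m)) :
    pd i (moll φ w) x = ∫ t, pd i (fun t => (φ.normed volume t : ℂ)) (x - t) * w t := by
  have h := (hasCompactSupport_normedC φ).hasFDerivAt_convolution_right
    (ContinuousLinearMap.mul ℝ ℂ) hw ((contDiff_normedC φ).of_le (by simp)) x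
  rw [pd, moll, h.fderiv, convolution_precompR_apply (L := ContinuousLinearMap.mul ℝ ℂ) hw
    ((hasCompactSupport_normedC φ).fderiv ℝ) ((contDiff_normedC φ).continuous_fderiv (by simp))]
  simp [convolution_def, pd, mul_comm]

lemma lintegral_normed_sub (x : EuclideanSpace ℝ (Fin m)) :
    ∫⁻ t, ENNReal.ofReal (φ.normed volume (x - t)) = 1 := by
  rw [lintegral_sub_left_eq_self (fun t => ENNReal.ofReal (φ.normed volume t)) x,
    ← ofReal_integral_eq_lintegral_ofReal φ.integrable_normed
      (Filter.Eventually.of_forall φ.nonneg_normed), φ.integral_normed, ENNReal.ofReal_one]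

/-- For fixed `x` the kernel turns Lebesgue measure into a probability measure, for which the `L^1`
norm is at most the `L^p` norm. Integrating the `p`-th powers in `x` and exchanging the integrals
leaves the kernel mass `1`. -/
lemma eLpNorm_moll_le {p : ℝ≥0∞} (hp : 1 ≤ p) (hp' : p ≠ ⊤) (hw : AEStronglyMeasurable w) :
    eLpNorm (moll φ w) p ≤ eLpNorm w p := by
  have hp0 : p ≠ 0 := (zero_lt_one.trans_le hp).ne'
  have hpt : 0 < p.toReal := ENNReal.toReal_pos hp0 hp'
  have hk : ∀ x : EuclideanSpace ℝ (Fin m),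
      Measurable fun t => ENNReal.ofReal (φ.normed volume (x - t)) := fun x =>
    (ENNReal.continuous_ofReal.comp (φ.continuous_normed.comp
      (continuous_const.sub continuous_id))).measurable
  have key : ∀ x, ‖moll φ w x‖ₑ ^ p.toReal
      ≤ ∫⁻ t, ENNReal.ofReal (φ.normed volume (x - t)) * ‖w t‖ₑ ^ p.toReal := by
    intro x
    set μ := (volume : Measure (EuclideanSpace ℝ (Fin m))).withDensity
      (fun t => ENNReal.ofReal (φ.normed volume (x - t))) with hμ
    have hpr : IsProbabilityMeasure μ := ⟨by
      rw [hμ, withDensity_apply _ MeasurableSet.univ, Measure.restrict_univ,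
        lintegral_normed_sub]⟩
    have hwμ : AEStronglyMeasurable w μ := hw.mono_ac (withDensity_absolutelyContinuous _ _)
    have h1 : ‖moll φ w x‖ₑ ≤ eLpNorm w 1 μ := by
      rw [moll_apply, eLpNorm_one_eq_lintegral_enorm, hμ,
        lintegral_withDensity_eq_lintegral_mul_non_measurable _ (hk x)
          (Filter.Eventually.of_forall fun t => ENNReal.ofReal_lt_top)]
      refine (enorm_integral_le_lintegral_enorm _).trans (lintegral_mono fun t => ?_)
      simp only [enorm_mul, Pi.mul_apply]
      gcongr
      rw [← ofReal_norm, Complex.norm_real, Real.norm_of_nonneg (φ.nonneg_normed _)]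
    have h2 := h1.trans (eLpNorm_le_eLpNorm_of_exponent_le hp hwμ)
    rw [eLpNorm_eq_lintegral_rpow_enorm_toReal hp0 hp'] at h2
    have h3 := ENNReal.rpow_le_rpow h2 hpt.le
    rw [← ENNReal.rpow_mul, one_div, inv_mul_cancel₀ hpt.ne', ENNReal.rpow_one, hμ,
      lintegral_withDensity_eq_lintegral_mul_non_measurable _ (hk x)
          (Filter.Eventually.of_forall fun t => ENNReal.ofReal_lt_top)] at h3
    exact h3
  rw [eLpNorm_eq_lintegral_rpow_enorm_toReal hp0 hp', eLpNorm_eq_lintegral_rpow_enorm_toReal hp0 hp']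
  refine ENNReal.rpow_le_rpow ((lintegral_mono key).trans ?_) (by positivity)
  rw [lintegral_lintegral_swap]
  · refine lintegral_mono fun t => ?_
    have hm : Measurable fun x => ENNReal.ofReal (φ.normed volume (x - t)) :=
      (ENNReal.continuous_ofReal.comp (φ.continuous_normed.comp
        (continuous_id.sub continuous_const))).measurable
    rw [lintegral_mul_const _ hm,
      lintegral_sub_right_eq_self (fun x => ENNReal.ofReal (φ.normed volume x)) t,
      ← ofReal_integral_eq_lintegral_ofReal φ.integrable_normed
      (Filter.Eventually.of_forall φ.nonneg_normed), φ.integral_normed, ENNReal.ofReal_one, one_mul]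
  · refine AEMeasurable.mul ?_ ?_
    · exact (ENNReal.continuous_ofReal.comp (φ.continuous_normed.comp
        (continuous_fst.sub continuous_snd))).measurable.aemeasurable
    · exact (hw.enorm.pow_const p.toReal).comp_snd

lemma moll_sub {v : EuclideanSpace ℝ (Fin m) → ℂ} (hw : LocallyIntegrable w)
    (hv : LocallyIntegrable v) : moll φ (w - v) = moll φ w - moll φ v := by
  ext x
  have h : ∀ u : EuclideanSpace ℝ (Fin m) → ℂ, LocallyIntegrable u →
      Integrable fun t => (φ.normed volume (x - t) : ℂ) * u t := fun u hu => by
    have := (hasCompactSupport_normedC φ).convolutionExists_right (ContinuousLinearMap.mul ℝ ℂ)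
      hu (contDiff_normedC φ).continuous x
    simpa [ConvolutionExistsAt, mul_comm] using this
  simp only [Pi.sub_apply, moll_apply, mul_sub]
  exact integral_sub (h _ hw) (h _ hv)

/-- Uniform continuity gives uniform convergence, and for radii below `1` everything is supported in
the compact `1`-thickening of the support, which has finite measure. -/
lemma tendsto_moll_of_continuous {p : ℝ≥0∞} (hp : 1 ≤ p) (hp' : p ≠ ⊤)
    {φ : ℕ → ContDiffBump (0 : EuclideanSpace ℝ (Fin m))}
    (hφ : Filter.Tendsto (fun n => (φ n).rOut) Filter.atTop (𝓝 0)) (hw : Continuous w)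
    (hwc : HasCompactSupport w) :
    Filter.Tendsto (fun n => eLpNorm (moll (φ n) w - w) p) Filter.atTop (𝓝 0) := by
  have hp0 : p ≠ 0 := (zero_lt_one.trans_le hp).ne'
  set K := Metric.cthickening 1 (tsupport w) with hK
  have hKc : IsCompact K := hwc.isCompact.cthickening
  have hfin : volume K ^ (1 / p.toReal) ≠ ⊤ :=
    ENNReal.rpow_ne_top_of_nonneg (by positivity) hKc.measure_lt_top.ne
  rw [ENNReal.tendsto_nhds_zero]
  intro ε hε
  -- A uniform error `δ` supported in `K` has `L^p` norm at most `δ vol(K)^{1/p}`.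
  obtain ⟨δ, hδ, hδε⟩ : ∃ δ : ℝ, 0 < δ ∧ ENNReal.ofReal δ * volume K ^ (1 / p.toReal) ≤ ε := by
    have h1 : Filter.Tendsto (fun δ : ℝ => ENNReal.ofReal δ * volume K ^ (1 / p.toReal))
        (𝓝[>] 0) (𝓝 (ENNReal.ofReal 0 * volume K ^ (1 / p.toReal))) :=
      ENNReal.Tendsto.mul_const
        ((ENNReal.continuous_ofReal.tendsto 0).mono_left nhdsWithin_le_nhds) (Or.inr hfin)
    simp only [ENNReal.ofReal_zero, zero_mul] at h1
    have h2 := (ENNReal.tendsto_nhds_zero.1 h1 ε hε).and self_mem_nhdsWithin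
    obtain ⟨δ, h3, h4⟩ := h2.exists
    exact ⟨δ, h4, h3⟩
  obtain ⟨r, hr, hr'⟩ := Metric.uniformContinuous_iff.1
    (hwc.uniformContinuous_of_continuous hw) δ hδ
  filter_upwards [(tendsto_order.1 hφ).2 _ hr, (tendsto_order.1 hφ).2 _ one_pos] with n hn hn1
  have hd : ∀ x, dist (moll (φ n) w x) (w x) ≤ δ := by
    intro x
    rw [moll_eq_lsmul]
    refine (φ n).dist_normed_convolution_le hw.aestronglyMeasurable fun y hy => ?_
    exact (hr' (lt_trans (Metric.mem_ball.1 hy) hn)).le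
  have hsupp : ∀ x, x ∉ K → moll (φ n) w x = 0 ∧ w x = 0 := by
    intro x hx
    have hxw : ∀ y ∈ Metric.ball x (φ n).rOut, w y = 0 := by
      intro y hy
      by_contra hne
      apply hx
      refine Metric.mem_cthickening_of_dist_le x y 1 _ (subset_tsupport _ hne) ?_
      rw [dist_comm]
      exact (lt_trans (Metric.mem_ball.1 hy) hn1).le
    have h0 := hxw x (Metric.mem_ball_self (φ n).rOut_pos)
    refine ⟨?_, h0⟩
    rw [moll_eq_lsmul, (φ n).normed_convolution_eq_right fun y hy => by rw [hxw y hy, h0], h0]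
  refine (eLpNorm_sub_le_of_dist_bdd volume hp' hKc.measurableSet hδ.le hd ?_ ?_).trans hδε
  · exact fun x hx => by_contra fun hc => hx (hsupp x hc).1
  · exact fun x hx => by_contra fun hc => hx (hsupp x hc).2

/-- Density of continuous compactly supported functions in `L^p` together with the contraction
property of mollification, by an `ε/3` argument. -/
lemma tendsto_moll {p : ℝ≥0∞} (hp : 1 ≤ p) (hp' : p ≠ ⊤)
    {φ : ℕ → ContDiffBump (0 : EuclideanSpace ℝ (Fin m))}
    (hφ : Filter.Tendsto (fun n => (φ n).rOut) Filter.atTop (𝓝 0)) (hw : MemLp w p) :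
    Filter.Tendsto (fun n => eLpNorm (moll (φ n) w - w) p) Filter.atTop (𝓝 0) := by
  rw [ENNReal.tendsto_nhds_zero]
  intro ε hε
  have hε3 : ε / 3 ≠ 0 := (ENNReal.div_pos hε.ne' (by simp)).ne'
  obtain ⟨g, hgc, hg, hgcont, hgL⟩ := hw.exists_hasCompactSupport_eLpNorm_sub_le hp' hε3
  filter_upwards [ENNReal.tendsto_nhds_zero.1 (tendsto_moll_of_continuous hp hp' hφ hgcont hgc)
    _ hε3.bot_lt] with n hn
  have e : moll (φ n) w - w = (moll (φ n) (w - g) + (moll (φ n) g - g)) + (g - w) := by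
    rw [moll_sub _ (hw.locallyIntegrable hp) (hgL.locallyIntegrable hp)]
    abel
  have hc : ∀ u : EuclideanSpace ℝ (Fin m) → ℂ, LocallyIntegrable u →
      AEStronglyMeasurable (moll (φ n) u) := fun u hu =>
    (contDiff_moll (φ n) hu).continuous.aestronglyMeasurable
  have m1 := hc _ ((hw.locallyIntegrable hp).sub (hgL.locallyIntegrable hp))
  have m2 := (hc _ (hgL.locallyIntegrable hp)).sub hgL.1
  have n1 : eLpNorm (moll (φ n) (w - g)) p ≤ ε / 3 :=
    (eLpNorm_moll_le _ hp hp' (hw.1.sub hgL.1)).trans hg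
  have n3 : eLpNorm (g - w) p ≤ ε / 3 := by rw [eLpNorm_sub_comm]; exact hg
  rw [e, ← ENNReal.add_thirds ε]
  exact (eLpNorm_add_le (m1.add m2) (hgL.1.sub hw.1) hp).trans
    (add_le_add ((eLpNorm_add_le m1 m2 hp).trans (add_le_add n1 hn)) n3)

/-- A sequence of local regularization operators near a compact set. -/
lemma exists_regularization {Ω K : Set (EuclideanSpace ℝ (Fin m))} {p : ℝ≥0∞} (hp : 1 ≤ p)
    (hp' : p ≠ ⊤) (hΩ : IsOpen Ω) (hK : IsCompact K) (hKΩ : K ⊆ Ω) :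
    ∃ (O : Set (EuclideanSpace ℝ (Fin m)))
      (T : ℕ → (EuclideanSpace ℝ (Fin m) → ℂ) → EuclideanSpace ℝ (Fin m) → ℂ),
      IsOpen O ∧ K ⊆ O ∧ O ⊆ Ω ∧ IsCompact (closure O) ∧ closure O ⊆ Ω ∧
      (∀ u, MemLpLocOn p Ω u → (∀ n, ContDiff ℝ ∞ (T n u)) ∧
        Filter.Tendsto (fun n => eLpNorm (T n u - u) p (volume.restrict K)) Filter.atTop (𝓝 0)) ∧
      ∀ i u v, MemLpLocOn p Ω u → MemLpLocOn p Ω v → WeakPD Ω i u v →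
        ∀ᶠ n in Filter.atTop, ∀ y ∈ O, pd i (T n u) y = T n v y := by
  -- Nested compact sets `K ⊆ int K₁` and `K₁ ⊆ int K' ⊆ Ω`. Functions are cut off sharply to `K'`
  -- before mollification, and the cut is invisible on `O = int K₁` once the radius is less than
  -- `δ`.
  obtain ⟨K', hK'c, hKK', hK'Ω⟩ := exists_compact_between hK hΩ hKΩ
  obtain ⟨K₁, hK₁c, hKK₁, hK₁K'⟩ := exists_compact_between hK isOpen_interior hKK'
  obtain ⟨δ, hδ, hδK⟩ := hK₁c.exists_cthickening_subset_open isOpen_interior hK₁K'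
  set φ : ℕ → ContDiffBump (0 : EuclideanSpace ℝ (Fin m)) := fun n =>
    { rIn := 1 / (2 * ((n : ℝ) + 1)), rOut := 1 / ((n : ℝ) + 1), rIn_pos := by positivity,
      rIn_lt_rOut := by
        have : (0 : ℝ) < (n : ℝ) + 1 := by positivity
        exact one_div_lt_one_div_of_lt this (by linarith) } with hφ
  have hφ0 : Filter.Tendsto (fun n => (φ n).rOut) Filter.atTop (𝓝 0) :=
    tendsto_one_div_add_atTop_nhds_zero_nat
  have hL : ∀ u, MemLpLocOn p Ω u → MemLp (K'.indicator u) p := fun u hu =>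
    (memLp_indicator_iff_restrict hK'c.measurableSet).2 (hu K' hK'c hK'Ω)
  have hcl : closure (interior K₁) ⊆ K₁ := hK₁c.isClosed.closure_subset_iff.2 interior_subset
  refine ⟨interior K₁, fun n u => moll (φ n) (K'.indicator u), isOpen_interior, hKK₁,
    interior_subset.trans (hK₁K'.trans (interior_subset.trans hK'Ω)),
    hK₁c.of_isClosed_subset isClosed_closure hcl,
    hcl.trans (hK₁K'.trans (interior_subset.trans hK'Ω)), ?_, ?_⟩
  · intro u hu
    refine ⟨fun n => contDiff_moll _ ((hL u hu).locallyIntegrable hp), ?_⟩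
    have h1 := tendsto_moll hp hp' hφ0 (hL u hu)
    refine tendsto_of_tendsto_of_tendsto_of_le_of_le tendsto_const_nhds h1 (fun _ => zero_le)
      fun n => ?_
    refine le_trans (le_of_eq ?_) (eLpNorm_mono_measure _ (Measure.restrict_le_self (s := K)))
    refine eLpNorm_congr_ae (ae_restrict_of_forall_mem hK.measurableSet fun y hy => ?_)
    simp only [Pi.sub_apply]
    rw [Set.indicator_of_mem (interior_subset (hKK' hy))]
  · intro i u v hu hv h
    filter_upwards [(tendsto_order.1 hφ0).2 _ hδ] with n hn y hy
    have hyK₁ : y ∈ K₁ := interior_subset hy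
    have hball : Metric.closedBall y (φ n).rOut ⊆ interior K' := by
      intro z hz
      refine hδK (Metric.mem_cthickening_of_dist_le z y δ _ hyK₁ ?_)
      exact (Metric.mem_closedBall.1 hz).trans hn.le
    set k : EuclideanSpace ℝ (Fin m) → ℂ := fun t => ((φ n).normed volume t : ℂ) with hk
    -- The reflected and translated kernel is itself a test function on `Ω`; the weak derivative
    -- identity for it says that mollification commutes with `∂_i` at `y`.
    set η : EuclideanSpace ℝ (Fin m) → ℂ := fun t => k (y - t) with hη
    have hsupp : Function.support η ⊆ Metric.closedBall y (φ n).rOut := by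
      intro t ht
      have h1 : y - t ∈ Function.support ((φ n).normed volume) := by
        simpa [hη, hk] using ht
      rw [(φ n).support_normed_eq, mem_ball_zero_iff] at h1
      rw [Metric.mem_closedBall, dist_comm, dist_eq_norm]
      exact h1.le
    have htsupp : tsupport η ⊆ Metric.closedBall y (φ n).rOut :=
      closure_minimal hsupp Metric.isClosed_closedBall
    have hηT : IsTest Ω η := by
      refine ⟨(contDiff_normedC (φ n)).comp (contDiff_const.sub contDiff_id), ?_, ?_⟩
      · exact (isCompact_closedBall _ _).of_isClosed_subset (isClosed_tsupport _) htsupp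
      · exact htsupp.trans (hball.trans (interior_subset.trans hK'Ω))
    -- The sign of the reflection cancels the sign in the definition of the weak derivative.
    have hpd : ∀ t, pd i η t = -pd i k (y - t) := by
      intro t
      have h1 : HasFDerivAt η ((fderiv ℝ k (y - t)).comp
          (-ContinuousLinearMap.id ℝ (EuclideanSpace ℝ (Fin m)))) t :=
        (((contDiff_normedC (φ n)).differentiable (by simp) (y - t)).hasFDerivAt).comp t
          (by simpa using (hasFDerivAt_id t).const_sub y)
      simp [pd, h1.fderiv]
    have hz : ∀ (w : EuclideanSpace ℝ (Fin m) → ℂ) (ζ : EuclideanSpace ℝ (Fin m) → ℂ),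
        (∀ t, t ∉ tsupport η → ζ t = 0) → ∀ t, ζ t * K'.indicator w t = ζ t * w t := by
      intro w ζ hζ t
      by_cases ht : t ∈ tsupport η
      · rw [Set.indicator_of_mem (interior_subset (hball (htsupp ht)))]
      · rw [hζ t ht, zero_mul, zero_mul]
    rw [pd_moll _ ((hL u hu).locallyIntegrable hp), moll_apply]
    have h1 := h η hηT
    have e1 : ∫ t, pd i k (y - t) * K'.indicator u t = -∫ t, pd i η t * u t := by
      rw [← integral_neg]
      congr 1 with t
      rw [← neg_mul, ← hz u (fun t => -pd i η t) (fun t ht => ?_) t]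
      · simp only [hpd, neg_neg]
      · have : t ∉ tsupport (pd i η) := fun hc => ht ((tsupport_fderiv_apply_subset ℝ _) hc)
        simp [image_eq_zero_of_notMem_tsupport this]
    have e2 : ∫ t, k (y - t) * K'.indicator v t = ∫ t, η t * v t := by
      congr 1 with t
      exact hz v η (fun t ht => image_eq_zero_of_notMem_tsupport ht) t
    rw [e1, h1, neg_neg]
    exact e2.symm

end Mollification

/-! ### Convergence of all derivatives -/

section Conv

variable {m ℓ : ℕ} {Ω K : Set (EuclideanSpace ℝ (Fin m))} {p : ℝ≥0∞}

/-- `c n → u` in `L^p(K)` together with all weak derivatives up to order `k`. -/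
def Conv (Ω K : Set (EuclideanSpace ℝ (Fin m))) (p : ℝ≥0∞) :
    ℕ → (ℕ → EuclideanSpace ℝ (Fin m) → ℂ) → (EuclideanSpace ℝ (Fin m) → ℂ) → Prop
  | 0, c, u => MemLpLocOn p Ω u ∧
      Filter.Tendsto (fun n => eLpNorm (c n - u) p (volume.restrict K)) Filter.atTop (𝓝 0)
  | k + 1, c, u => (MemLpLocOn p Ω u ∧
      Filter.Tendsto (fun n => eLpNorm (c n - u) p (volume.restrict K)) Filter.atTop (𝓝 0)) ∧
      ∀ i, ∃ v, WeakPD Ω i u v ∧ Conv Ω K p k (fun n => pd i (c n)) v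

namespace Conv

variable {c c' : ℕ → EuclideanSpace ℝ (Fin m) → ℂ} {u u' : EuclideanSpace ℝ (Fin m) → ℂ}

lemma base : ∀ {k : ℕ} {c : ℕ → EuclideanSpace ℝ (Fin m) → ℂ} {u}, Conv Ω K p k c u →
    MemLpLocOn p Ω u ∧
      Filter.Tendsto (fun n => eLpNorm (c n - u) p (volume.restrict K)) Filter.atTop (𝓝 0)
  | 0, _, _, h => h
  | _ + 1, _, _, h => h.1

lemma of_succ : ∀ {k : ℕ} {c : ℕ → EuclideanSpace ℝ (Fin m) → ℂ} {u},
    Conv Ω K p (k + 1) c u → Conv Ω K p k c u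
  | 0, _, _, h => h.1
  | _ + 1, _, _, h => ⟨h.1, fun i => let ⟨v, hv, hv'⟩ := h.2 i; ⟨v, hv, hv'.of_succ⟩⟩

/-- Equality on an open neighbourhood of `K` is needed, since equality on `K` alone would not
determine the derivatives there. -/
lemma congr {O : Set (EuclideanSpace ℝ (Fin m))} (hO : IsOpen O) (hKO : K ⊆ O)
    (hK : IsCompact K) : ∀ {k : ℕ} {c c' : ℕ → EuclideanSpace ℝ (Fin m) → ℂ} {u},
    Conv Ω K p k c u → (∀ᶠ n in Filter.atTop, ∀ y ∈ O, c n y = c' n y) → Conv Ω K p k c' u := by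
  have h0 : ∀ {c c' : ℕ → EuclideanSpace ℝ (Fin m) → ℂ} {u}, (MemLpLocOn p Ω u ∧
      Filter.Tendsto (fun n => eLpNorm (c n - u) p (volume.restrict K)) Filter.atTop (𝓝 0)) →
      (∀ᶠ n in Filter.atTop, ∀ y ∈ O, c n y = c' n y) → (MemLpLocOn p Ω u ∧
      Filter.Tendsto (fun n => eLpNorm (c' n - u) p (volume.restrict K)) Filter.atTop (𝓝 0)) := by
    intro c c' u h he
    refine ⟨h.1, h.2.congr' (he.mono fun n hn => ?_)⟩
    refine eLpNorm_congr_ae (ae_restrict_of_forall_mem hK.measurableSet fun y hy => ?_)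
    simp only [Pi.sub_apply, hn y (hKO hy)]
  intro k
  induction k with
  | zero => exact fun h he => h0 h he
  | succ k ih =>
    intro c c' u h he
    refine ⟨h0 h.1 he, fun i => ?_⟩
    obtain ⟨v, hv, hv'⟩ := h.2 i
    exact ⟨v, hv, ih hv' (he.mono fun n hn y hy => pd_congr hO hn hy)⟩

lemma congr_ae (hK : IsCompact K) (hKΩ : K ⊆ Ω) {k : ℕ} {u u'} (h : Conv Ω K p k c u)
    (he : ∀ᵐ y, y ∈ Ω → u y = u' y) : Conv Ω K p k c u' := by
  have h0 : (MemLpLocOn p Ω u ∧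
      Filter.Tendsto (fun n => eLpNorm (c n - u) p (volume.restrict K)) Filter.atTop (𝓝 0)) →
      (MemLpLocOn p Ω u' ∧
      Filter.Tendsto (fun n => eLpNorm (c n - u') p (volume.restrict K)) Filter.atTop (𝓝 0)) := by
    intro h
    refine ⟨h.1.congr he, h.2.congr fun n => ?_⟩
    refine eLpNorm_congr_ae ?_
    rw [Filter.EventuallyEq, ae_restrict_iff' hK.measurableSet]
    refine he.mono fun y hy hyK => ?_
    simp only [Pi.sub_apply, hy (hKΩ hyK)]
  cases k with
  | zero => exact h0 h
  | succ k =>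
    refine ⟨h0 h.1, fun i => ?_⟩
    obtain ⟨v, hv, hv'⟩ := h.2 i
    exact ⟨v, hv.congr he (Filter.Eventually.of_forall fun _ _ => rfl), hv'⟩

/-- The definition supplies some weak derivative as limit; by uniqueness it may be replaced by the
prescribed one. -/
lemma pd_tendsto (hΩ : IsOpen Ω) (hp : 1 ≤ p) (hK : IsCompact K) (hKΩ : K ⊆ Ω) {k : ℕ} {i : Fin m}
    {v} (h : Conv Ω K p (k + 1) c u) (hv : WeakPD Ω i u v) (hv' : MemLpLocOn p Ω v) :
    Conv Ω K p k (fun n => pd i (c n)) v := by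
  obtain ⟨v₁, h1, h2⟩ := h.2 i
  exact h2.congr_ae hK hKΩ (h1.unique hΩ hp h2.base.1 hv' hv)

lemma add (hΩ : IsOpen Ω) (hp : 1 ≤ p) (hK : IsCompact K) (hKΩ : K ⊆ Ω) : ∀ {k : ℕ}
    {c c' : ℕ → EuclideanSpace ℝ (Fin m) → ℂ} {u u'}, (∀ n, ContDiffOn ℝ ∞ (c n) Ω) →
    (∀ n, ContDiffOn ℝ ∞ (c' n) Ω) → Conv Ω K p k c u → Conv Ω K p k c' u' →
    Conv Ω K p k (fun n y => c n y + c' n y) (fun y => u y + u' y) := by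
  have h0 : ∀ {c c' : ℕ → EuclideanSpace ℝ (Fin m) → ℂ} {u u'},
      (∀ n, ContDiffOn ℝ ∞ (c n) Ω) → (∀ n, ContDiffOn ℝ ∞ (c' n) Ω) → (MemLpLocOn p Ω u ∧
      Filter.Tendsto (fun n => eLpNorm (c n - u) p (volume.restrict K)) Filter.atTop (𝓝 0)) →
      (MemLpLocOn p Ω u' ∧
      Filter.Tendsto (fun n => eLpNorm (c' n - u') p (volume.restrict K)) Filter.atTop (𝓝 0)) →
      (MemLpLocOn p Ω (fun y => u y + u' y) ∧
      Filter.Tendsto (fun n => eLpNorm ((fun y => c n y + c' n y) - fun y => u y + u' y) p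
        (volume.restrict K)) Filter.atTop (𝓝 0)) := by
    intro c c' u u' hc hc' h h'
    refine ⟨h.1.add h'.1, ?_⟩
    have := h.2.add h'.2
    rw [add_zero] at this
    refine tendsto_of_tendsto_of_tendsto_of_le_of_le tendsto_const_nhds this (fun _ => zero_le)
      fun n => ?_
    have e : ((fun y => c n y + c' n y) - fun y => u y + u' y) = (c n - u) + (c' n - u') := by
      ext y; simp; ring
    rw [e]
    exact eLpNorm_add_le
      ((((hc n).continuousOn.mono hKΩ).aestronglyMeasurable hK.measurableSet).sub
        (h.1 K hK hKΩ).1)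
      ((((hc' n).continuousOn.mono hKΩ).aestronglyMeasurable hK.measurableSet).sub
        (h'.1 K hK hKΩ).1) hp
  obtain ⟨O, hO, hKO, hOΩ⟩ : ∃ O, IsOpen O ∧ K ⊆ O ∧ O ⊆ Ω := ⟨Ω, hΩ, hKΩ, le_rfl⟩
  intro k
  induction k with
  | zero => exact fun hc hc' h h' => h0 hc hc' h h'
  | succ k ih =>
    intro c c' u u' hc hc' h h'
    refine ⟨h0 hc hc' h.1 h'.1, fun i => ?_⟩
    obtain ⟨v, hv, hv'⟩ := h.2 i
    obtain ⟨w, hw, hw'⟩ := h'.2 i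
    refine ⟨_, hv.add hp h.1.1 h'.1.1 hv'.base.1 hw'.base.1 hw, ?_⟩
    refine Conv.congr hO hKO hK (ih (fun n => pd_contDiffOn hΩ (hc n))
      (fun n => pd_contDiffOn hΩ (hc' n)) hv' hw') (Filter.Eventually.of_forall fun n y hy => ?_)
    rw [pd_add (differentiableAt_of_contDiffOn hΩ (hc n) (hOΩ hy))
      (differentiableAt_of_contDiffOn hΩ (hc' n) (hOΩ hy))]

lemma mul_left (hΩ : IsOpen Ω) (hp : 1 ≤ p) (hK : IsCompact K) (hKΩ : K ⊆ Ω) : ∀ {k : ℕ}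
    {f : EuclideanSpace ℝ (Fin m) → ℂ}
    {c : ℕ → EuclideanSpace ℝ (Fin m) → ℂ} {u}, ContDiffOn ℝ ∞ f Ω →
    (∀ n, ContDiffOn ℝ ∞ (c n) Ω) → Conv Ω K p k c u →
    Conv Ω K p k (fun n y => f y * c n y) (fun y => f y * u y) := by
  have h0 : ∀ {f : EuclideanSpace ℝ (Fin m) → ℂ} {c : ℕ → EuclideanSpace ℝ (Fin m) → ℂ} {u},
      ContDiffOn ℝ ∞ f Ω → (MemLpLocOn p Ω u ∧
      Filter.Tendsto (fun n => eLpNorm (c n - u) p (volume.restrict K)) Filter.atTop (𝓝 0)) →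
      (MemLpLocOn p Ω (fun y => f y * u y) ∧
      Filter.Tendsto (fun n => eLpNorm ((fun y => f y * c n y) - fun y => f y * u y) p
        (volume.restrict K)) Filter.atTop (𝓝 0)) := by
    intro f c u hf h
    refine ⟨h.1.mul_left hf.continuousOn, ?_⟩
    obtain ⟨C, hC⟩ := hK.exists_bound_of_continuousOn (hf.continuousOn.mono hKΩ)
    have := ENNReal.Tendsto.const_mul h.2 (a := ENNReal.ofReal C) (Or.inr ENNReal.ofReal_ne_top)
    rw [mul_zero] at this
    refine tendsto_of_tendsto_of_tendsto_of_le_of_le tendsto_const_nhds this (fun _ => zero_le)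
      fun n => ?_
    refine eLpNorm_le_mul_eLpNorm_of_ae_le_mul
      (ae_restrict_of_forall_mem hK.measurableSet fun y hy => ?_) p
    simp only [Pi.sub_apply, ← mul_sub, norm_mul]
    exact mul_le_mul_of_nonneg_right (hC y hy) (norm_nonneg _)
  intro k
  induction k with
  | zero => exact fun hf _ h => h0 hf h
  | succ k ih =>
    intro f c u hf hc h
    refine ⟨h0 hf h.1, fun i => ?_⟩
    obtain ⟨v, hv, hv'⟩ := h.2 i
    refine ⟨_, hv.mul_left hΩ hp hf h.1.1 hv'.base.1, ?_⟩
    refine Conv.congr hΩ hKΩ hK (Conv.add hΩ hp hK hKΩ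
      (fun n => (pd_contDiffOn (i := i) hΩ hf).mul (hc n))
      (fun n => hf.mul (pd_contDiffOn (i := i) hΩ (hc n)))
      (ih (pd_contDiffOn (i := i) hΩ hf) hc h.of_succ)
      (ih hf (fun n => pd_contDiffOn hΩ (hc n)) hv'))
      (Filter.Eventually.of_forall fun n y hy => ?_)
    rw [pd_mul (differentiableAt_of_contDiffOn hΩ hf hy)
      (differentiableAt_of_contDiffOn hΩ (hc n) hy)]

lemma zero (hΩ : IsOpen Ω) : ∀ {k : ℕ}, Conv Ω K p k (fun _ _ => 0) (fun _ => 0)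
  | 0 => ⟨MemLpLocOn.of_continuousOn continuousOn_const, by simp⟩
  | _ + 1 => ⟨Conv.zero hΩ (k := 0), fun i => ⟨fun _ => 0, fun η _ => by simp, by
      have : (fun _ : ℕ => pd i (fun _ : EuclideanSpace ℝ (Fin m) => (0 : ℂ))) = fun _ _ => 0 := by
        ext; simp [pd]
      rw [this]; exact Conv.zero hΩ⟩⟩

lemma sum (hΩ : IsOpen Ω) (hp : 1 ≤ p) (hK : IsCompact K) (hKΩ : K ⊆ Ω) {k : ℕ} {ι : Type*}
    (s : Finset ι) {c : ι → ℕ → EuclideanSpace ℝ (Fin m) → ℂ}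
    {u : ι → EuclideanSpace ℝ (Fin m) → ℂ} (hc : ∀ a n, ContDiffOn ℝ ∞ (c a n) Ω)
    (h : ∀ a, Conv Ω K p k (c a) (u a)) :
    Conv Ω K p k (fun n y => ∑ a ∈ s, c a n y) (fun y => ∑ a ∈ s, u a y) := by
  classical
  induction s using Finset.induction_on with
  | empty => simpa using Conv.zero hΩ
  | insert a s ha ih =>
    simp only [Finset.sum_insert ha]
    exact Conv.add hΩ hp hK hKΩ (hc a) (fun n => ContDiffOn.sum fun b _ => hc b n) (h a) ih

end Conv

/-- A weak solution is locally the limit of all smooth solutions whose zeroth order components are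
the regularizations of its zeroth order components. -/
lemma IsWeakTower.exists_approx (hΩ : IsOpen Ω) (hp : 1 ≤ p) (hp' : p ≠ ⊤)
    (hK : IsCompact K) (hKΩ : K ⊆ Ω) {Q : Coefs m ℓ}
    (hQ : ∀ j i κ κ', ContDiffOn ℝ ∞ (Q j i κ κ') Ω) {s : ℕ} {G : Comps m ℓ}
    (hG : IsWeakTower Ω Q s p G) :
    ∃ (O : Set (EuclideanSpace ℝ (Fin m))) (c : ℕ → Idx m ℓ 0 → EuclideanSpace ℝ (Fin m) → ℂ),
      IsOpen O ∧ K ⊆ O ∧ IsCompact (closure O) ∧ closure O ⊆ Ω ∧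
      (∀ n κ, ContDiff ℝ ∞ (c n κ)) ∧
      ∀ H : ℕ → Comps m ℓ, (∀ n, IsTower Ω Q (H n)) → (∀ n κ, ∀ y ∈ O, H n 0 κ y = c n κ y) →
      ∀ j ≤ s, ∀ κ, Filter.Tendsto (fun n => eLpNorm (H n j κ - G j κ) p (volume.restrict K))
        Filter.atTop (𝓝 0) := by
  obtain ⟨O, T, hO, hKO, hOΩ, hOc, hOcΩ, hT, hTpd⟩ := exists_regularization hp hp' hΩ hK hKΩ
  refine ⟨O, fun n κ => T n (G 0 κ), hO, hKO, hOc, hOcΩ,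
    fun n κ => (hT _ (hG.memLp 0 (by omega) κ)).1 n, fun H hH hHc => ?_⟩
  -- The operators commute with weak derivatives on `O`, so the `L^p` convergence applies to every
  -- derivative in turn.
  have hTC : ∀ k u, Sob Ω p k u → Conv Ω K p k (fun n => T n u) u := by
    intro k
    induction k with
    | zero => exact fun u hu => ⟨hu, (hT u hu).2⟩
    | succ k ih =>
      intro u hu
      refine ⟨⟨hu.1, (hT u hu.1).2⟩, fun i => ?_⟩
      obtain ⟨v, hv, hv'⟩ := hu.2 i
      refine ⟨v, hv, Conv.congr hO hKO hK (ih v hv') ?_⟩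
      exact (hTpd i u v hu.1 hv'.memLp hv).mono fun n hn y hy => (hn y hy).symm
  -- The higher components of `H n` are not mollifications themselves. They are determined by the
  -- zeroth ones through the system, and each order uses up one of the `s` derivatives that
  -- converge.
  have key : ∀ j, j ≤ s → ∀ κ, Conv Ω K p (s - j) (fun n => H n j κ) (G j κ) := by
    intro j
    induction j with
    | zero =>
      intro _ κ
      refine Conv.congr hO hKO hK (hTC s _ (hG.sob hΩ hQ hp s 0 (by omega) κ))
        (Filter.Eventually.of_forall fun n y hy => (hHc n κ y hy).symm)
    | succ j ih =>
      intro hj κ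
      have ih' := ih (by omega)
      rw [← Idx.cons_tail κ]
      set i := κ.1 0
      set κ₀ : Idx m ℓ j := (Fin.tail κ.1, κ.2)
      have hsj : s - j = (s - (j + 1)) + 1 := by omega
      have hM := MemLpLocOn.sum Finset.univ fun κ' _ => (hG.memLp j (by omega) κ').mul_left
        (hQ j i κ₀ κ').continuousOn
      have h1 : Conv Ω K p (s - (j + 1)) (fun n => pd i (H n j κ₀)) _ :=
        Conv.pd_tendsto hΩ hp hK hKΩ (hsj ▸ ih' κ₀) (hG.step j (by omega) i κ₀)
          ((hG.memLp (j + 1) hj _).sub hM)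
      have h2 : Conv Ω K p (s - (j + 1)) (fun n y => ∑ κ', Q j i κ₀ κ' y * H n j κ' y)
          (fun y => ∑ κ', Q j i κ₀ κ' y * G j κ' y) :=
        Conv.sum hΩ hp hK hKΩ Finset.univ (fun κ' n => (hQ j i κ₀ κ').mul ((hH n).smooth j κ'))
          fun κ' => Conv.mul_left hΩ hp hK hKΩ (hQ j i κ₀ κ') (fun n => (hH n).smooth j κ')
            (hsj ▸ ih' κ' : Conv Ω K p ((s - (j + 1)) + 1) _ _).of_succ
      have h3 := Conv.add hΩ hp hK hKΩ (fun n => pd_contDiffOn hΩ ((hH n).smooth j κ₀))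
        (fun n => ContDiffOn.sum fun κ' _ => (hQ j i κ₀ κ').mul ((hH n).smooth j κ')) h1 h2
      refine (Conv.congr hΩ hKΩ hK h3 (Filter.Eventually.of_forall fun n y hy =>
        ((hH n).step j i κ₀ y hy).symm)).congr_ae hK hKΩ
        (Filter.Eventually.of_forall fun y _ => by ring)
  exact fun j hj κ => (key j hj κ).base.2

end Conv


/-! ### Coordinate vector fields -/

section Coordinates

variable {m : ℕ} {M : Type*} [TopologicalSpace M] [ChartedSpace (EuclideanSpace ℝ (Fin m)) M]
  [IsManifold (𝓡 m) ∞ M]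
  {e : OpenPartialHomeomorph M (EuclideanSpace ℝ (Fin m))}

/-- The coordinate vector field `∂_i` of the chart `e`. -/
noncomputable def coordField (e : OpenPartialHomeomorph M (EuclideanSpace ℝ (Fin m))) (i : Fin m)
    (x : M) : TangentSpace (𝓡 m) x :=
  mfderiv (𝓡 m) (𝓡 m) e.symm (e x) (EuclideanSpace.single i (1 : ℝ))

/-- The coordinate functional `dx^i` of the chart `e`. -/
noncomputable def coordForm (e : OpenPartialHomeomorph M (EuclideanSpace ℝ (Fin m))) (i : Fin m)
    (x : M) : TangentSpace (𝓡 m) x →L[ℝ] ℝ :=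
  (EuclideanSpace.proj i : EuclideanSpace ℝ (Fin m) →L[ℝ] ℝ).comp (mvfderiv (𝓡 m) e x)

/-- The base points `e (e.symm y)` and `y` are equal only propositionally, so the equality is
substituted in the model space, which all tangent spaces share. -/
lemma coordField_symm {y : EuclideanSpace ℝ (Fin m)} (hy : y ∈ e.target) (i : Fin m) :
    coordField e i (e.symm y) = coordVec e i y := by
  have h : ∀ z, z = y → (mfderiv (𝓡 m) (𝓡 m) e.symm z (EuclideanSpace.single i (1 : ℝ)) :
      EuclideanSpace ℝ (Fin m)) = mfderiv (𝓡 m) (𝓡 m) e.symm y (EuclideanSpace.single i (1 : ℝ)) := by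
    rintro _ rfl; rfl
  exact h _ (e.right_inv hy)

lemma mdifferentiableAt_chart (he : e ∈ IsManifold.maximalAtlas (𝓡 m) ∞ M) {x : M}
    (hx : x ∈ e.source) : MDifferentiableAt (𝓡 m) (𝓡 m) e x :=
  (contMDiffAt_of_mem_maximalAtlas he hx).mdifferentiableAt (by simp)

lemma mdifferentiableAt_chart_symm (he : e ∈ IsManifold.maximalAtlas (𝓡 m) ∞ M)
    {y : EuclideanSpace ℝ (Fin m)} (hy : y ∈ e.target) :
    MDifferentiableAt (𝓡 m) (𝓡 m) e.symm y :=
  (contMDiffAt_symm_of_mem_maximalAtlas he hy).mdifferentiableAt (by simp)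

lemma chart_mdifferentiable (he : e ∈ IsManifold.maximalAtlas (𝓡 m) ∞ M) :
    e.MDifferentiable (𝓡 m) (𝓡 m) :=
  ⟨fun _ hx => (mdifferentiableAt_chart he hx).mdifferentiableWithinAt,
    fun _ hy => (mdifferentiableAt_chart_symm he hy).mdifferentiableWithinAt⟩

lemma coordForm_coordField (he : e ∈ IsManifold.maximalAtlas (𝓡 m) ∞ M) {x : M}
    (hx : x ∈ e.source) (i j : Fin m) :
    coordForm e i x (coordField e j x) = if i = j then 1 else 0 := by
  have h := (chart_mdifferentiable he).comp_symm_deriv (e.map_source hx)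
  have h1 := congrArg (fun L : EuclideanSpace ℝ (Fin m) →L[ℝ] EuclideanSpace ℝ (Fin m) =>
    (L (EuclideanSpace.single j (1 : ℝ))) i) h
  have h2 : coordForm e i (e.symm (e x)) (coordField e j x) = if i = j then 1 else 0 := by
    refine Eq.trans ?_ (h1.trans ?_)
    · rfl
    · change (EuclideanSpace.single j (1 : ℝ)) i = _
      simp [Pi.single_apply]
  rwa [e.left_inv hx] at h2

lemma sum_coordForm_smul (he : e ∈ IsManifold.maximalAtlas (𝓡 m) ∞ M) {x : M}
    (hx : x ∈ e.source) (v : TangentSpace (𝓡 m) x) :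
    ∑ i, coordForm e i x v • coordField e i x = v := by
  have h := (chart_mdifferentiable he).symm_comp_deriv hx
  have h1 : mfderiv (𝓡 m) (𝓡 m) e.symm (e x) (mvfderiv (𝓡 m) e x v) = v :=
    congrArg (fun L : TangentSpace (𝓡 m) x →L[ℝ] TangentSpace (𝓡 m) x => L v) h
  have h2 : (mvfderiv (𝓡 m) e x v : EuclideanSpace ℝ (Fin m))
      = ∑ i, coordForm e i x v • EuclideanSpace.single i (1 : ℝ) := by
    ext j
    simp [coordForm, Finset.sum_apply, Pi.single_apply]
  conv_rhs => rw [← h1, h2]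
  refine Eq.trans ?_ (map_sum (mfderiv (𝓡 m) (𝓡 m) e.symm (e x)).toLinearMap _ _).symm
  refine Finset.sum_congr rfl fun i _ => ?_
  exact ((mfderiv (𝓡 m) (𝓡 m) e.symm (e x)).map_smul _ _).symm

lemma mvfderiv_coordField (he : e ∈ IsManifold.maximalAtlas (𝓡 m) ∞ M) {c : M → ℂ} {x : M}
    (hx : x ∈ e.source) (hc : MDifferentiableAt (𝓡 m) 𝓘(ℝ, ℂ) c x) (i : Fin m) :
    mvfderiv (𝓡 m) c x (coordField e i x) = pd i (fun y => c (e.symm y)) (e x) := by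
  have h := mfderiv_comp_apply_of_eq (I := 𝓡 m) (I' := 𝓡 m) (I'' := 𝓘(ℝ, ℂ)) (g := c)
    (f := e.symm) (e x) hc (mdifferentiableAt_chart_symm he (e.map_source hx)) (e.left_inv hx)
    (EuclideanSpace.single i (1 : ℝ))
  rw [mfderiv_eq_fderiv] at h
  exact h.symm

end Coordinates


/-! ### Smoothness of matrix inverses -/

section MatrixInverse

variable {𝕜 : Type*} [RCLike 𝕜] {n : ℕ}

lemma contDiff_det : ContDiff ℝ ∞ (fun A : Fin n → Fin n → 𝕜 => Matrix.det (Matrix.of A)) := by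
  simp only [Matrix.det_apply', Matrix.of_apply]
  refine ContDiff.sum fun σ _ => contDiff_const.mul (contDiff_prod fun i _ => ?_)
  exact contDiff_apply_apply ℝ 𝕜 _ _

/-- Cramer's rule: each entry of the inverse is a polynomial in the entries of `A` divided by the
determinant. -/
lemma contDiffAt_inv {A : Fin n → Fin n → 𝕜} (hA : Matrix.det (Matrix.of A) ≠ 0) (i j : Fin n) :
    ContDiffAt ℝ ∞ (fun A : Fin n → Fin n → 𝕜 => (Matrix.of A)⁻¹ i j) A := by
  have h : (fun A : Fin n → Fin n → 𝕜 => (Matrix.of A)⁻¹ i j) = fun A =>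
      (Matrix.det (Matrix.of A))⁻¹ *
        Matrix.det (Matrix.of fun k l => if k = j then (if l = i then 1 else 0) else A k l) := by
    ext A
    rw [Matrix.inv_def, Matrix.smul_apply, Matrix.adjugate_apply, Ring.inverse_eq_inv', smul_eq_mul]
    congr 2
    ext k l
    by_cases hk : k = j <;> simp [Matrix.updateRow_apply, hk, Pi.single_apply]
  rw [h]
  refine (contDiff_det.contDiffAt.inv hA).mul ?_
  refine (contDiff_det.comp ?_).contDiffAt
  refine contDiff_pi.2 fun k => contDiff_pi.2 fun l => ?_
  by_cases hk : k = j
  · simp only [hk, if_true]; exact contDiff_const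
  · simp only [hk, if_false]; exact contDiff_apply_apply ℝ 𝕜 _ _

variable {m : ℕ} {M : Type*} [TopologicalSpace M] [ChartedSpace (EuclideanSpace ℝ (Fin m)) M]

lemma contMDiffOn_matrix_inv {U : Set M} {A : M → Matrix (Fin n) (Fin n) 𝕜}
    (hA : ∀ i j, ContMDiffOn (𝓡 m) 𝓘(ℝ, 𝕜) ∞ (fun x => A x i j) U)
    (hdet : ∀ x ∈ U, (A x).det ≠ 0) (i j : Fin n) :
    ContMDiffOn (𝓡 m) 𝓘(ℝ, 𝕜) ∞ (fun x => (A x)⁻¹ i j) U := by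
  have hA' : ContMDiffOn (𝓡 m) 𝓘(ℝ, Fin n → Fin n → 𝕜) ∞ (fun x => fun i j => A x i j) U :=
    contMDiffOn_pi_space.2 fun i => contMDiffOn_pi_space.2 fun j => hA i j
  intro x hx
  exact ContMDiffAt.comp_contMDiffWithinAt x
    (contDiffAt_inv (A := fun i j => A x i j) (hdet x hx) i j).contMDiffAt (hA' x hx)

end MatrixInverse

/-! ### Gram determinants -/

section Gram

open scoped ComplexOrder in
lemma det_gram_ne_zero {𝕜 E : Type*} [RCLike 𝕜] [NormedAddCommGroup E] [InnerProductSpace 𝕜 E]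
    {n : ℕ} {v : Fin n → E} (hv : LinearIndependent 𝕜 v) : (Matrix.gram 𝕜 v).det ≠ 0 := by
  have h := (Matrix.posDef_gram_iff_linearIndependent (𝕜 := 𝕜)).2 hv
  exact h.det_pos.ne'

end Gram

/-! ### Smoothness of coordinate fields, coordinate forms and the metric matrix -/

section Coordinates

variable {m : ℕ} {M : Type*} [TopologicalSpace M] [ChartedSpace (EuclideanSpace ℝ (Fin m)) M]
  [IsManifold (𝓡 m) ∞ M]
  {e : OpenPartialHomeomorph M (EuclideanSpace ℝ (Fin m))}

/-- The field is the image of a constant vector field on the coordinate domain under the tangent map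
of `e.symm`. -/
lemma contMDiffOn_coordField (he : e ∈ IsManifold.maximalAtlas (𝓡 m) ∞ M) (i : Fin m) :
    ContMDiffOn (𝓡 m) (𝓡 m).tangent ∞
      (fun x => (⟨x, coordField e i x⟩ : TangentBundle (𝓡 m) M)) e.source := by
  have h1 := (contMDiffOn_symm_of_mem_maximalAtlas he).contMDiffOn_tangentMapWithin (m := ∞)
    (by simp) e.open_target.uniqueMDiffOn
  have h2 : ContMDiffOn (𝓡 m) (𝓡 m).tangent ∞ (fun x => (⟨e x, EuclideanSpace.single i (1 : ℝ)⟩ :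
      TangentBundle (𝓡 m) (EuclideanSpace ℝ (Fin m)))) e.source := by
    intro x hx
    rw [contMDiffWithinAt_totalSpace]
    refine ⟨contMDiffOn_of_mem_maximalAtlas he x hx, ?_⟩
    simpa using contMDiffWithinAt_const
  have h3 := h1.comp h2 (fun x hx => e.map_source hx)
  refine h3.congr fun x hx => ?_
  simp only [Function.comp, tangentMapWithin]
  rw [mfderivWithin_of_isOpen e.open_target (e.map_source hx)]
  have h : ∀ z, z = x → ∀ v : EuclideanSpace ℝ (Fin m),
      (⟨x, v⟩ : TangentBundle (𝓡 m) M) = ⟨z, v⟩ := by rintro _ rfl _; rfl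
  exact h _ (e.left_inv hx) _

lemma linearIndependent_coordField (he : e ∈ IsManifold.maximalAtlas (𝓡 m) ∞ M) {x : M}
    (hx : x ∈ e.source) : LinearIndependent ℝ (fun i => coordField e i x) := by
  rw [Fintype.linearIndependent_iff]
  intro c hc i
  have h := congrArg (coordForm e i x) hc
  simpa [map_sum, coordForm_coordField he hx] using h

variable [RiemannianBundle (fun x : M => TangentSpace (𝓡 m) x)]

/-- The matrix `g_ij` of the metric in the chart `e`. -/
noncomputable def metricMatrix (e : OpenPartialHomeomorph M (EuclideanSpace ℝ (Fin m))) (x : M) :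
    Matrix (Fin m) (Fin m) ℝ :=
  Matrix.gram ℝ (fun i => coordField e i x)

lemma det_metricMatrix_ne_zero (he : e ∈ IsManifold.maximalAtlas (𝓡 m) ∞ M) {x : M}
    (hx : x ∈ e.source) : (metricMatrix e x).det ≠ 0 :=
  det_gram_ne_zero (linearIndependent_coordField he hx)

/-- Raising an index. Coordinates of vectors become inner products, whose smoothness follows from
that of the Riemannian metric. -/
lemma coordForm_eq_sum (he : e ∈ IsManifold.maximalAtlas (𝓡 m) ∞ M) {x : M}
    (hx : x ∈ e.source) (i : Fin m) (v : TangentSpace (𝓡 m) x) :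
    coordForm e i x v = ∑ k, (metricMatrix e x)⁻¹ i k * inner ℝ (coordField e k x) v := by
  have h : ∀ k, (inner ℝ (coordField e k x) v : ℝ)
      = ∑ j, metricMatrix e x k j * coordForm e j x v := by
    intro k
    conv_lhs => rw [← sum_coordForm_smul he hx v]
    rw [inner_sum]
    refine Finset.sum_congr rfl fun j _ => ?_
    rw [inner_smul_right, mul_comm]; rfl
  have h2 : (fun k => (inner ℝ (coordField e k x) v : ℝ))
      = (metricMatrix e x).mulVec fun j => coordForm e j x v := by
    ext k; rw [h k]; rfl
  have h3 : (metricMatrix e x)⁻¹.mulVec (fun k => (inner ℝ (coordField e k x) v : ℝ))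
      = fun j => coordForm e j x v := by
    rw [h2, Matrix.mulVec_mulVec, Matrix.nonsing_inv_mul _
      (isUnit_iff_ne_zero.2 (det_metricMatrix_ne_zero he hx)), Matrix.one_mulVec]
  exact (congrFun h3 i).symm

variable [IsContMDiffRiemannianBundle (𝓡 m) ∞ (EuclideanSpace ℝ (Fin m))
      (fun x : M => TangentSpace (𝓡 m) x)]

lemma contMDiffOn_metricMatrix (he : e ∈ IsManifold.maximalAtlas (𝓡 m) ∞ M) (i j : Fin m) :
    ContMDiffOn (𝓡 m) 𝓘(ℝ, ℝ) ∞ (fun x => metricMatrix e x i j) e.source :=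
  (contMDiffOn_coordField he i).inner_bundle (contMDiffOn_coordField he j)

lemma contMDiffOn_metricMatrix_inv (he : e ∈ IsManifold.maximalAtlas (𝓡 m) ∞ M) (i j : Fin m) :
    ContMDiffOn (𝓡 m) 𝓘(ℝ, ℝ) ∞ (fun x => (metricMatrix e x)⁻¹ i j) e.source :=
  contMDiffOn_matrix_inv (contMDiffOn_metricMatrix he)
    (fun _ hx => det_metricMatrix_ne_zero he hx) i j

lemma contMDiffOn_coordForm (he : e ∈ IsManifold.maximalAtlas (𝓡 m) ∞ M) {U : Set M}
    (hU : U ⊆ e.source) {X : Π x : M, TangentSpace (𝓡 m) x}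
    (hX : ContMDiffOn (𝓡 m) (𝓡 m).tangent ∞ (fun x => (⟨x, X x⟩ : TangentBundle (𝓡 m) M)) U)
    (i : Fin m) : ContMDiffOn (𝓡 m) 𝓘(ℝ, ℝ) ∞ (fun x => coordForm e i x (X x)) U := by
  refine ContMDiffOn.congr (f := fun x => ∑ k, (metricMatrix e x)⁻¹ i k *
    inner ℝ (coordField e k x) (X x)) ?_ fun x hx => coordForm_eq_sum he (hU hx) i _
  exact contMDiffOn_finsetSum fun k _ => ((contMDiffOn_metricMatrix_inv he i k).mono hU).mul
    (((contMDiffOn_coordField he k).mono hU).inner_bundle hX)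

/-- For an orthonormal basis, `∑ₐ dx^i(e_a) dx^j(e_a) = g^{ij}`. -/
lemma sum_coordForm_mul_coordForm (he : e ∈ IsManifold.maximalAtlas (𝓡 m) ∞ M) {x : M}
    (hx : x ∈ e.source) (i j : Fin m) :
    ∑ a, coordForm e i x (tangentONB x a) * coordForm e j x (tangentONB x a)
      = (metricMatrix e x)⁻¹ i j := by
  have h : ∀ a, coordForm e i x (tangentONB x a) * coordForm e j x (tangentONB x a)
      = ∑ k, (metricMatrix e x)⁻¹ i k *
        (inner ℝ (coordField e k x) (tangentONB x a) * coordForm e j x (tangentONB x a)) := by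
    intro a
    rw [coordForm_eq_sum he hx i, Finset.sum_mul]
    exact Finset.sum_congr rfl fun k _ => by ring
  simp only [h]
  rw [Finset.sum_comm]
  have h2 : ∀ k, ∑ a, (inner ℝ (coordField e k x) (tangentONB x a) *
      coordForm e j x (tangentONB x a)) = if j = k then 1 else 0 := by
    intro k
    rw [← coordForm_coordField he hx j k]
    conv_rhs => rw [← (tangentONB x).sum_repr (coordField e k x)]
    rw [map_sum]
    refine Finset.sum_congr rfl fun a _ => ?_
    rw [map_smul, smul_eq_mul, OrthonormalBasis.repr_apply_apply, real_inner_comm]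
  simp only [← Finset.mul_sum, h2]
  simp

end Coordinates


/-! ### Smooth sections of the Hermitian bundle and local frames -/

section Hermitian

variable {m : ℕ} {M : Type*} [TopologicalSpace M] [ChartedSpace (EuclideanSpace ℝ (Fin m)) M]
  {F : Type*} [NormedAddCommGroup F] [NormedSpace ℂ F]
  {V : M → Type*} [TopologicalSpace (TotalSpace F V)]
  [∀ x, NormedAddCommGroup (V x)] [∀ x, InnerProductSpace ℂ (V x)] [FiberBundle F V]

/-- `σ` is smooth at `x` within `U`. -/
abbrev SmoothSectionWithinAt (m : ℕ) {M : Type*} [TopologicalSpace M]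
    [ChartedSpace (EuclideanSpace ℝ (Fin m)) M]
    (F : Type*) [NormedAddCommGroup F] [NormedSpace ℂ F]
    {V : M → Type*} [TopologicalSpace (TotalSpace F V)]
    [∀ x, NormedAddCommGroup (V x)] [∀ x, InnerProductSpace ℂ (V x)] [FiberBundle F V]
    (σ : Π x : M, V x) (U : Set M) (x : M) : Prop :=
  ContMDiffWithinAt (𝓡 m) ((𝓡 m).prod 𝓘(ℝ, F)) ∞ (fun x => TotalSpace.mk' F x (σ x)) U x

/-- `σ` is smooth on `U`. -/
abbrev SmoothSectionOn (m : ℕ) {M : Type*} [TopologicalSpace M]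
    [ChartedSpace (EuclideanSpace ℝ (Fin m)) M]
    (F : Type*) [NormedAddCommGroup F] [NormedSpace ℂ F]
    {V : M → Type*} [TopologicalSpace (TotalSpace F V)]
    [∀ x, NormedAddCommGroup (V x)] [∀ x, InnerProductSpace ℂ (V x)] [FiberBundle F V]
    (σ : Π x : M, V x) (U : Set M) : Prop :=
  ContMDiffOn (𝓡 m) ((𝓡 m).prod 𝓘(ℝ, F)) ∞ (fun x => TotalSpace.mk' F x (σ x)) U

/-- `σ` is differentiable at `x`. -/
abbrev DiffSectionAt (m : ℕ) {M : Type*} [TopologicalSpace M]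
    [ChartedSpace (EuclideanSpace ℝ (Fin m)) M]
    (F : Type*) [NormedAddCommGroup F] [NormedSpace ℂ F]
    {V : M → Type*} [TopologicalSpace (TotalSpace F V)]
    [∀ x, NormedAddCommGroup (V x)] [∀ x, InnerProductSpace ℂ (V x)] [FiberBundle F V]
    (σ : Π x : M, V x) (x : M) : Prop :=
  MDifferentiableAt (𝓡 m) ((𝓡 m).prod 𝓘(ℝ, F)) (fun y => TotalSpace.mk' F y (σ y)) x

lemma trivialization_smul [VectorBundle ℂ F V] {x₀ x : M}
    (hx : x ∈ (trivializationAt F V x₀).baseSet) (c : ℂ) (v : V x) :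
    (trivializationAt F V x₀ ⟨x, c • v⟩).2 = c • (trivializationAt F V x₀ ⟨x, v⟩).2 :=
  (Trivialization.linear ℂ (trivializationAt F V x₀) hx).map_smul c v

lemma contDiff_complex_smul : ContDiff ℝ ∞ (fun q : ℂ × F => q.1 • q.2) :=
  (ContinuousLinearMap.lsmul ℝ ℂ : ℂ →L[ℝ] F →L[ℝ] F).isBoundedBilinearMap.contDiff

/-- The smooth structure is real while the coefficient is complex, so the product is examined in a
trivialization, which is complex linear on fibres. -/
lemma SmoothSectionWithinAt.smul [VectorBundle ℂ F V] {c : M → ℂ} {σ : Π x : M, V x} {U : Set M}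
    {x : M} (hc : ContMDiffWithinAt (𝓡 m) 𝓘(ℝ, ℂ) ∞ c U x) (hσ : SmoothSectionWithinAt m F σ U x) :
    SmoothSectionWithinAt m F (fun x => c x • σ x) U x := by
  rw [SmoothSectionWithinAt] at hσ ⊢
  rw [contMDiffWithinAt_section] at hσ ⊢
  refine ContMDiffWithinAt.congr_of_eventuallyEq (ContMDiffAt.comp_contMDiffWithinAt x
    (contDiff_complex_smul (F := F)).contMDiff.contMDiffAt (hc.prodMk_space hσ)) ?_ ?_
  · filter_upwards [mem_nhdsWithin_of_mem_nhds ((trivializationAt F V x).open_baseSet.mem_nhds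
      (mem_baseSet_trivializationAt F V x))] with y hy
    exact trivialization_smul hy _ _
  · exact trivialization_smul (mem_baseSet_trivializationAt F V x) _ _

lemma SmoothSectionOn.smul [VectorBundle ℂ F V] {c : M → ℂ} {σ : Π x : M, V x} {U : Set M}
    (hc : ContMDiffOn (𝓡 m) 𝓘(ℝ, ℂ) ∞ c U) (hσ : SmoothSectionOn m F σ U) :
    SmoothSectionOn m F (fun x => c x • σ x) U :=
  fun x hx => SmoothSectionWithinAt.smul (hc x hx) (hσ x hx)

lemma DiffSectionAt.smul [VectorBundle ℂ F V] {c : M → ℂ} {σ : Π x : M, V x}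
    {x : M} (hc : MDifferentiableAt (𝓡 m) 𝓘(ℝ, ℂ) c x) (hσ : DiffSectionAt m F σ x) :
    DiffSectionAt m F (fun x => c x • σ x) x := by
  rw [DiffSectionAt] at hσ ⊢
  rw [mdifferentiableAt_section] at hσ ⊢
  refine MDifferentiableAt.congr_of_eventuallyEq (MDifferentiableAt.comp x
    ((contDiff_complex_smul (F := F)).contMDiff.contMDiffAt.mdifferentiableAt (by simp))
    (hc.prodMk_space hσ)) ?_
  filter_upwards [(trivializationAt F V x).open_baseSet.mem_nhds
      (mem_baseSet_trivializationAt F V x)] with y hy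
  exact trivialization_smul hy _ _

lemma SmoothSectionOn.sum [VectorBundle ℝ F V] {ι : Type*} {s : Finset ι} {σ : ι → Π x : M, V x}
    {U : Set M} (hσ : ∀ i ∈ s, SmoothSectionOn m F (σ i) U) :
    SmoothSectionOn m F (fun x => ∑ i ∈ s, σ i x) U :=
  ContMDiffOn.sum_section fun i hi => hσ i hi

lemma SmoothSectionWithinAt.inner [VectorBundle ℝ F V]
    (hV : IsSmoothHermitian (m := m) F (V := V)) {σ τ : Π x : M, V x} {U : Set M} {x : M}
    (hσ : SmoothSectionWithinAt m F σ U x) (hτ : SmoothSectionWithinAt m F τ U x) :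
    ContMDiffWithinAt (𝓡 m) 𝓘(ℝ, ℂ) ∞ (fun x => inner ℂ (σ x) (τ x)) U x := by
  rcases hV with ⟨g, g_smooth, hg⟩
  simp only [hg]
  have : ContMDiffWithinAt (𝓡 m) ((𝓡 m).prod 𝓘(ℝ, ℂ)) ∞
      (fun x => TotalSpace.mk' ℂ (E := Bundle.Trivial M ℂ) x (g x (σ x) (τ x))) U x := by
    apply ContMDiffWithinAt.clm_bundle_apply₂ (F₁ := F) (F₂ := F)
    · exact g_smooth.contMDiffAt.contMDiffWithinAt
    · exact hσ
    · exact hτ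
  simp only [contMDiffWithinAt_totalSpace] at this
  exact this.2

lemma SmoothSectionOn.inner [VectorBundle ℝ F V]
    (hV : IsSmoothHermitian (m := m) F (V := V)) {σ τ : Π x : M, V x} {U : Set M}
    (hσ : SmoothSectionOn m F σ U) (hτ : SmoothSectionOn m F τ U) :
    ContMDiffOn (𝓡 m) 𝓘(ℝ, ℂ) ∞ (fun x => inner ℂ (σ x) (τ x)) U :=
  fun x hx => SmoothSectionWithinAt.inner hV (hσ x hx) (hτ x hx)

/-- The frame dual to `fr` with respect to the Hermitian metric. -/
noncomputable def dualFrame {ℓ : ℕ} (fr : Fin ℓ → Π x : M, V x) (b : Fin ℓ) (x : M) : V x :=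
  ∑ c, star ((Matrix.gram ℂ fun a => fr a x)⁻¹ b c) • fr c x

variable {ℓ : ℕ} {fr : Fin ℓ → Π x : M, V x} {U : Set M}

lemma inner_dualFrame_eq (b : Fin ℓ) (x : M) (v : V x) :
    inner ℂ (dualFrame fr b x) v
      = ∑ c, (Matrix.gram ℂ fun a => fr a x)⁻¹ b c * inner ℂ (fr c x) v := by
  rw [dualFrame, sum_inner]
  exact Finset.sum_congr rfl fun c _ => by simp [inner_smul_left]

lemma IsSmoothFrameOn.inner_dualFrame (hfr : IsSmoothFrameOn (m := m) F fr U) {x : M} (hx : x ∈ U)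
    (b a : Fin ℓ) : inner ℂ (dualFrame fr b x) (fr a x) = if b = a then (1 : ℂ) else 0 := by
  rw [inner_dualFrame_eq]
  have h := Matrix.nonsing_inv_mul (Matrix.gram ℂ fun a => fr a x)
    (isUnit_iff_ne_zero.2 (det_gram_ne_zero (hfr.linearIndependent x hx)))
  have h2 := congrFun (congrFun h b) a
  rw [Matrix.one_apply, Matrix.mul_apply] at h2
  exact h2

/-- Pairing with the dual frame reads off the coefficients. In this way components are smooth or
measurable as soon as inner products are. -/
lemma IsSmoothFrameOn.sum_inner_smul (hfr : IsSmoothFrameOn (m := m) F fr U) {x : M} (hx : x ∈ U)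
    (v : V x) : ∑ a, inner ℂ (dualFrame fr a x) v • fr a x = v := by
  have hv : v ∈ Submodule.span ℂ (Set.range fun a => fr a x) := by
    rw [hfr.span_eq_top x hx]; trivial
  obtain ⟨c, rfl⟩ := (Submodule.mem_span_range_iff_exists_fun ℂ).1 hv
  refine Finset.sum_congr rfl fun a _ => ?_
  congr 1
  rw [inner_sum]
  simp [inner_smul_right, hfr.inner_dualFrame hx]

lemma IsSmoothFrameOn.inner_dualFrame_sum (hfr : IsSmoothFrameOn (m := m) F fr U) {x : M}
    (hx : x ∈ U) (c : Fin ℓ → ℂ) (a : Fin ℓ) :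
    inner ℂ (dualFrame fr a x) (∑ b, c b • fr b x) = c a := by
  rw [inner_sum]
  simp [inner_smul_right, hfr.inner_dualFrame hx]

lemma IsSmoothFrameOn.ext_inner (hfr : IsSmoothFrameOn (m := m) F fr U) {x : M} (hx : x ∈ U)
    {v w : V x} (h : ∀ a, inner ℂ (dualFrame fr a x) v = inner ℂ (dualFrame fr a x) w) :
    v = w := by
  rw [← hfr.sum_inner_smul hx v, ← hfr.sum_inner_smul hx w]
  exact Finset.sum_congr rfl fun a _ => by rw [h a]

/-- `⟪w, v⟫ = ∑ⱼ ⟪w, e_a⟫ ⟪e^a, v⟫`. -/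
lemma IsSmoothFrameOn.mono (hfr : IsSmoothFrameOn (m := m) F fr U) {U' : Set M} (h : U' ⊆ U) :
    IsSmoothFrameOn (m := m) F fr U' :=
  ⟨fun x hx => hfr.linearIndependent x (h hx), fun x hx => hfr.span_eq_top x (h hx),
    fun a => (hfr.contMDiffOn a).mono h⟩

variable [VectorBundle ℝ F V]

lemma contMDiffOn_star {c : M → ℂ} (hc : ContMDiffOn (𝓡 m) 𝓘(ℝ, ℂ) ∞ c U) :
    ContMDiffOn (𝓡 m) 𝓘(ℝ, ℂ) ∞ (fun x => star (c x)) U :=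
  fun x hx => ContMDiffAt.comp_contMDiffWithinAt x
    (Complex.conjCLE.contDiff (n := ∞)).contMDiff.contMDiffAt (hc x hx)

lemma IsSmoothFrameOn.contMDiffOn_dualFrame [VectorBundle ℂ F V]
    (hV : IsSmoothHermitian (m := m) F (V := V))
    (hfr : IsSmoothFrameOn (m := m) F fr U) (b : Fin ℓ) :
    SmoothSectionOn m F (dualFrame fr b) U := by
  unfold dualFrame
  refine SmoothSectionOn.sum fun c _ => SmoothSectionOn.smul ?_ (hfr.contMDiffOn c)
  refine contMDiffOn_star (contMDiffOn_matrix_inv (fun i j => ?_) (fun x hx =>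
    det_gram_ne_zero (hfr.linearIndependent x hx)) b c)
  exact SmoothSectionOn.inner hV (hfr.contMDiffOn i) (hfr.contMDiffOn j)

end Hermitian


/-! ### The Levi-Civita connection -/

section LeviCivita

variable {m : ℕ} {M : Type*} [TopologicalSpace M] [ChartedSpace (EuclideanSpace ℝ (Fin m)) M]
  [IsManifold (𝓡 m) ∞ M]

/-- Vector fields differentiable at `x`. -/
abbrev DiffVFAt (X : Π x : M, TangentSpace (𝓡 m) x) (x : M) : Prop :=
  MDifferentiableAt (𝓡 m) (𝓡 m).tangent (fun y => (⟨y, X y⟩ : TangentBundle (𝓡 m) M)) x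

/-- Vector fields smooth on `U`. -/
abbrev SmoothVFOn (X : Π x : M, TangentSpace (𝓡 m) x) (U : Set M) : Prop :=
  ContMDiffOn (𝓡 m) (𝓡 m).tangent ∞ (fun y => (⟨y, X y⟩ : TangentBundle (𝓡 m) M)) U

lemma SmoothVFOn.diffVFAt {X : Π x : M, TangentSpace (𝓡 m) x} {U : Set M} (hX : SmoothVFOn X U)
    (hU : IsOpen U) {x : M} (hx : x ∈ U) : DiffVFAt X x :=
  (hX.contMDiffAt (hU.mem_nhds hx)).mdifferentiableAt (by simp)

lemma diffVFAt_extend {x : M} (v : TangentSpace (𝓡 m) x) :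
    DiffVFAt (FiberBundle.extend (EuclideanSpace ℝ (Fin m)) v) x :=
  FiberBundle.mdifferentiableAt_extend (𝓡 m) (EuclideanSpace ℝ (Fin m)) v

lemma contMDiffOn_mvfderiv_apply {U : Set M} (hU : IsOpen U) {c : M → ℝ}
    (hc : ContMDiffOn (𝓡 m) 𝓘(ℝ, ℝ) ∞ c U) {X : Π x : M, TangentSpace (𝓡 m) x}
    (hX : SmoothVFOn X U) :
    ContMDiffOn (𝓡 m) 𝓘(ℝ, ℝ) ∞ (fun x => mvfderiv (𝓡 m) c x (X x)) U := by
  have h1 := hc.contMDiffOn_tangentMapWithin (m := ∞) (by simp) hU.uniqueMDiffOn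
  have h2 := h1.comp hX (fun x hx => hx)
  intro x hx
  have h3 := h2 x hx
  rw [contMDiffWithinAt_totalSpace] at h3
  have h4 := h3.2
  simp only [Function.comp, tangentMapWithin] at h4
  refine ContMDiffWithinAt.congr (f := fun x => mfderivWithin (𝓡 m) 𝓘(ℝ, ℝ) c U x (X x)) ?_ ?_ ?_
  · simpa using h4
  · intro y hy; rw [mfderivWithin_of_isOpen hU hy]; rfl
  · rw [mfderivWithin_of_isOpen hU hx]; rfl

variable [RiemannianBundle (fun x : M => TangentSpace (𝓡 m) x)]
  [IsContMDiffRiemannianBundle (𝓡 m) ∞ (EuclideanSpace ℝ (Fin m))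
      (fun x : M => TangentSpace (𝓡 m) x)]

lemma DiffVFAt.inner {X Y : Π x : M, TangentSpace (𝓡 m) x} {x : M} (hX : DiffVFAt X x)
    (hY : DiffVFAt Y x) :
    MDifferentiableAt (𝓡 m) 𝓘(ℝ, ℝ) (fun y => (inner ℝ (X y) (Y y) : ℝ)) x :=
  have : IsContMDiffRiemannianBundle (𝓡 m) 1 (EuclideanSpace ℝ (Fin m))
      (fun x : M => TangentSpace (𝓡 m) x) := .of_le (n := ∞) (by simp)
  MDifferentiableAt.inner_bundle hX hY

/-- The derivatives `Y f` and `Z f` occur twice each, once from differentiating an inner product and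
once from a Lie bracket, with opposite signs. -/
lemma koszul_smul_left {X Y Z : Π x : M, TangentSpace (𝓡 m) x} {f : M → ℝ} {x : M}
    (hf : MDifferentiableAt (𝓡 m) 𝓘(ℝ, ℝ) f x) (hX : DiffVFAt X x) (hY : DiffVFAt Y x)
    (hZ : DiffVFAt Z x) : koszul (f • X) Y Z x = f x * koszul X Y Z x := by
  have h1 : mvfderiv (𝓡 m) (fun y => (inner ℝ (Z y) ((f • X) y) : ℝ)) x
      = f x • mvfderiv (𝓡 m) (fun y => (inner ℝ (Z y) (X y) : ℝ)) x
        + (inner ℝ (Z x) (X x) : ℝ) • mvfderiv (𝓡 m) f x := by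
    rw [← mvfderiv_mul hf (hZ.inner hX)]
    congr 1; ext y; simp [inner_smul_right]
  have h2 : mvfderiv (𝓡 m) (fun y => (inner ℝ ((f • X) y) (Y y) : ℝ)) x
      = f x • mvfderiv (𝓡 m) (fun y => (inner ℝ (X y) (Y y) : ℝ)) x
        + (inner ℝ (X x) (Y x) : ℝ) • mvfderiv (𝓡 m) f x := by
    rw [← mvfderiv_mul hf (hX.inner hY)]
    congr 1; ext y; simp [inner_smul_left]
  unfold koszul
  rw [h1, h2, VectorField.mlieBracket_smul_left hf hX, VectorField.mlieBracket_smul_right hf hX]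
  simp only [Pi.smul_apply', map_smul, inner_add_left, inner_smul_left, inner_smul_right,
    add_apply, smul_apply, smul_eq_mul,
    conj_trivial, real_inner_comm (X x)]
  simp only [neg_mul, real_inner_comm]
  ring

lemma koszul_smul_right {X Y Z : Π x : M, TangentSpace (𝓡 m) x} {f : M → ℝ} {x : M}
    (hf : MDifferentiableAt (𝓡 m) 𝓘(ℝ, ℝ) f x) (hX : DiffVFAt X x) (hY : DiffVFAt Y x)
    (hZ : DiffVFAt Z x) : koszul X Y (f • Z) x = f x * koszul X Y Z x := by
  have h1 : mvfderiv (𝓡 m) (fun y => (inner ℝ (Y y) ((f • Z) y) : ℝ)) x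
      = f x • mvfderiv (𝓡 m) (fun y => (inner ℝ (Y y) (Z y) : ℝ)) x
        + (inner ℝ (Y x) (Z x) : ℝ) • mvfderiv (𝓡 m) f x := by
    rw [← mvfderiv_mul hf (hY.inner hZ)]
    congr 1; ext y; simp [inner_smul_right]
  have h2 : mvfderiv (𝓡 m) (fun y => (inner ℝ ((f • Z) y) (X y) : ℝ)) x
      = f x • mvfderiv (𝓡 m) (fun y => (inner ℝ (Z y) (X y) : ℝ)) x
        + (inner ℝ (Z x) (X x) : ℝ) • mvfderiv (𝓡 m) f x := by
    rw [← mvfderiv_mul hf (hZ.inner hX)]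
    congr 1; ext y; simp [inner_smul_left]
  unfold koszul
  rw [h1, h2, VectorField.mlieBracket_smul_left hf hZ, VectorField.mlieBracket_smul_right hf hZ]
  simp only [Pi.smul_apply', map_smul, inner_add_left, inner_smul_left, inner_smul_right,
    add_apply, smul_apply, smul_eq_mul,
    conj_trivial]
  simp only [neg_mul, real_inner_comm]
  ring

/-- In the middle slot the `Z f` terms cancel, but the two `X f` terms add up. The factor `2` is
compensated by the `1 / 2` in `leviCivita` and yields the Leibniz rule. -/
lemma koszul_smul_mid {X Y Z : Π x : M, TangentSpace (𝓡 m) x} {f : M → ℝ} {x : M}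
    (hf : MDifferentiableAt (𝓡 m) 𝓘(ℝ, ℝ) f x) (hX : DiffVFAt X x) (hY : DiffVFAt Y x)
    (hZ : DiffVFAt Z x) : koszul X (f • Y) Z x
      = f x * koszul X Y Z x + 2 * (mvfderiv (𝓡 m) f x (X x) * inner ℝ (Y x) (Z x)) := by
  have h1 : mvfderiv (𝓡 m) (fun y => (inner ℝ ((f • Y) y) (Z y) : ℝ)) x
      = f x • mvfderiv (𝓡 m) (fun y => (inner ℝ (Y y) (Z y) : ℝ)) x
        + (inner ℝ (Y x) (Z x) : ℝ) • mvfderiv (𝓡 m) f x := by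
    rw [← mvfderiv_mul hf (hY.inner hZ)]
    congr 1; ext y; simp [inner_smul_left]
  have h2 : mvfderiv (𝓡 m) (fun y => (inner ℝ (X y) ((f • Y) y) : ℝ)) x
      = f x • mvfderiv (𝓡 m) (fun y => (inner ℝ (X y) (Y y) : ℝ)) x
        + (inner ℝ (X x) (Y x) : ℝ) • mvfderiv (𝓡 m) f x := by
    rw [← mvfderiv_mul hf (hX.inner hY)]
    congr 1; ext y; simp [inner_smul_right]
  unfold koszul
  rw [h1, h2, VectorField.mlieBracket_smul_left hf hY, VectorField.mlieBracket_smul_right hf hY]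
  simp only [Pi.smul_apply', map_smul, inner_add_left, inner_smul_left, inner_smul_right,
    add_apply, smul_apply, smul_eq_mul,
    conj_trivial]
  simp only [neg_mul, real_inner_comm]
  ring

lemma koszul_add_left {X X' Y Z : Π x : M, TangentSpace (𝓡 m) x} {x : M} (hX : DiffVFAt X x)
    (hX' : DiffVFAt X' x) (hY : DiffVFAt Y x) (hZ : DiffVFAt Z x) :
    koszul (X + X') Y Z x = koszul X Y Z x + koszul X' Y Z x := by
  have h1 : mvfderiv (𝓡 m) (fun y => (inner ℝ (Z y) ((X + X') y) : ℝ)) x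
      = mvfderiv (𝓡 m) (fun y => (inner ℝ (Z y) (X y) : ℝ)) x
        + mvfderiv (𝓡 m) (fun y => (inner ℝ (Z y) (X' y) : ℝ)) x := by
    rw [← mvfderiv_add (hZ.inner hX) (hZ.inner hX')]
    congr 1; ext y; simp [inner_add_right]
  have h2 : mvfderiv (𝓡 m) (fun y => (inner ℝ ((X + X') y) (Y y) : ℝ)) x
      = mvfderiv (𝓡 m) (fun y => (inner ℝ (X y) (Y y) : ℝ)) x
        + mvfderiv (𝓡 m) (fun y => (inner ℝ (X' y) (Y y) : ℝ)) x := by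
    rw [← mvfderiv_add (hX.inner hY) (hX'.inner hY)]
    congr 1; ext y; simp [inner_add_left]
  unfold koszul
  rw [h1, h2, VectorField.mlieBracket_add_left hX hX', VectorField.mlieBracket_add_right hX hX']
  simp only [Pi.add_apply, map_add, inner_add_left, inner_add_right,
    add_apply]
  ring

lemma koszul_add_right {X Y Z Z' : Π x : M, TangentSpace (𝓡 m) x} {x : M} (hX : DiffVFAt X x)
    (hY : DiffVFAt Y x) (hZ : DiffVFAt Z x) (hZ' : DiffVFAt Z' x) :
    koszul X Y (Z + Z') x = koszul X Y Z x + koszul X Y Z' x := by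
  have h1 : mvfderiv (𝓡 m) (fun y => (inner ℝ (Y y) ((Z + Z') y) : ℝ)) x
      = mvfderiv (𝓡 m) (fun y => (inner ℝ (Y y) (Z y) : ℝ)) x
        + mvfderiv (𝓡 m) (fun y => (inner ℝ (Y y) (Z' y) : ℝ)) x := by
    rw [← mvfderiv_add (hY.inner hZ) (hY.inner hZ')]
    congr 1; ext y; simp [inner_add_right]
  have h2 : mvfderiv (𝓡 m) (fun y => (inner ℝ ((Z + Z') y) (X y) : ℝ)) x
      = mvfderiv (𝓡 m) (fun y => (inner ℝ (Z y) (X y) : ℝ)) x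
        + mvfderiv (𝓡 m) (fun y => (inner ℝ (Z' y) (X y) : ℝ)) x := by
    rw [← mvfderiv_add (hZ.inner hX) (hZ'.inner hX)]
    congr 1; ext y; simp [inner_add_left]
  unfold koszul
  rw [h1, h2, VectorField.mlieBracket_add_left hZ hZ', VectorField.mlieBracket_add_right hZ hZ']
  simp only [Pi.add_apply, map_add, inner_add_left, inner_add_right,
    add_apply]
  ring

lemma koszul_add_mid {X Y Y' Z : Π x : M, TangentSpace (𝓡 m) x} {x : M} (hX : DiffVFAt X x)
    (hY : DiffVFAt Y x) (hY' : DiffVFAt Y' x) (hZ : DiffVFAt Z x) :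
    koszul X (Y + Y') Z x = koszul X Y Z x + koszul X Y' Z x := by
  have h1 : mvfderiv (𝓡 m) (fun y => (inner ℝ ((Y + Y') y) (Z y) : ℝ)) x
      = mvfderiv (𝓡 m) (fun y => (inner ℝ (Y y) (Z y) : ℝ)) x
        + mvfderiv (𝓡 m) (fun y => (inner ℝ (Y' y) (Z y) : ℝ)) x := by
    rw [← mvfderiv_add (hY.inner hZ) (hY'.inner hZ)]
    congr 1; ext y; simp [inner_add_left]
  have h2 : mvfderiv (𝓡 m) (fun y => (inner ℝ (X y) ((Y + Y') y) : ℝ)) x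
      = mvfderiv (𝓡 m) (fun y => (inner ℝ (X y) (Y y) : ℝ)) x
        + mvfderiv (𝓡 m) (fun y => (inner ℝ (X y) (Y' y) : ℝ)) x := by
    rw [← mvfderiv_add (hX.inner hY) (hX.inner hY')]
    congr 1; ext y; simp [inner_add_right]
  unfold koszul
  rw [h1, h2, VectorField.mlieBracket_add_left hY hY', VectorField.mlieBracket_add_right hY hY']
  simp only [Pi.add_apply, map_add, inner_add_left, inner_add_right,
    add_apply]
  ring

lemma tensorialAt_koszul_left {Y Z : Π x : M, TangentSpace (𝓡 m) x} {x : M} (hY : DiffVFAt Y x)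
    (hZ : DiffVFAt Z x) :
    TensorialAt (𝓡 m) (EuclideanSpace ℝ (Fin m)) (fun X => koszul X Y Z x) x :=
  ⟨fun hf hX => koszul_smul_left hf hX hY hZ, fun hX hX' => koszul_add_left hX hX' hY hZ⟩

lemma tensorialAt_koszul_right {X Y : Π x : M, TangentSpace (𝓡 m) x} {x : M} (hX : DiffVFAt X x)
    (hY : DiffVFAt Y x) :
    TensorialAt (𝓡 m) (EuclideanSpace ℝ (Fin m)) (fun Z => koszul X Y Z x) x :=
  ⟨fun hf hZ => koszul_smul_right hf hX hY hZ, fun hZ hZ' => koszul_add_right hX hY hZ hZ'⟩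

/-- The Koszul formula. -/
lemma inner_leviCivita {X Y Z : Π x : M, TangentSpace (𝓡 m) x} {x : M} (hX : DiffVFAt X x)
    (hY : DiffVFAt Y x) (hZ : DiffVFAt Z x) :
    inner ℝ (leviCivita Y x (X x)) (Z x) = 1 / 2 * koszul X Y Z x := by
  have h0 := diffVFAt_extend (m := m) (X x)
  -- By tensoriality in the last slot the Koszul expression is a linear functional of `Z x`, and
  -- `leviCivita` is its Riesz representative written in an orthonormal basis.
  let L := (tensorialAt_koszul_right h0 hY).mkHom
    (fun Z => koszul (FiberBundle.extend (EuclideanSpace ℝ (Fin m)) (X x)) Y Z x) x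
  have hL : ∀ Z, DiffVFAt Z x → L (Z x)
      = koszul (FiberBundle.extend (EuclideanSpace ℝ (Fin m)) (X x)) Y Z x := fun Z hZ =>
    (tensorialAt_koszul_right h0 hY).mkHom_apply hZ
  have hL' : ∀ v, koszul (FiberBundle.extend (EuclideanSpace ℝ (Fin m)) (X x)) Y
      (FiberBundle.extend (EuclideanSpace ℝ (Fin m)) v) x = L v := fun v =>
    ((tensorialAt_koszul_right h0 hY).mkHom_apply_eq_extend v).symm
  -- Tensoriality in the first slot permits replacing `X` by the extension of `X x`.
  have h1 : koszul X Y Z x = L (Z x) := by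
    rw [hL Z hZ]
    exact (tensorialAt_koszul_left hY hZ).pointwise hX h0 (by simp)
  rw [h1]
  unfold leviCivita
  simp only [hL']
  rw [sum_inner]
  conv_rhs => rw [← (tangentONB x).sum_repr (Z x), map_sum, Finset.mul_sum]
  refine Finset.sum_congr rfl fun i _ => ?_
  rw [inner_smul_left, map_smul, OrthonormalBasis.repr_apply_apply, smul_eq_mul]
  simp only [conj_trivial]
  ring

/-- Nondegeneracy of the metric. The algebraic rules for `leviCivita` below are all deduced from
those for `koszul` through this characterization. -/
lemma leviCivita_eq_of_inner {Y : Π x : M, TangentSpace (𝓡 m) x} {x : M}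
    {v w : TangentSpace (𝓡 m) x}
    (hY : DiffVFAt Y x) (h : ∀ z, inner ℝ w z = 1 / 2 * koszul
      (FiberBundle.extend (EuclideanSpace ℝ (Fin m)) v) Y
      (FiberBundle.extend (EuclideanSpace ℝ (Fin m)) z) x) : leviCivita Y x v = w := by
  refine ext_inner_right ℝ fun z => ?_
  rw [h z]
  have := inner_leviCivita (diffVFAt_extend (m := m) v) hY (diffVFAt_extend (m := m) z)
  simpa using this

lemma inner_leviCivita_extend {Y : Π x : M, TangentSpace (𝓡 m) x} {x : M}
    (hY : DiffVFAt Y x) (v z : TangentSpace (𝓡 m) x) :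
    inner ℝ (leviCivita Y x v) z = 1 / 2 * koszul
      (FiberBundle.extend (EuclideanSpace ℝ (Fin m)) v) Y
      (FiberBundle.extend (EuclideanSpace ℝ (Fin m)) z) x := by
  simpa using inner_leviCivita (diffVFAt_extend (m := m) v) hY (diffVFAt_extend (m := m) z)

lemma leviCivita_add_vector {Y : Π x : M, TangentSpace (𝓡 m) x} {x : M}
    (hY : DiffVFAt Y x) (v w : TangentSpace (𝓡 m) x) :
    leviCivita Y x (v + w) = leviCivita Y x v + leviCivita Y x w := by
  refine leviCivita_eq_of_inner hY fun z => ?_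
  have hz := diffVFAt_extend (m := m) z
  rw [inner_add_left, inner_leviCivita_extend hY, inner_leviCivita_extend hY, ← mul_add,
    ← (tensorialAt_koszul_left hY hz).mkHom_apply_eq_extend v,
    ← (tensorialAt_koszul_left hY hz).mkHom_apply_eq_extend w,
    ← (tensorialAt_koszul_left hY hz).mkHom_apply_eq_extend (v + w), map_add]

lemma leviCivita_smul_vector {Y : Π x : M, TangentSpace (𝓡 m) x} {x : M}
    (hY : DiffVFAt Y x) (c : ℝ) (v : TangentSpace (𝓡 m) x) :
    leviCivita Y x (c • v) = c • leviCivita Y x v := by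
  refine leviCivita_eq_of_inner hY fun z => ?_
  have hz := diffVFAt_extend (m := m) z
  rw [inner_smul_left, inner_leviCivita_extend hY,
    ← (tensorialAt_koszul_left hY hz).mkHom_apply_eq_extend v,
    ← (tensorialAt_koszul_left hY hz).mkHom_apply_eq_extend (c • v), map_smul, smul_eq_mul]
  simp only [conj_trivial]
  ring

lemma leviCivita_add {Y Y' : Π x : M, TangentSpace (𝓡 m) x} {x : M}
    (hY : DiffVFAt Y x) (hY' : DiffVFAt Y' x) (v : TangentSpace (𝓡 m) x) :
    leviCivita (Y + Y') x v = leviCivita Y x v + leviCivita Y' x v := by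
  refine leviCivita_eq_of_inner (mdifferentiableAt_add_section hY hY') fun z => ?_
  rw [inner_add_left, inner_leviCivita_extend hY, inner_leviCivita_extend hY', ← mul_add,
    koszul_add_mid (diffVFAt_extend v) hY hY' (diffVFAt_extend z)]

lemma leviCivita_smul {Y : Π x : M, TangentSpace (𝓡 m) x} {f : M → ℝ} {x : M}
    (hf : MDifferentiableAt (𝓡 m) 𝓘(ℝ, ℝ) f x)
    (hY : DiffVFAt Y x) (v : TangentSpace (𝓡 m) x) :
    leviCivita (f • Y) x v = f x • leviCivita Y x v + (mvfderiv (𝓡 m) f x v : ℝ) • Y x := by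
  refine leviCivita_eq_of_inner (hf.smul_section hY) fun z => ?_
  rw [inner_add_left, inner_smul_left, inner_smul_left, inner_leviCivita_extend hY,
    koszul_smul_mid hf (diffVFAt_extend v) hY (diffVFAt_extend z)]
  simp only [conj_trivial, FiberBundle.extend_apply_self]
  ring

lemma contMDiffOn_koszul {X Y Z : Π x : M, TangentSpace (𝓡 m) x} {U : Set M} (hU : IsOpen U)
    (hX : SmoothVFOn X U) (hY : SmoothVFOn Y U) (hZ : SmoothVFOn Z U) :
    ContMDiffOn (𝓡 m) 𝓘(ℝ, ℝ) ∞ (fun x => koszul X Y Z x) U := by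
  have hb : ∀ {X Y : Π x : M, TangentSpace (𝓡 m) x}, SmoothVFOn X U → SmoothVFOn Y U →
      SmoothVFOn (VectorField.mlieBracket (𝓡 m) X Y) U := by
    intro X Y hX hY x hx
    have : IsManifold (𝓡 m) (minSmoothness ℝ 3) M := by
      rw [minSmoothness_of_isRCLikeNormedField]; exact IsManifold.of_le (n := ∞) (by norm_cast)
    have : IsManifold (𝓡 m) (minSmoothness ℝ 2) M := by
      rw [minSmoothness_of_isRCLikeNormedField]; exact IsManifold.of_le (n := ∞) (by norm_cast)
    have : IsManifold (𝓡 m) (((⊤ : ℕ∞) : WithTop ℕ∞) + 1) M := by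
      simpa using (inferInstance : IsManifold (𝓡 m) ∞ M)
    exact (ContMDiffAt.mlieBracket_vectorField (n := (⊤ : ℕ∞)) (hX.contMDiffAt (hU.mem_nhds hx))
      (hY.contMDiffAt (hU.mem_nhds hx)) (m := (⊤ : ℕ∞)) (by simp)).contMDiffWithinAt
  unfold koszul
  exact ((((contMDiffOn_mvfderiv_apply hU (hY.inner_bundle hZ) hX).add
    (contMDiffOn_mvfderiv_apply hU (hZ.inner_bundle hX) hY)).sub
    (contMDiffOn_mvfderiv_apply hU (hX.inner_bundle hY) hZ)).add
    ((hb hX hY).inner_bundle hZ) |>.sub ((hb hY hZ).inner_bundle hX)).add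
    ((hb hZ hX).inner_bundle hY)

/-- The Christoffel symbol `Γ^l_{ij}` of the chart `e`. -/
noncomputable def christoffel (e : OpenPartialHomeomorph M (EuclideanSpace ℝ (Fin m)))
    (i j l : Fin m) (x : M) : ℝ :=
  coordForm e l x (leviCivita (coordField e j) x (coordField e i x))

/-- The symbols are `g^{lk}` times half the Koszul expression of coordinate fields; both factors are
smooth on the chart. -/
lemma contMDiffOn_christoffel {e : OpenPartialHomeomorph M (EuclideanSpace ℝ (Fin m))}
    (he : e ∈ IsManifold.maximalAtlas (𝓡 m) ∞ M) (i j l : Fin m) :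
    ContMDiffOn (𝓡 m) 𝓘(ℝ, ℝ) ∞ (christoffel e i j l) e.source := by
  refine ContMDiffOn.congr (f := fun x => ∑ k, (metricMatrix e x)⁻¹ l k *
    (1 / 2 * koszul (coordField e i) (coordField e j) (coordField e k) x)) ?_ fun x hx => ?_
  · exact contMDiffOn_finsetSum fun k _ => (contMDiffOn_metricMatrix_inv he l k).mul
      (contMDiffOn_const.mul (contMDiffOn_koszul e.open_source (contMDiffOn_coordField he i)
        (contMDiffOn_coordField he j) (contMDiffOn_coordField he k)))
  · rw [christoffel, coordForm_eq_sum he hx]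
    refine Finset.sum_congr rfl fun k _ => ?_
    have h := fun i => SmoothVFOn.diffVFAt (contMDiffOn_coordField he i) e.open_source hx
    rw [real_inner_comm, inner_leviCivita (h i) (h j) (h k)]

lemma leviCivita_coordField {e : OpenPartialHomeomorph M (EuclideanSpace ℝ (Fin m))}
    (he : e ∈ IsManifold.maximalAtlas (𝓡 m) ∞ M) {x : M} (hx : x ∈ e.source) (i j : Fin m) :
    leviCivita (coordField e j) x (coordField e i x)
      = ∑ l, christoffel e i j l x • coordField e l x :=
  (sum_coordForm_smul he hx _).symm

end LeviCivita


/-! ### The connection on sections, and the tensor covariant derivative -/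

section Connection

variable {m : ℕ} {M : Type*} [TopologicalSpace M] [ChartedSpace (EuclideanSpace ℝ (Fin m)) M]
  [IsManifold (𝓡 m) ∞ M]
  {F : Type*} [NormedAddCommGroup F] [NormedSpace ℂ F]
  {V : M → Type*} [TopologicalSpace (TotalSpace F V)]
  [∀ x, NormedAddCommGroup (V x)] [∀ x, InnerProductSpace ℂ (V x)] [FiberBundle F V]
  [VectorBundle ℂ F V] [VectorBundle ℝ F V] [ContMDiffVectorBundle ∞ F V (𝓡 m)]
  {cov : CovariantDerivative (𝓡 m) F V}

lemma SmoothSectionOn.diffSectionAt {σ : Π x : M, V x} {U : Set M} (hσ : SmoothSectionOn m F σ U)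
    (hU : IsOpen U) {x : M} (hx : x ∈ U) : DiffSectionAt m F σ x :=
  (hσ.contMDiffAt (hU.mem_nhds hx)).mdifferentiableAt (by simp)

lemma cov_congr {σ τ : Π x : M, V x} {x : M} (hσ : DiffSectionAt m F σ x)
    (h : ∀ᶠ y in 𝓝 x, σ y = τ y) : cov σ x = cov τ x := by
  refine cov.isCovariantDerivativeOnUniv.congr_of_eventuallyEq hσ ?_ Filter.univ_mem h
  exact hσ.congr_of_eventuallyEq (h.mono fun y hy => by simp [hy])

lemma cov_add {σ τ : Π x : M, V x} {x : M} (hσ : DiffSectionAt m F σ x)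
    (hτ : DiffSectionAt m F τ x) : cov (fun y => σ y + τ y) x = cov σ x + cov τ x :=
  cov.isCovariantDerivativeOnUniv.add hσ hτ

lemma cov_real_smul {σ : Π x : M, V x} {f : M → ℝ} {x : M} (hσ : DiffSectionAt m F σ x)
    (hf : MDifferentiableAt (𝓡 m) 𝓘(ℝ, ℝ) f x) (v : TangentSpace (𝓡 m) x) :
    cov (fun y => f y • σ y) x v = f x • cov σ x v + (mvfderiv (𝓡 m) f x v : ℝ) • σ x := by
  have h := cov.isCovariantDerivativeOnUniv.leibniz hσ hf
  exact congrArg (fun L => L v) h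

lemma cov_sum {ι : Type*} (s : Finset ι) {σ : ι → Π x : M, V x} {x : M}
    (hσ : ∀ i ∈ s, DiffSectionAt m F (σ i) x) :
    cov (fun y => ∑ i ∈ s, σ i y) x = ∑ i ∈ s, cov (σ i) x := by
  classical
  induction s using Finset.induction_on with
  | empty =>
    simp only [Finset.sum_empty]
    exact cov.isCovariantDerivativeOnUniv.zero
  | insert a s ha ih =>
    simp only [Finset.mem_insert, forall_eq_or_imp] at hσ
    simp only [Finset.sum_insert ha, ← ih hσ.2]
    exact cov_add hσ.1 (MDifferentiableAt.sum_section fun i hi => hσ.2 i hi)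

/-- The connection is given on the underlying real bundle and obeys the Leibniz rule for real
functions only. Writing `c σ = Re c σ + Im c (i σ)` and using that `∇` commutes with `i` extends it
to complex functions. -/
lemma cov_smul (hcov : IsComplexLinear cov) {σ : Π x : M, V x} {c : M → ℂ} {x : M}
    (hσ : DiffSectionAt m F σ x)
    (hc : MDifferentiableAt (𝓡 m) 𝓘(ℝ, ℂ) c x) (v : TangentSpace (𝓡 m) x) :
    cov (fun y => c y • σ y) x v = c x • cov σ x v + (mvfderiv (𝓡 m) c x v : ℂ) • σ x := by
  have hIσ : DiffSectionAt m F (fun y => Complex.I • σ y) x :=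
    DiffSectionAt.smul mdifferentiableAt_const hσ
  have hre : MDifferentiableAt (𝓡 m) 𝓘(ℝ, ℝ) (fun y => (c y).re) x :=
    (Complex.reCLM.contDiff (n := ∞)).contMDiff.contMDiffAt.mdifferentiableAt (by simp)
      |>.comp x hc
  have him : MDifferentiableAt (𝓡 m) 𝓘(ℝ, ℝ) (fun y => (c y).im) x :=
    (Complex.imCLM.contDiff (n := ∞)).contMDiff.contMDiffAt.mdifferentiableAt (by simp)
      |>.comp x hc
  have h : (fun y => c y • σ y) = fun y => (c y).re • σ y + (c y).im • (Complex.I • σ y) := by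
    ext y
    rw [← Complex.coe_smul, ← Complex.coe_smul, smul_smul, ← add_smul, Complex.re_add_im]
  have hdre : mvfderiv (𝓡 m) (fun y => (c y).re) x v = (mvfderiv (𝓡 m) c x v).re := by
    have := mfderiv_comp_apply (I := 𝓡 m) (I' := 𝓘(ℝ, ℂ)) (I'' := 𝓘(ℝ, ℝ)) (g := Complex.reCLM)
      (f := c) x
      ((Complex.reCLM.contDiff (n := ∞)).contMDiff.contMDiffAt.mdifferentiableAt (by simp)) hc v
    rw [mfderiv_eq_fderiv, ContinuousLinearMap.fderiv] at this
    exact this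
  have hdim : mvfderiv (𝓡 m) (fun y => (c y).im) x v = (mvfderiv (𝓡 m) c x v).im := by
    have := mfderiv_comp_apply (I := 𝓡 m) (I' := 𝓘(ℝ, ℂ)) (I'' := 𝓘(ℝ, ℝ)) (g := Complex.imCLM)
      (f := c) x
      ((Complex.imCLM.contDiff (n := ∞)).contMDiff.contMDiffAt.mdifferentiableAt (by simp)) hc v
    rw [mfderiv_eq_fderiv, ContinuousLinearMap.fderiv] at this
    exact this
  have hadd : cov (fun y => (c y).re • σ y + (c y).im • (Complex.I • σ y)) x
      = cov (fun y => (c y).re • σ y) x + cov (fun y => (c y).im • (Complex.I • σ y)) x :=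
    cov_add (hre.smul_section hσ) (him.smul_section hIσ)
  rw [h, hadd, add_apply, cov_real_smul hσ hre, cov_real_smul hIσ him, hcov σ x hσ, hdre, hdim]
  simp only [← Complex.coe_smul, smul_smul]
  conv_rhs => rw [← Complex.re_add_im (c x), ← Complex.re_add_im (mvfderiv (𝓡 m) c x v)]
  simp only [add_smul]
  abel

variable [T2Space M]

lemma exists_bump {U : Set M} (hU : IsOpen U) {x : M} (hx : x ∈ U) :
    ∃ χ : M → ℝ, ContMDiff (𝓡 m) 𝓘(ℝ, ℝ) ∞ χ ∧ tsupport χ ⊆ U ∧ HasCompactSupport χ ∧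
      ∀ᶠ y in 𝓝 x, χ y = 1 := by
  obtain ⟨f, -, hf⟩ := ((SmoothBumpFunction.nhds_basis_tsupport (I := 𝓡 m) x).mem_iff).1
    (hU.mem_nhds hx)
  exact ⟨f, f.contMDiff, hf, f.hasCompactSupport, f.eventuallyEq_one⟩

lemma SmoothSectionOn.smul_bump {σ : Π x : M, V x} {U : Set M} (hU : IsOpen U)
    (hσ : SmoothSectionOn m F σ U) {χ : M → ℝ} (hχ : ContMDiff (𝓡 m) 𝓘(ℝ, ℝ) ∞ χ)
    (hs : tsupport χ ⊆ U) : IsSmoothSection (m := m) F (fun x => χ x • σ x) :=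
  ContMDiffOn.smul_section_of_tsupport hχ.contMDiffOn hU hs hσ

/-- Smoothness of the connection is used for global sections. A local section is multiplied by a
bump function equal to `1` near the point, and locality of `∇` removes the bump. -/
lemma SmoothSectionOn.cov_apply [cov.ContMDiffCovariantDerivative ∞] {σ : Π x : M, V x} {U : Set M}
    (hU : IsOpen U) (hσ : SmoothSectionOn m F σ U) {X : Π x : M, TangentSpace (𝓡 m) x}
    (hX : SmoothVFOn X U) : SmoothSectionOn m F (fun x => cov σ x (X x)) U := by
  intro x hx
  obtain ⟨χ, hχ, hs, -, h1⟩ := exists_bump (m := m) hU hx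
  have hg := hσ.smul_bump hU hχ hs
  have hc := (CovariantDerivative.ContMDiffCovariantDerivative.contMDiff (cov := cov) (k := ∞)
    ).contMDiff (σ := fun x => χ x • σ x) (by
      rw [contMDiffOn_univ]
      refine ContMDiff.congr hg fun y => ?_
      rfl)
  have h2 : SmoothSectionWithinAt m F (fun x => cov (fun x => χ x • σ x) x (X x)) U x :=
    ContMDiffWithinAt.clm_bundle_apply (F₁ := EuclideanSpace ℝ (Fin m)) (F₂ := F)
      ((contMDiffOn_univ.1 hc).contMDiffAt.contMDiffWithinAt) (hX x hx)
  refine h2.congr_of_eventuallyEq_of_mem ?_ hx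
  have h3 : ∀ᶠ y in 𝓝 x, cov (fun x => χ x • σ x) y = cov σ y := by
    filter_upwards [h1.eventually_nhds] with y hy
    refine cov_congr ((hg y).mdifferentiableAt (by simp)) ?_
    filter_upwards [hy] with z hz
    rw [hz, one_smul]
  filter_upwards [mem_nhdsWithin_of_mem_nhds h3] with y hy
  rw [hy]

end Connection

/-! ### Tensor fields and their covariant derivatives -/

section Tensor

variable {m : ℕ} {M : Type*} [TopologicalSpace M] [ChartedSpace (EuclideanSpace ℝ (Fin m)) M]
  [IsManifold (𝓡 m) ∞ M]
  {F : Type*} [NormedAddCommGroup F] [NormedSpace ℂ F]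
  {V : M → Type*} [TopologicalSpace (TotalSpace F V)]
  [∀ x, NormedAddCommGroup (V x)] [∀ x, InnerProductSpace ℂ (V x)] [FiberBundle F V]

variable (F) in
/-- Smooth tensor fields, in terms of coordinate vector fields. -/
def IsLocSmoothTensor {j : ℕ} (T : TensorField (m := m) V j) : Prop :=
  ∀ e ∈ IsManifold.maximalAtlas (𝓡 m) ∞ M, ∀ α : Fin j → Fin m,
    SmoothSectionOn m F (fun x => T x fun k => coordField e (α k) x) e.source

lemma tensor_expand {e : OpenPartialHomeomorph M (EuclideanSpace ℝ (Fin m))}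
    (he : e ∈ IsManifold.maximalAtlas (𝓡 m) ∞ M) {x : M} (hx : x ∈ e.source) {j : ℕ}
    {W : Type*} [AddCommGroup W] [Module ℝ W]
    (T : MultilinearMap ℝ (fun _ : Fin j => TangentSpace (𝓡 m) x) W)
    (v : Fin j → TangentSpace (𝓡 m) x) :
    T v = ∑ α : Fin j → Fin m, (∏ k, coordForm e (α k) x (v k)) •
      T fun k => coordField e (α k) x := by
  conv_lhs => rw [show v = fun k => ∑ i, coordForm e i x (v k) • coordField e i x from
    funext fun k => (sum_coordForm_smul he hx (v k)).symm]
  rw [MultilinearMap.map_sum]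
  exact Finset.sum_congr rfl fun α _ => MultilinearMap.map_smul_univ _ _ _

variable [VectorBundle ℝ F V]
  [RiemannianBundle (fun x : M => TangentSpace (𝓡 m) x)]
  [IsContMDiffRiemannianBundle (𝓡 m) ∞ (EuclideanSpace ℝ (Fin m))
      (fun x : M => TangentSpace (𝓡 m) x)]

lemma IsLocSmoothTensor.smooth_apply {j : ℕ} {T : TensorField (m := m) V j}
    (hT : IsLocSmoothTensor F T) {X : Fin j → Π x : M, TangentSpace (𝓡 m) x} {U : Set M}
    (hU : IsOpen U) (hX : ∀ k, SmoothVFOn (X k) U) :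
    SmoothSectionOn m F (fun x => T x fun k => X k x) U := by
  intro x hx
  have he := IsManifold.chart_mem_maximalAtlas (I := 𝓡 m) (n := ∞) x
  set e := chartAt (EuclideanSpace ℝ (Fin m)) x
  have hxe : x ∈ U ∩ e.source := ⟨hx, mem_chart_source _ x⟩
  have hO : IsOpen (U ∩ e.source) := hU.inter e.open_source
  have h : SmoothSectionOn m F (fun x => T x fun k => X k x) (U ∩ e.source) := by
    refine ContMDiffOn.congr (f := fun x => TotalSpace.mk' F x (∑ α : Fin j → Fin m,
      (∏ k, coordForm e (α k) x (X k x)) • T x fun k => coordField e (α k) x)) ?_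
      fun y hy => congrArg (TotalSpace.mk' F y) (tensor_expand he hy.2 (T y) _)
    refine ContMDiffOn.sum_section fun α _ => ContMDiffOn.smul_section ?_
      ((hT e he α).mono Set.inter_subset_right)
    exact contMDiffOn_finsetProd fun k _ => contMDiffOn_coordForm he Set.inter_subset_right
      ((hX k).mono Set.inter_subset_left) _
  exact (h.contMDiffAt (hO.mem_nhds hxe)).contMDiffWithinAt

lemma mdifferentiableAt_coordForm {e : OpenPartialHomeomorph M (EuclideanSpace ℝ (Fin m))}
    (he : e ∈ IsManifold.maximalAtlas (𝓡 m) ∞ M) {x : M} (hx : x ∈ e.source)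
    {X : Π x : M, TangentSpace (𝓡 m) x} (hX : DiffVFAt X x) (i : Fin m) :
    MDifferentiableAt (𝓡 m) 𝓘(ℝ, ℝ) (fun x => coordForm e i x (X x)) x := by
  refine MDifferentiableAt.congr_of_eventuallyEq (f := fun x => ∑ k, (metricMatrix e x)⁻¹ i k *
    inner ℝ (coordField e k x) (X x)) ?_ ?_
  · have h : ∀ k ∈ Finset.univ, MDifferentiableAt (𝓡 m) 𝓘(ℝ, ℝ) (fun x =>
        (metricMatrix e x)⁻¹ i k * inner ℝ (coordField e k x) (X x)) x := fun k _ =>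
      MDifferentiableAt.mul (((contMDiffOn_metricMatrix_inv he i k).contMDiffAt
        (e.open_source.mem_nhds hx)).mdifferentiableAt (by simp))
        (DiffVFAt.inner (SmoothVFOn.diffVFAt (contMDiffOn_coordField he k) e.open_source hx) hX)
    refine (MDifferentiableAt.sum h).congr_of_eventuallyEq
      (Filter.Eventually.of_forall fun y => ?_)
    simp [Finset.sum_apply]
  · filter_upwards [e.open_source.mem_nhds hx] with y hy using coordForm_eq_sum he hy i _

/-- The extensions of tangent vectors used in `covDerivTensor` are handled as vector fields
differentiable at the one point `x`, so a pointwise version is required. -/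
lemma IsLocSmoothTensor.diff_apply {j : ℕ} {T : TensorField (m := m) V j}
    [VectorBundle ℂ F V] [ContMDiffVectorBundle ∞ F V (𝓡 m)]
    (hT : IsLocSmoothTensor F T) {X : Fin j → Π x : M, TangentSpace (𝓡 m) x} {x : M}
    (hX : ∀ k, DiffVFAt (X k) x) : DiffSectionAt m F (fun x => T x fun k => X k x) x := by
  have he := IsManifold.chart_mem_maximalAtlas (I := 𝓡 m) (n := ∞) x
  set e := chartAt (EuclideanSpace ℝ (Fin m)) x
  have hxe : x ∈ e.source := mem_chart_source _ x
  refine MDifferentiableAt.congr_of_eventuallyEq (f := fun x => TotalSpace.mk' F x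
    (∑ α : Fin j → Fin m, (∏ k, coordForm e (α k) x (X k x)) •
      T x fun k => coordField e (α k) x)) ?_ ?_
  · refine MDifferentiableAt.sum_section fun α _ => MDifferentiableAt.smul_section ?_
      (SmoothSectionOn.diffSectionAt (hT e he α) e.open_source hxe)
    have := MDifferentiableAt.prod (t := Finset.univ) fun k _ =>
      mdifferentiableAt_coordForm he hxe (hX k) (α k)
    refine this.congr_of_eventuallyEq (Filter.Eventually.of_forall fun y => ?_)
    simp [Finset.prod_apply]
  · filter_upwards [e.open_source.mem_nhds hxe] with y hy
    rw [tensor_expand he hy]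

/-- `(∇_w T)(X₁, …, X_j)` at `x`. -/
noncomputable def tensorCov (cov : CovariantDerivative (𝓡 m) F V) {j : ℕ}
    (T : TensorField (m := m) V j)
    (X : Fin j → Π x : M, TangentSpace (𝓡 m) x) (x : M) (w : TangentSpace (𝓡 m) x) : V x :=
  cov (fun y => T y fun k => X k y) x w
    - ∑ k, T x (Function.update (fun l => X l x) k (leviCivita (X k) x w))

lemma update_vf_apply {j : ℕ} (X : Fin j → Π x : M, TangentSpace (𝓡 m) x) (k : Fin j)
    (Y : Π x : M, TangentSpace (𝓡 m) x) (y : M) :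
    (fun i => Function.update X k Y i y) = Function.update (fun i => X i y) k (Y y) := by
  funext i
  by_cases h : i = k
  · subst h; simp
  · simp [h]

variable [ContMDiffVectorBundle ∞ F V (𝓡 m)] {cov : CovariantDerivative (𝓡 m) F V}

lemma diffVFAt_update {j : ℕ} {X : Fin j → Π x : M, TangentSpace (𝓡 m) x} {x : M}
    (hX : ∀ k, DiffVFAt (X k) x) (k : Fin j) {Y : Π x : M, TangentSpace (𝓡 m) x}
    (hY : DiffVFAt Y x) (i : Fin j) : DiffVFAt (Function.update X k Y i) x := by
  by_cases h : i = k
  · subst h; simpa using hY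
  · simpa [h] using hX i

/-- Replacing `X_k` by `f Y` produces the term `(w f) T(…, Y, …)` twice: from the Leibniz rule for
`∇` on sections, and from the Leibniz rule for the Levi-Civita connection in slot `k`. The minus
sign in the definition cancels them. -/
lemma tensorialAt_tensorCov [VectorBundle ℂ F V] {j : ℕ} {T : TensorField (m := m) V j}
    (hT : IsLocSmoothTensor F T)
    {X : Fin j → Π x : M, TangentSpace (𝓡 m) x} {x : M} (hX : ∀ k, DiffVFAt (X k) x)
    (w : TangentSpace (𝓡 m) x) (k : Fin j) :
    TensorialAt (𝓡 m) (EuclideanSpace ℝ (Fin m))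
      (fun Y => tensorCov cov T (Function.update X k Y) x w) x := by
  have hd : ∀ Y, DiffVFAt Y x →
      DiffSectionAt m F (fun y => T y (Function.update (fun i => X i y) k (Y y))) x := by
    intro Y hY
    have := hT.diff_apply (X := Function.update X k Y) (diffVFAt_update hX k hY)
    simpa only [update_vf_apply] using this
  constructor
  · intro f Y hf hY
    unfold tensorCov
    simp only [update_vf_apply, Pi.smul_apply', MultilinearMap.map_update_smul]
    rw [cov_real_smul (hd Y hY) hf]
    have hterm : ∀ i, T x (Function.update (Function.update (fun i => X i x) k (f x • Y x)) i
          (leviCivita (Function.update X k (f • Y) i) x w))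
        = f x • T x (Function.update (Function.update (fun i => X i x) k (Y x)) i
          (leviCivita (Function.update X k Y i) x w))
          + if i = k then (mvfderiv (𝓡 m) f x w : ℝ) •
            T x (Function.update (fun i => X i x) k (Y x)) else 0 := by
      intro i
      by_cases h : i = k
      · subst h
        simp only [Function.update_self, Function.update_idem, if_true]
        rw [leviCivita_smul hf hY, MultilinearMap.map_update_add, MultilinearMap.map_update_smul,
          MultilinearMap.map_update_smul]
      · simp only [Function.update_of_ne h, h, if_false, add_zero]
        rw [Function.update_comm (Ne.symm h), Function.update_comm (Ne.symm h),
          MultilinearMap.map_update_smul]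
    simp only [hterm, Finset.sum_add_distrib, Finset.sum_ite_eq', Finset.mem_univ, if_true]
    rw [smul_sub, Finset.smul_sum]
    abel
  · intro Y Y' hY hY'
    unfold tensorCov
    simp only [update_vf_apply, Pi.add_apply, MultilinearMap.map_update_add]
    rw [cov_add (hd Y hY) (hd Y' hY')]
    have hterm : ∀ i, T x (Function.update (Function.update (fun i => X i x) k (Y x + Y' x)) i
          (leviCivita (Function.update X k (Y + Y') i) x w))
        = T x (Function.update (Function.update (fun i => X i x) k (Y x)) i
          (leviCivita (Function.update X k Y i) x w))
          + T x (Function.update (Function.update (fun i => X i x) k (Y' x)) i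
          (leviCivita (Function.update X k Y' i) x w)) := by
      intro i
      by_cases h : i = k
      · subst h
        simp only [Function.update_self, Function.update_idem]
        rw [leviCivita_add hY hY', MultilinearMap.map_update_add]
      · simp only [Function.update_of_ne h]
        rw [Function.update_comm (Ne.symm h), Function.update_comm (Ne.symm h),
          Function.update_comm (Ne.symm h), MultilinearMap.map_update_add]
    simp only [hterm, Finset.sum_add_distrib, add_apply]
    abel

/-- The vector fields are exchanged one slot at a time. -/
lemma TensorialAt.pointwise_pi {j : ℕ} {A : Type*} [AddCommGroup A] [Module ℝ A]
    {Φ : (Fin j → Π x : M, TangentSpace (𝓡 m) x) → A} {x : M}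
    (h : ∀ X : Fin j → Π x : M, TangentSpace (𝓡 m) x, (∀ k, DiffVFAt (X k) x) → ∀ k,
      TensorialAt (𝓡 m) (EuclideanSpace ℝ (Fin m)) (fun Y => Φ (Function.update X k Y)) x)
    {X X' : Fin j → Π x : M, TangentSpace (𝓡 m) x} (hX : ∀ k, DiffVFAt (X k) x)
    (hX' : ∀ k, DiffVFAt (X' k) x) (heq : ∀ k, X k x = X' k x) : Φ X = Φ X' := by
  classical
  have key : ∀ s : Finset (Fin j), Φ (s.piecewise X' X) = Φ X := by
    intro s
    induction s using Finset.induction_on with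
    | empty => simp
    | insert a s ha ih =>
      rw [← ih, Finset.piecewise_insert]
      have hd : ∀ k, DiffVFAt (s.piecewise X' X k) x := by
        intro k
        by_cases hk : k ∈ s
        · simpa [hk] using hX' k
        · simpa [hk] using hX k
      have := (h _ hd a).pointwise (hX' a) (hX a) (heq a).symm
      rw [this]
      congr 1
      conv_rhs => rw [← Function.update_eq_self a (s.piecewise X' X)]
      rw [Finset.piecewise_eq_of_notMem _ _ _ ha]
  simpa using (key Finset.univ).symm

/-- The chosen extensions of vectors can thus be replaced by coordinate fields, for which the
Levi-Civita terms are given by Christoffel symbols. -/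
lemma tensorCov_congr [VectorBundle ℂ F V] {j : ℕ} {T : TensorField (m := m) V j}
    (hT : IsLocSmoothTensor F T)
    {X X' : Fin j → Π x : M, TangentSpace (𝓡 m) x} {x : M} (hX : ∀ k, DiffVFAt (X k) x)
    (hX' : ∀ k, DiffVFAt (X' k) x) (heq : ∀ k, X k x = X' k x) (w : TangentSpace (𝓡 m) x) :
    tensorCov cov T X x w = tensorCov cov T X' x w :=
  TensorialAt.pointwise_pi (Φ := fun X => tensorCov cov T X x w)
    (fun _ h k => tensorialAt_tensorCov hT h w k) hX hX' heq

lemma tensorCov_add_vector {j : ℕ} {T : TensorField (m := m) V j}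
    {X : Fin j → Π x : M, TangentSpace (𝓡 m) x} {x : M} (hX : ∀ k, DiffVFAt (X k) x)
    (w w' : TangentSpace (𝓡 m) x) :
    tensorCov cov T X x (w + w') = tensorCov cov T X x w + tensorCov cov T X x w' := by
  unfold tensorCov
  simp only [map_add, leviCivita_add_vector (hX _), MultilinearMap.map_update_add,
    Finset.sum_add_distrib]
  abel

lemma tensorCov_smul_vector {j : ℕ} {T : TensorField (m := m) V j}
    {X : Fin j → Π x : M, TangentSpace (𝓡 m) x} {x : M} (hX : ∀ k, DiffVFAt (X k) x)
    (c : ℝ) (w : TangentSpace (𝓡 m) x) :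
    tensorCov cov T X x (c • w) = c • tensorCov cov T X x w := by
  unfold tensorCov
  simp only [map_smul, leviCivita_smul_vector (hX _), MultilinearMap.map_update_smul,
    ← Finset.smul_sum, smul_sub]

lemma covDerivTensor_eq {j : ℕ} (T : TensorField (m := m) V j) (x : M)
    (v : Fin (j + 1) → TangentSpace (𝓡 m) x) :
    covDerivTensor cov (fun x v => T x v) x v = tensorCov cov T
      (fun k => FiberBundle.extend (EuclideanSpace ℝ (Fin m)) (v k.succ)) x (v 0) := by
  simp [covDerivTensor, tensorCov]

/-- `∇T` as a field of multilinear maps. -/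
noncomputable def covTensor [VectorBundle ℂ F V] (cov : CovariantDerivative (𝓡 m) F V) {j : ℕ}
    {T : TensorField (m := m) V j} (hT : IsLocSmoothTensor F T) :
    TensorField (m := m) V (j + 1) := fun x =>
  LinearMap.uncurryLeft (M := fun _ => TangentSpace (𝓡 m) x)
    { toFun := fun w => MultilinearMap.mk' (fun v => tensorCov cov T
        (fun k => FiberBundle.extend (EuclideanSpace ℝ (Fin m)) (v k)) x w)
        (fun v k a b => by
          have hX : ∀ i, DiffVFAt (FiberBundle.extend (EuclideanSpace ℝ (Fin m)) (v i)) x :=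
            fun i => diffVFAt_extend (v i)
          -- Tensoriality in slot `k` provides a linear map of tangent vectors; additivity of the
          -- slot is additivity of that map, although `FiberBundle.extend` enters separately for
          -- each vector.
          have h := (tensorialAt_tensorCov (cov := cov) hT hX w k).mkHom_apply_eq_extend
          have hu : ∀ a, (fun i => FiberBundle.extend (EuclideanSpace ℝ (Fin m))
              (Function.update v k a i)) = Function.update (fun i =>
              FiberBundle.extend (EuclideanSpace ℝ (Fin m)) (v i)) k
              (FiberBundle.extend (EuclideanSpace ℝ (Fin m)) a) := by
            intro a; funext i
            by_cases hi : i = k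
            · subst hi; simp
            · simp [hi]
          simp only [hu]
          rw [← h, ← h, ← h, map_add])
        (fun v k c a => by
          have hX : ∀ i, DiffVFAt (FiberBundle.extend (EuclideanSpace ℝ (Fin m)) (v i)) x :=
            fun i => diffVFAt_extend (v i)
          have h := (tensorialAt_tensorCov (cov := cov) hT hX w k).mkHom_apply_eq_extend
          have hu : ∀ a, (fun i => FiberBundle.extend (EuclideanSpace ℝ (Fin m))
              (Function.update v k a i)) = Function.update (fun i =>
              FiberBundle.extend (EuclideanSpace ℝ (Fin m)) (v i)) k
              (FiberBundle.extend (EuclideanSpace ℝ (Fin m)) a) := by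
            intro a; funext i
            by_cases hi : i = k
            · subst hi; simp
            · simp [hi]
          simp only [hu]
          rw [← h, ← h, map_smul])
      map_add' := fun w w' => by
        ext v; exact tensorCov_add_vector (fun k => diffVFAt_extend _) w w'
      map_smul' := fun c w => by
        ext v; exact tensorCov_smul_vector (fun k => diffVFAt_extend _) c w }

lemma covTensor_apply [VectorBundle ℂ F V] {j : ℕ}
    {T : TensorField (m := m) V j} (hT : IsLocSmoothTensor F T) (x : M)
    (v : Fin (j + 1) → TangentSpace (𝓡 m) x) :
    covTensor cov hT x v = covDerivTensor cov (fun x v => T x v) x v :=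
  (covDerivTensor_eq T x v).symm

/-- `∇T` in a chart. -/
lemma covTensor_coordField [VectorBundle ℂ F V] {j : ℕ}
    {T : TensorField (m := m) V j} (hT : IsLocSmoothTensor F T)
    {e : OpenPartialHomeomorph M (EuclideanSpace ℝ (Fin m))}
    (he : e ∈ IsManifold.maximalAtlas (𝓡 m) ∞ M) {x : M} (hx : x ∈ e.source)
    (i : Fin m) (α : Fin j → Fin m) :
    covTensor cov hT x (fun k => coordField e ((Fin.cons i α : Fin (j + 1) → Fin m) k) x)
      = cov (fun y => T y fun k => coordField e (α k) y) x (coordField e i x)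
        - ∑ k, ∑ l, christoffel e i (α k) l x •
          T x (fun r => coordField e (Function.update α k l r) x) := by
  rw [covTensor_apply, covDerivTensor_eq]
  have hd : ∀ k, DiffVFAt (coordField e k) x := fun k =>
    SmoothVFOn.diffVFAt (contMDiffOn_coordField he k) e.open_source hx
  rw [tensorCov_congr (X' := fun k => coordField e (α k)) hT (fun k => diffVFAt_extend _)
    (fun k => hd (α k)) (fun k => by simp)]
  simp only [Fin.cons_zero, tensorCov]
  congr 1
  refine Finset.sum_congr rfl fun k _ => ?_
  rw [leviCivita_coordField he hx, MultilinearMap.map_update_sum]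
  refine Finset.sum_congr rfl fun l _ => ?_
  rw [MultilinearMap.map_update_smul]
  congr 2
  funext r
  by_cases h : r = k
  · subst h; simp
  · simp [h]

lemma isLocSmoothTensor_covTensor [VectorBundle ℂ F V] [T2Space M]
    [cov.ContMDiffCovariantDerivative ∞] {j : ℕ}
    {T : TensorField (m := m) V j} (hT : IsLocSmoothTensor F T) :
    IsLocSmoothTensor F (covTensor cov hT) := by
  intro e he α
  have hα : α = Fin.cons (α 0) (Fin.tail α) := (Fin.cons_self_tail α).symm
  refine ContMDiffOn.congr (f := fun x => TotalSpace.mk' F x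
    (cov (fun y => T y fun k => coordField e (Fin.tail α k) y) x (coordField e (α 0) x)
        - ∑ k, ∑ l, christoffel e (α 0) (Fin.tail α k) l x •
          T x (fun r => coordField e (Function.update (Fin.tail α) k l r) x))) ?_ fun x hx => ?_
  · refine ContMDiffOn.sub_section ?_ ?_
    · exact SmoothSectionOn.cov_apply e.open_source (hT e he _) (contMDiffOn_coordField he _)
    · exact ContMDiffOn.sum_section fun k _ => ContMDiffOn.sum_section fun l _ =>
        ContMDiffOn.smul_section (contMDiffOn_christoffel he _ _ _) (hT e he _)
  · rw [← covTensor_coordField hT he hx]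
    conv_lhs => rw [hα]

-- `iterCovDeriv` is defined on plain functions of `j` vectors. Multilinearity and smoothness must
-- be carried along together, because differentiating once more uses both.
variable (cov) in
lemma exists_tensorField_iterCovDeriv [VectorBundle ℂ F V] [T2Space M]
    [cov.ContMDiffCovariantDerivative ∞] {f : Π x : M, V x}
    (hf : IsSmoothSection (m := m) F f) (j : ℕ) :
    ∃ T : TensorField (m := m) V j, IsLocSmoothTensor F T ∧
      ∀ x, (fun v => T x v) = iterCovDeriv cov f j x := by
  induction j with
  | zero =>
    refine ⟨fun x => MultilinearMap.constOfIsEmpty ℝ _ (f x), fun e he α => ?_, fun x => rfl⟩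
    exact hf.contMDiffOn
  | succ j ih =>
    obtain ⟨T, hT, hTe⟩ := ih
    refine ⟨covTensor cov hT, isLocSmoothTensor_covTensor hT, fun x => ?_⟩
    funext v
    rw [covTensor_apply, iterCovDeriv]
    congr 1
    funext x; exact hTe x

end Tensor


/-! ### Components of iterated covariant derivatives -/

section Components

variable {m : ℕ} {M : Type*} [TopologicalSpace M] [ChartedSpace (EuclideanSpace ℝ (Fin m)) M]
  [IsManifold (𝓡 m) ∞ M]
  {F : Type*} [NormedAddCommGroup F] [NormedSpace ℂ F]
  {V : M → Type*} [TopologicalSpace (TotalSpace F V)]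
  [∀ x, NormedAddCommGroup (V x)] [∀ x, InnerProductSpace ℂ (V x)] [FiberBundle F V]

/-- The components of a tensor field in a chart and a frame. -/
noncomputable def tensorComp (e : OpenPartialHomeomorph M (EuclideanSpace ℝ (Fin m))) {ℓ : ℕ}
    (fr : Fin ℓ → Π x : M, V x) {j : ℕ} (A : Π x : M, (Fin j → TangentSpace (𝓡 m) x) → V x)
    (κ : Idx m ℓ j) (x : M) : ℂ :=
  inner ℂ (dualFrame fr κ.2 x) (A x fun k => coordField e (κ.1 k) x)

lemma contDiffOn_comp_symm {E : Type*} [NormedAddCommGroup E] [NormedSpace ℝ E]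
    {e : OpenPartialHomeomorph M (EuclideanSpace ℝ (Fin m))}
    (he : e ∈ IsManifold.maximalAtlas (𝓡 m) ∞ M) {c : M → E}
    (hc : ContMDiffOn (𝓡 m) 𝓘(ℝ, E) ∞ c e.source) :
    ContDiffOn ℝ ∞ (fun y => c (e.symm y)) e.target :=
  contMDiffOn_iff_contDiffOn.1 (hc.comp (contMDiffOn_symm_of_mem_maximalAtlas he)
    fun _ hy => e.map_target hy)

lemma contMDiffOn_comp_chart {E : Type*} [NormedAddCommGroup E] [NormedSpace ℝ E]
    {e : OpenPartialHomeomorph M (EuclideanSpace ℝ (Fin m))}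
    (he : e ∈ IsManifold.maximalAtlas (𝓡 m) ∞ M) {c : EuclideanSpace ℝ (Fin m) → E}
    (hc : ContDiffOn ℝ ∞ c e.target) :
    ContMDiffOn (𝓡 m) 𝓘(ℝ, E) ∞ (fun x => c (e x)) e.source :=
  (contMDiffOn_iff_contDiffOn.2 hc).comp (contMDiffOn_of_mem_maximalAtlas he)
    fun _ hx => e.map_source hx

lemma IsSmoothFrameOn.tensor_sum {e : OpenPartialHomeomorph M (EuclideanSpace ℝ (Fin m))} {ℓ : ℕ}
    {fr : Fin ℓ → Π x : M, V x} (hfr : IsSmoothFrameOn (m := m) F fr e.source) {j : ℕ}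
    (A : Π x : M, (Fin j → TangentSpace (𝓡 m) x) → V x) (α : Fin j → Fin m) {x : M}
    (hx : x ∈ e.source) :
    (A x fun k => coordField e (α k) x) = ∑ a, tensorComp e fr A (α, a) x • fr a x :=
  (hfr.sum_inner_smul hx _).symm

/-- The connection form of `cov` in a chart and a frame. -/
noncomputable def connForm [RiemannianBundle (fun x : M => TangentSpace (𝓡 m) x)]
    (cov : CovariantDerivative (𝓡 m) F V)
    (e : OpenPartialHomeomorph M (EuclideanSpace ℝ (Fin m))) {ℓ : ℕ}
    (fr : Fin ℓ → Π x : M, V x) (i : Fin m) (b a : Fin ℓ) (x : M) : ℂ :=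
  inner ℂ (dualFrame fr b x) (cov (fr a) x (coordField e i x))

/-- The zeroth order coefficients of `∇` on tensor fields in a chart and a frame. -/
noncomputable def chartCoefs [RiemannianBundle (fun x : M => TangentSpace (𝓡 m) x)]
    (cov : CovariantDerivative (𝓡 m) F V)
    (e : OpenPartialHomeomorph M (EuclideanSpace ℝ (Fin m))) {ℓ : ℕ}
    (fr : Fin ℓ → Π x : M, V x) : Coefs m ℓ := fun _ i κ κ' y =>
  (if κ'.1 = κ.1 then connForm cov e fr i κ.2 κ'.2 (e.symm y) else 0)
    - if κ'.2 = κ.2 then ∑ k, ∑ l, if κ'.1 = Function.update κ.1 k l then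
        (christoffel e i (κ.1 k) l (e.symm y) : ℂ) else 0 else 0

variable [VectorBundle ℂ F V] [VectorBundle ℝ F V] [ContMDiffVectorBundle ∞ F V (𝓡 m)]
  [RiemannianBundle (fun x : M => TangentSpace (𝓡 m) x)]
  [IsContMDiffRiemannianBundle (𝓡 m) ∞ (EuclideanSpace ℝ (Fin m))
      (fun x : M => TangentSpace (𝓡 m) x)]
  {cov : CovariantDerivative (𝓡 m) F V}
  {e : OpenPartialHomeomorph M (EuclideanSpace ℝ (Fin m))} {ℓ : ℕ}
  {fr : Fin ℓ → Π x : M, V x}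

lemma contMDiffOn_ofReal {U : Set M} {c : M → ℝ} (hc : ContMDiffOn (𝓡 m) 𝓘(ℝ, ℝ) ∞ c U) :
    ContMDiffOn (𝓡 m) 𝓘(ℝ, ℂ) ∞ (fun x => (c x : ℂ)) U :=
  fun x hx => ContMDiffAt.comp_contMDiffWithinAt x
    (Complex.ofRealCLM.contDiff (n := ∞)).contMDiff.contMDiffAt (hc x hx)

lemma contDiffOn_chartCoefs [T2Space M] [cov.ContMDiffCovariantDerivative ∞]
    (hV : IsSmoothHermitian (m := m) F (V := V))
    (he : e ∈ IsManifold.maximalAtlas (𝓡 m) ∞ M) (hfr : IsSmoothFrameOn (m := m) F fr e.source)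
    (j : ℕ) (i : Fin m) (κ κ' : Idx m ℓ j) :
    ContDiffOn ℝ ∞ (chartCoefs cov e fr j i κ κ') e.target := by
  unfold chartCoefs
  refine ContDiffOn.sub ?_ ?_
  · split_ifs
    · refine contDiffOn_comp_symm he (SmoothSectionOn.inner hV (hfr.contMDiffOn_dualFrame hV _) ?_)
      exact SmoothSectionOn.cov_apply e.open_source (hfr.contMDiffOn _) (contMDiffOn_coordField he _)
    · exact contDiffOn_const
  · split_ifs
    · refine ContDiffOn.sum fun k _ => ContDiffOn.sum fun l _ => ?_
      split_ifs
      · exact contDiffOn_comp_symm he (contMDiffOn_ofReal (contMDiffOn_christoffel he _ _ _))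
      · exact contDiffOn_const
    · exact contDiffOn_const

lemma IsLocSmoothTensor.contMDiffOn_tensorComp (hV : IsSmoothHermitian (m := m) F (V := V))
    (he : e ∈ IsManifold.maximalAtlas (𝓡 m) ∞ M) (hfr : IsSmoothFrameOn (m := m) F fr e.source)
    {j : ℕ} {T : TensorField (m := m) V j} (hT : IsLocSmoothTensor F T) (κ : Idx m ℓ j) :
    ContMDiffOn (𝓡 m) 𝓘(ℝ, ℂ) ∞ (tensorComp e fr (fun x v => T x v) κ) e.source :=
  SmoothSectionOn.inner hV (hfr.contMDiffOn_dualFrame hV _) (hT e he _)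

/-- Expand `T(∂_α)` in the frame and differentiate: the coefficients contribute the partial
derivatives, the frame contributes the connection form, and the correction terms of the tensor
derivative contribute the Christoffel symbols. -/
lemma tensorComp_covTensor (hcov : IsComplexLinear cov)
    (hV : IsSmoothHermitian (m := m) F (V := V))
    (he : e ∈ IsManifold.maximalAtlas (𝓡 m) ∞ M) (hfr : IsSmoothFrameOn (m := m) F fr e.source)
    {j : ℕ} {T : TensorField (m := m) V j} (hT : IsLocSmoothTensor F T) (i : Fin m)
    (κ : Idx m ℓ j) {y : EuclideanSpace ℝ (Fin m)} (hy : y ∈ e.target) :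
    tensorComp e fr (fun x v => covTensor cov hT x v) (Idx.cons i κ) (e.symm y)
      = pd i (fun y => tensorComp e fr (fun x v => T x v) κ (e.symm y)) y
        + ∑ κ', chartCoefs cov e fr j i κ κ' y
          * tensorComp e fr (fun x v => T x v) κ' (e.symm y) := by
  obtain ⟨α, b⟩ := κ
  have hx : e.symm y ∈ e.source := e.map_target hy
  set x := e.symm y with hxdef
  have hsm : ∀ κ : Idx m ℓ j, MDifferentiableAt (𝓡 m) 𝓘(ℝ, ℂ)
      (tensorComp e fr (fun x v => T x v) κ) x := fun κ =>
    ((hT.contMDiffOn_tensorComp hV he hfr κ).contMDiffAt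
      (e.open_source.mem_nhds hx)).mdifferentiableAt (by simp)
  have hfd : ∀ a, DiffSectionAt m F (fr a) x := fun a =>
    SmoothSectionOn.diffSectionAt (hfr.contMDiffOn a) e.open_source hx
  have h1 : cov (fun y => T y fun k => coordField e (α k) y) x (coordField e i x)
      = ∑ a, (tensorComp e fr (fun x v => T x v) (α, a) x • cov (fr a) x (coordField e i x)
        + pd i (fun y => tensorComp e fr (fun x v => T x v) (α, a) (e.symm y)) y • fr a x) := by
    have hc : cov (fun y => T y fun k => coordField e (α k) y) x
        = cov (fun y => ∑ a, tensorComp e fr (fun x v => T x v) (α, a) y • fr a y) x := by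
      refine cov_congr (SmoothSectionOn.diffSectionAt (hT e he α) e.open_source hx) ?_
      filter_upwards [e.open_source.mem_nhds hx] with z hz
      exact hfr.tensor_sum (fun x v => T x v) α hz
    rw [hc, cov_sum Finset.univ (fun a _ => DiffSectionAt.smul (hsm (α, a)) (hfd a))]
    rw [_root_.sum_apply]
    refine Finset.sum_congr rfl fun a _ => ?_
    rw [cov_smul hcov (hfd a) (hsm (α, a)), mvfderiv_coordField he hx (hsm (α, a)),
      hxdef, e.right_inv hy]
  have hcons : tensorComp e fr (fun x v => covTensor cov hT x v) (Idx.cons i (α, b)) x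
      = inner ℂ (dualFrame fr b x) (covTensor cov hT x
        (fun k => coordField e ((Fin.cons i α : Fin (j + 1) → Fin m) k) x)) := rfl
  rw [hcons, covTensor_coordField hT he hx, inner_sub_right, h1, inner_sum]
  simp only [inner_add_right, inner_smul_right, hfr.inner_dualFrame hx, inner_sum,
    Finset.sum_add_distrib, mul_ite, mul_one, mul_zero, Finset.sum_ite_eq, Finset.mem_univ, if_true]
  -- The connection form acts on the frame index and fixes `α`, while the Christoffel part changes
  -- one entry of `α` and fixes the frame index; the conditionals in `chartCoefs` select exactly
  -- these terms.
  have h2 : ∑ κ' : Idx m ℓ j, chartCoefs cov e fr j i (α, b) κ' y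
        * tensorComp e fr (fun x v => T x v) κ' x
      = ∑ a, tensorComp e fr (fun x v => T x v) (α, a) x *
          inner ℂ (dualFrame fr b x) (cov (fr a) x (coordField e i x))
        - ∑ k, ∑ l, (christoffel e i (α k) l x : ℂ) *
          tensorComp e fr (fun x v => T x v) (Function.update α k l, b) x := by
    simp only [chartCoefs, sub_mul, Finset.sum_sub_distrib, ite_mul, zero_mul]
    congr 1
    · rw [Fintype.sum_prod_type_right]
      refine Finset.sum_congr rfl fun a _ => ?_
      simp only [Finset.sum_ite_eq', Finset.mem_univ, if_true, connForm]
      exact mul_comm _ _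
    · rw [Fintype.sum_prod_type]
      simp only [Finset.sum_ite_eq', Finset.mem_univ, if_true, Finset.sum_mul, ite_mul, zero_mul]
      rw [Finset.sum_comm]
      refine Finset.sum_congr rfl fun k _ => ?_
      rw [Finset.sum_comm]
      refine Finset.sum_congr rfl fun l _ => ?_
      simp [hxdef]
  rw [h2]
  have h3 : ∀ k l, inner ℂ (dualFrame fr b x) (christoffel e i (α k) l x •
        T x (fun r => coordField e (Function.update α k l r) x))
      = (christoffel e i (α k) l x : ℂ) *
          tensorComp e fr (fun x v => T x v) (Function.update α k l, b) x := by
    intro k l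
    rw [← Complex.coe_smul, inner_smul_right]; rfl
  simp only [h3]
  ring

/-- The components of the iterated covariant derivatives of a smooth section. -/
noncomputable def derivComps (cov : CovariantDerivative (𝓡 m) F V)
    (e : OpenPartialHomeomorph M (EuclideanSpace ℝ (Fin m))) (fr : Fin ℓ → Π x : M, V x)
    (f : Π x : M, V x) : Comps m ℓ :=
  fun j κ y => tensorComp e fr (iterCovDeriv cov f j) κ (e.symm y)

/-- The passage from geometry to the Euclidean system. The coefficients do not depend on the
section, which is what makes all later constants uniform. -/
theorem isTower_derivComps [T2Space M] [cov.ContMDiffCovariantDerivative ∞]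
    (hcov : IsComplexLinear cov) (hV : IsSmoothHermitian (m := m) F (V := V))
    (he : e ∈ IsManifold.maximalAtlas (𝓡 m) ∞ M) (hfr : IsSmoothFrameOn (m := m) F fr e.source)
    {f : Π x : M, V x} (hf : IsSmoothSection (m := m) F f) :
    IsTower e.target (chartCoefs cov e fr) (derivComps cov e fr f) := by
  constructor
  · intro j κ
    obtain ⟨T, hT, hTe⟩ := exists_tensorField_iterCovDeriv cov hf j
    have : iterCovDeriv cov f j = fun x v => T x v := funext fun x => (hTe x).symm
    unfold derivComps
    rw [this]
    exact contDiffOn_comp_symm he (hT.contMDiffOn_tensorComp hV he hfr κ)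
  · intro j i κ y hy
    obtain ⟨T, hT, hTe⟩ := exists_tensorField_iterCovDeriv cov hf j
    have h : iterCovDeriv cov f j = fun x v => T x v := funext fun x => (hTe x).symm
    have h' : iterCovDeriv cov f (j + 1) = fun x v => covTensor cov hT x v := by
      funext x v
      rw [covTensor_apply, iterCovDeriv, h]
    have hd : ∀ κ, derivComps cov e fr f j κ
        = fun y => tensorComp e fr (fun x v => T x v) κ (e.symm y) := fun κ => by
      rw [← h]; rfl
    have hd' : derivComps cov e fr f (j + 1) (Idx.cons i κ) y
        = tensorComp e fr (fun x v => covTensor cov hT x v) (Idx.cons i κ) (e.symm y) := by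
      rw [← h']; rfl
    simp only [hd, hd']
    exact tensorComp_covTensor hcov hV he hfr hT i κ hy

end Components


/-! ### The Riemannian volume in charts -/

section Volume

variable {m : ℕ} {M : Type*} [TopologicalSpace M] [ChartedSpace (EuclideanSpace ℝ (Fin m)) M]
  [IsManifold (𝓡 m) ∞ M] [RiemannianBundle (fun x : M => TangentSpace (𝓡 m) x)]
  {e e' : OpenPartialHomeomorph M (EuclideanSpace ℝ (Fin m))}

/-- The Riemannian density of the chart `e`, as a function on the manifold. -/
noncomputable def metricDensity (e : OpenPartialHomeomorph M (EuclideanSpace ℝ (Fin m)))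
    (x : M) : ℝ := √(metricMatrix e x).det

lemma volDensity_eq {y : EuclideanSpace ℝ (Fin m)} (hy : y ∈ e.target) :
    volDensity e y = metricDensity e (e.symm y) := by
  unfold volDensity metricDensity
  congr 2
  ext i j
  simp only [Matrix.of_apply, metricMatrix, Matrix.gram_apply, coordField_symm hy]

lemma det_metricMatrix_pos (he : e ∈ IsManifold.maximalAtlas (𝓡 m) ∞ M) {x : M}
    (hx : x ∈ e.source) : 0 < (metricMatrix e x).det :=
  ((Matrix.posDef_gram_iff_linearIndependent (𝕜 := ℝ)).2
    (linearIndependent_coordField he hx)).det_pos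

lemma metricDensity_pos (he : e ∈ IsManifold.maximalAtlas (𝓡 m) ∞ M) {x : M}
    (hx : x ∈ e.source) : 0 < metricDensity e x :=
  Real.sqrt_pos.2 (det_metricMatrix_pos he hx)

lemma contMDiffOn_metricDensity [IsContMDiffRiemannianBundle (𝓡 m) ∞ (EuclideanSpace ℝ (Fin m))
      (fun x : M => TangentSpace (𝓡 m) x)] (he : e ∈ IsManifold.maximalAtlas (𝓡 m) ∞ M) :
    ContMDiffOn (𝓡 m) 𝓘(ℝ, ℝ) ∞ (metricDensity e) e.source := by
  have hA' : ContMDiffOn (𝓡 m) 𝓘(ℝ, Fin m → Fin m → ℝ) ∞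
      (fun x => fun i j => metricMatrix e x i j) e.source :=
    contMDiffOn_pi_space.2 fun i => contMDiffOn_pi_space.2 fun j => contMDiffOn_metricMatrix he i j
  intro x hx
  have h : ContDiffAt ℝ ∞ (fun A : Fin m → Fin m → ℝ => √(Matrix.det (Matrix.of A)))
      (fun i j => metricMatrix e x i j) :=
    contDiff_det.contDiffAt.sqrt (det_metricMatrix_pos he hx).ne'
  exact ContMDiffAt.comp_contMDiffWithinAt
    (g := fun A : Fin m → Fin m → ℝ => √(Matrix.det (Matrix.of A))) x h.contMDiffAt (hA' x hx)

/-- The Jacobian matrix of the change of coordinates. -/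
noncomputable def chartJacobian (e e' : OpenPartialHomeomorph M (EuclideanSpace ℝ (Fin m)))
    (x : M) : Matrix (Fin m) (Fin m) ℝ :=
  Matrix.of fun k i => coordForm e' k x (coordField e i x)

/-- The Gram matrix transforms by congruence, `g = Jᵀ g' J`, so the square root of its determinant
picks up `|det J|`. -/
lemma metricDensity_eq_det_mul (he' : e' ∈ IsManifold.maximalAtlas (𝓡 m) ∞ M) {x : M}
    (hx' : x ∈ e'.source) :
    metricDensity e x = |(chartJacobian e e' x).det| * metricDensity e' x := by
  have h : metricMatrix e x
      = (chartJacobian e e' x).transpose * metricMatrix e' x * chartJacobian e e' x := by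
    ext i j
    simp only [metricMatrix, Matrix.gram_apply, Matrix.mul_apply, Matrix.transpose_apply,
      chartJacobian, Matrix.of_apply]
    conv_lhs => rw [← sum_coordForm_smul he' hx' (coordField e i x),
      ← sum_coordForm_smul he' hx' (coordField e j x), inner_sum]
    refine Finset.sum_congr rfl fun l _ => ?_
    rw [sum_inner, Finset.sum_mul]
    refine Finset.sum_congr rfl fun k _ => ?_
    rw [inner_smul_left, inner_smul_right]
    simp only [conj_trivial]
    ring
  unfold metricDensity
  rw [h, Matrix.det_mul, Matrix.det_mul, Matrix.det_transpose, ← Real.sqrt_sq_eq_abs,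
    ← Real.sqrt_mul (sq_nonneg _)]
  congr 1; ring

lemma hasFDerivAt_chart_change (he : e ∈ IsManifold.maximalAtlas (𝓡 m) ∞ M)
    (he' : e' ∈ IsManifold.maximalAtlas (𝓡 m) ∞ M) {y : EuclideanSpace ℝ (Fin m)}
    (hy : y ∈ e.target) (hy' : e.symm y ∈ e'.source) :
    HasFDerivAt (fun z => e' (e.symm z)) (fderiv ℝ (fun z => e' (e.symm z)) y) y ∧
    (fderiv ℝ (fun z => e' (e.symm z)) y).det = (chartJacobian e e' (e.symm y)).det := by
  have hd : MDifferentiableAt (𝓡 m) (𝓡 m) (fun z => e' (e.symm z)) y :=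
    (mdifferentiableAt_chart he' hy').comp y (mdifferentiableAt_chart_symm he hy)
  refine ⟨hd.differentiableAt.hasFDerivAt, ?_⟩
  rw [ContinuousLinearMap.det, ← LinearMap.det_toMatrix (EuclideanSpace.basisFun (Fin m) ℝ).toBasis]
  congr 1
  ext k i
  rw [LinearMap.toMatrix_apply]
  simp only [chartJacobian, Matrix.of_apply, coordField_symm hy]
  have h := mfderiv_comp_apply (I := 𝓡 m) (I' := 𝓡 m) (I'' := 𝓡 m) (g := e') (f := e.symm) y
    (mdifferentiableAt_chart he' hy') (mdifferentiableAt_chart_symm he hy)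
    (EuclideanSpace.single i (1 : ℝ))
  rw [mfderiv_eq_fderiv] at h
  have h2 := congrArg (fun v : EuclideanSpace ℝ (Fin m) => v k) h
  simp only [OrthonormalBasis.coe_toBasis, EuclideanSpace.basisFun_apply,
    OrthonormalBasis.coe_toBasis_repr_apply, EuclideanSpace.basisFun_repr]
  exact h2

variable [MeasurableSpace M] [BorelSpace M]

/-- The Riemannian volume on the source of the chart `e`. -/
noncomputable def chartVol (e : OpenPartialHomeomorph M (EuclideanSpace ℝ (Fin m))) : Measure M :=
  Measure.map e.symm ((volume.restrict e.target).withDensity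
      fun y => ENNReal.ofReal (volDensity e y))

lemma aemeasurable_symm :
    AEMeasurable e.symm ((volume.restrict e.target).withDensity
      fun y => ENNReal.ofReal (volDensity e y)) :=
  (e.continuousOn_symm.aemeasurable e.open_target.measurableSet).mono_ac
    (withDensity_absolutelyContinuous _ _)

lemma measurableSet_target_inter {A : Set M} (hA : MeasurableSet A) :
    MeasurableSet (e.target ∩ e.symm ⁻¹' A) := by
  have h := (e.continuousOn_symm.domRestrict).measurable hA
  have h2 := (MeasurableEmbedding.subtype_coe e.open_target.measurableSet).measurableSet_image.2 h
  convert! h2 using 1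
  ext y; constructor
  · rintro ⟨h1, h2⟩; exact ⟨⟨y, h1⟩, h2, rfl⟩
  · rintro ⟨⟨y, h1⟩, h2, rfl⟩; exact ⟨h1, h2⟩

lemma chartVol_apply {A : Set M} (hA : MeasurableSet A) :
    chartVol e A = ∫⁻ y in e.target ∩ e.symm ⁻¹' A, ENNReal.ofReal (metricDensity e (e.symm y)) := by
  have hm := measurableSet_target_inter (e := e) hA
  rw [chartVol, Measure.map_apply_of_aemeasurable aemeasurable_symm hA,
    withDensity_apply']
  rw [Measure.restrict_restrict₀' (e.open_target.measurableSet.nullMeasurableSet), Set.inter_comm]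
  refine setLIntegral_congr_fun hm fun y hy => ?_
  rw [volDensity_eq hy.1]

lemma chartVol_inter_source {A : Set M} (hA : MeasurableSet A) :
    chartVol e (A ∩ e.source) = chartVol e A := by
  rw [chartVol_apply hA, chartVol_apply (hA.inter e.open_source.measurableSet)]
  congr 2
  ext y
  simp only [Set.mem_inter_iff, Set.mem_preimage]
  exact ⟨fun h => ⟨h.1, h.2.1⟩, fun h => ⟨h.1, h.2, e.map_target h.1⟩⟩

/-- Change of variables: the Jacobian determinant of the coordinate change is the factor by which
the two densities differ. -/
lemma chartVol_congr (he : e ∈ IsManifold.maximalAtlas (𝓡 m) ∞ M)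
    (he' : e' ∈ IsManifold.maximalAtlas (𝓡 m) ∞ M) {A : Set M} (hA : MeasurableSet A)
    (h : A ⊆ e.source) (h' : A ⊆ e'.source) : chartVol e A = chartVol e' A := by
  rw [chartVol_apply hA, chartVol_apply hA]
  have himg : e'.target ∩ e'.symm ⁻¹' A
      = (fun z => e' (e.symm z)) '' (e.target ∩ e.symm ⁻¹' A) := by
    ext z
    constructor
    · rintro ⟨h1, h2⟩
      refine ⟨e (e'.symm z), ⟨e.map_source (h h2), ?_⟩, ?_⟩
      · simpa [e.left_inv (h h2)] using h2
      · simp only [e.left_inv (h h2), e'.right_inv h1]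
    · rintro ⟨y, ⟨h1, h2⟩, rfl⟩
      refine ⟨e'.map_source (h' h2), ?_⟩
      simpa [e'.left_inv (h' h2)] using h2
  rw [himg, lintegral_image_eq_lintegral_abs_det_fderiv_mul volume (measurableSet_target_inter hA)
    (f' := fun y => fderiv ℝ (fun z => e' (e.symm z)) y)
    (fun y hy => (hasFDerivAt_chart_change he he' hy.1 (h' hy.2)).1.hasFDerivWithinAt)]
  · refine setLIntegral_congr_fun (measurableSet_target_inter hA) fun y hy => ?_
    rw [(hasFDerivAt_chart_change he he' hy.1 (h' hy.2)).2, e'.left_inv (h' hy.2),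
      metricDensity_eq_det_mul he' (h' hy.2), ENNReal.ofReal_mul (abs_nonneg _)]
  · intro y hy z hz hyz
    have := congrArg e'.symm hyz
    simp only [e'.left_inv (h' hy.2), e'.left_inv (h' hz.2)] at this
    have := congrArg e this
    rwa [e.right_inv hy.1, e.right_inv hz.1] at this

/-- A supremum of measures is bounded above by producing one dominating measure; here it has to
coincide with `chartVol e` on the source of `e`. -/
theorem volG_apply_of_subset (he : e ∈ IsManifold.maximalAtlas (𝓡 m) ∞ M) {A : Set M}
    (hA : MeasurableSet A) (h : A ⊆ e.source) : volG (m := m) M A = chartVol e A := by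
  apply le_antisymm
  -- Off the source, infinity times the counting measure dominates everything; inside, the measures
  -- of the other charts agree with `chartVol e` on overlaps.
  · have hle : volG (m := m) M ≤ chartVol e
        + ((⊤ : ℝ≥0∞) • (Measure.count : Measure M)).restrict (e.source)ᶜ := by
      unfold volG
      refine iSup₂_le fun e' he' => ?_
      refine Measure.le_iff.2 fun B hB => ?_
      change chartVol e' B ≤ _
      rw [Measure.add_apply, Measure.restrict_apply hB, Measure.smul_apply, smul_eq_mul]
      by_cases hemp : B ∩ (e.source)ᶜ = ∅
      · have hBe : B ⊆ e.source := fun x hx => by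
          by_contra hxe
          exact (Set.eq_empty_iff_forall_notMem.1 hemp) x ⟨hx, hxe⟩
        refine le_add_right ?_
        have hBm := hB.inter e'.open_source.measurableSet
        rw [← chartVol_inter_source (e := e') hB,
          ← chartVol_congr he he' hBm (Set.inter_subset_left.trans hBe) Set.inter_subset_right]
        exact measure_mono Set.inter_subset_left
      · have : (Measure.count : Measure M) (B ∩ (e.source)ᶜ) ≠ 0 := by
          rw [Measure.count_apply (hB.inter e.open_source.measurableSet.compl)]
          simpa using hemp
        rw [ENNReal.top_mul this]
        simp
    refine (hle A).trans ?_
    rw [Measure.add_apply, Measure.restrict_apply hA, Measure.smul_apply]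
    have : A ∩ (e.source)ᶜ = ∅ := by
      ext x; simp only [Set.mem_inter_iff, Set.mem_compl_iff, Set.mem_empty_iff_false, iff_false]
      exact fun hx => hx.2 (h hx.1)
    rw [this]; simp
  · have : chartVol e ≤ volG (m := m) M := by
      unfold volG
      exact le_iSup₂ (f := fun (e : OpenPartialHomeomorph M (EuclideanSpace ℝ (Fin m)))
        (_ : e ∈ IsManifold.maximalAtlas (𝓡 m) ∞ M) => chartVol e) e he
    exact this A

theorem volG_restrict_source (he : e ∈ IsManifold.maximalAtlas (𝓡 m) ∞ M) :
    (volG (m := m) M).restrict e.source = chartVol e := by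
  ext A hA
  rw [Measure.restrict_apply hA, volG_apply_of_subset he (hA.inter e.open_source.measurableSet)
    Set.inter_subset_right, chartVol_inter_source hA]

lemma ae_source_of_ae_target (he : e ∈ IsManifold.maximalAtlas (𝓡 m) ∞ M)
    {P : EuclideanSpace ℝ (Fin m) → Prop}
    (h : ∀ᵐ y ∂(volume.restrict e.target), P y) :
    ∀ᵐ x ∂(volG (m := m) M).restrict e.source, P (e x) := by
  have h1 : Measure.map e (chartVol e) = (volume.restrict e.target).withDensity
      fun y => ENNReal.ofReal (volDensity e y) := by
    have haem : AEMeasurable e (chartVol e) := by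
      rw [← volG_restrict_source he]
      exact e.continuousOn.aemeasurable e.open_source.measurableSet
    rw [chartVol] at haem ⊢
    rw [AEMeasurable.map_map_of_aemeasurable haem aemeasurable_symm]
    have : (e ∘ e.symm) =ᵐ[(volume.restrict e.target).withDensity
        fun y => ENNReal.ofReal (volDensity e y)] id := by
      refine (withDensity_absolutelyContinuous _ _).ae_le ?_
      filter_upwards [ae_restrict_mem e.open_target.measurableSet] with y hy
      exact e.right_inv hy
    rw [Measure.map_congr this, Measure.map_id]
  have haem : AEMeasurable e ((volG (m := m) M).restrict e.source) :=
    e.continuousOn.aemeasurable e.open_source.measurableSet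
  refine Measure.tendsto_ae_map haem ?_
  rw [volG_restrict_source he, h1]
  exact (withDensity_absolutelyContinuous _ _).ae_le h

variable [IsContMDiffRiemannianBundle (𝓡 m) ∞ (EuclideanSpace ℝ (Fin m))
      (fun x : M => TangentSpace (𝓡 m) x)]

lemma continuousOn_metricDensity_symm (he : e ∈ IsManifold.maximalAtlas (𝓡 m) ∞ M) :
    ContinuousOn (fun y => metricDensity e (e.symm y)) e.target :=
  (contDiffOn_comp_symm he (contMDiffOn_metricDensity he)).continuousOn

lemma continuousOn_volDensity (he : e ∈ IsManifold.maximalAtlas (𝓡 m) ∞ M) :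
    ContinuousOn (volDensity e) e.target :=
  (continuousOn_metricDensity_symm he).congr fun _ hy => volDensity_eq hy

/-- Positivity of the density is essential here: it makes Lebesgue measure absolutely continuous
with respect to the weighted measure. -/
lemma ae_target_of_ae_source (he : e ∈ IsManifold.maximalAtlas (𝓡 m) ∞ M) {P : M → Prop}
    (h : ∀ᵐ x ∂(volG (m := m) M).restrict e.source, P x) :
    ∀ᵐ y ∂(volume.restrict e.target), P (e.symm y) := by
  rw [volG_restrict_source he] at h
  have h2 := Measure.tendsto_ae_map aemeasurable_symm h
  have hac : (volume.restrict e.target) ≪ (volume.restrict e.target).withDensity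
      fun y => ENNReal.ofReal (volDensity e y) := by
    refine withDensity_absolutelyContinuous' ?_ ?_
    · exact ((continuousOn_volDensity he).aemeasurable e.open_target.measurableSet).ennreal_ofReal
    · filter_upwards [ae_restrict_mem e.open_target.measurableSet] with y hy
      rw [volDensity_eq hy]
      simpa using metricDensity_pos he (e.map_target hy)
  exact hac.ae_le h2

lemma ae_target_iff (he : e ∈ IsManifold.maximalAtlas (𝓡 m) ∞ M) {P : M → Prop} :
    (∀ᵐ y ∂(volume.restrict e.target), P (e.symm y)) ↔
      ∀ᵐ x ∂(volG (m := m) M).restrict e.source, P x := by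
  refine ⟨fun h => ?_, ae_target_of_ae_source he⟩
  filter_upwards [ae_source_of_ae_target he h, ae_restrict_mem e.open_source.measurableSet]
    with x hx hxe
  rwa [e.left_inv hxe] at hx

end Volume


/-! ### Inner products and norms of tensors -/

section TensorNorm

variable {m : ℕ} {M : Type*} [TopologicalSpace M] [ChartedSpace (EuclideanSpace ℝ (Fin m)) M]
  [IsManifold (𝓡 m) ∞ M] [RiemannianBundle (fun x : M => TangentSpace (𝓡 m) x)]
  {V : M → Type*} [∀ x, NormedAddCommGroup (V x)] [∀ x, InnerProductSpace ℂ (V x)]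

/-- The values of a tensor on an orthonormal basis. -/
noncomputable def tensorVec {j : ℕ} {x : M} (A : (Fin j → TangentSpace (𝓡 m) x) → V x) :
    PiLp 2 (fun _ : Fin j → Fin (Module.finrank ℝ (TangentSpace (𝓡 m) x)) => V x) :=
  WithLp.toLp 2 fun a => A fun k => tangentONB x (a k)

variable {j : ℕ} {x : M} (A B : (Fin j → TangentSpace (𝓡 m) x) → V x)

/-- With the values on an orthonormal basis regarded as an element of a finite Hilbert sum, the
triangle and Cauchy–Schwarz inequalities are inherited. -/
lemma tensorNorm_eq : tensorNorm A = ‖tensorVec A‖ :=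
  (PiLp.norm_eq_of_L2 (tensorVec A)).symm

lemma tensorInner_eq : tensorInner A B = inner ℂ (tensorVec A) (tensorVec B) :=
  (PiLp.inner_apply (tensorVec A) (tensorVec B)).symm

lemma tensorNorm_nonneg : 0 ≤ tensorNorm A := Real.sqrt_nonneg _

lemma tensorNorm_add_le : tensorNorm (fun v => A v + B v) ≤ tensorNorm A + tensorNorm B := by
  simp only [tensorNorm_eq]
  exact norm_add_le (tensorVec A) (tensorVec B)

lemma tensorNorm_sub_le : tensorNorm (fun v => A v - B v) ≤ tensorNorm A + tensorNorm B := by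
  simp only [tensorNorm_eq]
  exact norm_sub_le (tensorVec A) (tensorVec B)

lemma norm_tensorInner_le : ‖tensorInner A B‖ ≤ tensorNorm A * tensorNorm B := by
  rw [tensorInner_eq, tensorNorm_eq, tensorNorm_eq]
  exact norm_inner_le_norm _ _

lemma tensorInner_self : tensorInner A A = (tensorNorm A : ℂ) ^ 2 := by
  rw [tensorInner_eq, tensorNorm_eq]
  exact inner_self_eq_norm_sq_to_K _

lemma tensorNorm_eq_sqrt : tensorNorm A = √(tensorInner A A).re := by
  rw [tensorInner_self, ← Complex.ofReal_pow, Complex.ofReal_re,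
    Real.sqrt_sq (tensorNorm_nonneg A)]

lemma tensorInner_sub_right (C : (Fin j → TangentSpace (𝓡 m) x) → V x) :
    tensorInner C (fun v => A v - B v) = tensorInner C A - tensorInner C B := by
  simp only [tensorInner_eq]
  exact inner_sub_right (tensorVec C) (tensorVec A) (tensorVec B)

lemma norm_apply_tangentONB_le (a : Fin j → Fin (Module.finrank ℝ (TangentSpace (𝓡 m) x))) :
    ‖A fun k => tangentONB x (a k)‖ ≤ tensorNorm A := by
  rw [tensorNorm_eq]
  exact PiLp.norm_apply_le (tensorVec A) a

variable {A B}

lemma tensorNorm_zero_index (A : (Fin 0 → TangentSpace (𝓡 m) x) → V x)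
    (v : Fin 0 → TangentSpace (𝓡 m) x) : tensorNorm A = ‖A v‖ := by
  unfold tensorNorm
  rw [Fintype.sum_unique, Real.sqrt_sq (norm_nonneg _)]
  congr 2
  exact Subsingleton.elim _ _

lemma tensor_expand_tangentONB {W : Type*} [AddCommGroup W] [Module ℝ W]
    (T : MultilinearMap ℝ (fun _ : Fin j => TangentSpace (𝓡 m) x) W)
    (v : Fin j → TangentSpace (𝓡 m) x) :
    T v = ∑ a : Fin j → Fin (Module.finrank ℝ (TangentSpace (𝓡 m) x)),
      (∏ k, (inner ℝ (tangentONB x (a k)) (v k) : ℝ)) • T fun k => tangentONB x (a k) := by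
  conv_lhs => rw [show v = fun k => ∑ i, (inner ℝ (tangentONB x i) (v k) : ℝ) • tangentONB x i from
    funext fun k => by
      conv_lhs => rw [← (tangentONB x).sum_repr (v k)]
      simp only [OrthonormalBasis.repr_apply_apply]]
  rw [MultilinearMap.map_sum]
  exact Finset.sum_congr rfl fun α _ => MultilinearMap.map_smul_univ _ _ _

lemma finrank_tangentSpace : Module.finrank ℝ (TangentSpace (𝓡 m) x) = m := by
  have : Module.finrank ℝ (EuclideanSpace ℝ (Fin m)) = m := by simp
  exact this

/-- Expansion in the orthonormal basis has `m ^ j` terms, each with a coefficient bounded by the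
product of the norms of the arguments. -/
lemma norm_multilinear_apply_le
    (T : MultilinearMap ℝ (fun _ : Fin j => TangentSpace (𝓡 m) x) (V x))
    (v : Fin j → TangentSpace (𝓡 m) x) :
    ‖T v‖ ≤ (m : ℝ) ^ j * (∏ k, ‖v k‖) * tensorNorm (fun v => T v) := by
  rw [tensor_expand_tangentONB T v]
  refine (norm_sum_le _ _).trans ?_
  have h : ∀ a : Fin j → Fin (Module.finrank ℝ (TangentSpace (𝓡 m) x)),
      ‖(∏ k, (inner ℝ (tangentONB x (a k)) (v k) : ℝ)) • T fun k => tangentONB x (a k)‖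
      ≤ (∏ k, ‖v k‖) * tensorNorm (fun v => T v) := by
    intro a
    rw [norm_smul, norm_prod]
    refine mul_le_mul ?_ (norm_apply_tangentONB_le (fun v => T v) a) (norm_nonneg _)
      (Finset.prod_nonneg fun _ _ => norm_nonneg _)
    refine Finset.prod_le_prod (fun _ _ => norm_nonneg _) fun k _ => ?_
    refine (norm_inner_le_norm _ _).trans ?_
    rw [(tangentONB x).norm_eq_one, one_mul]
  refine (Finset.sum_le_sum fun a _ => h a).trans ?_
  rw [Finset.sum_const, Finset.card_univ, Fintype.card_fun, Fintype.card_fin, Fintype.card_fin,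
    finrank_tangentSpace, nsmul_eq_mul, mul_assoc]
  push_cast
  exact le_rfl

/-- The tensor `⟨w₁, ·⟩ ⊗ ⋯ ⊗ ⟨w_j, ·⟩ ⊗ z`. -/
noncomputable def simpleTensor (w : Fin j → TangentSpace (𝓡 m) x) (z : V x) :
    MultilinearMap ℝ (fun _ : Fin j => TangentSpace (𝓡 m) x) (V x) :=
  ((MultilinearMap.mkPiAlgebra ℝ (Fin j) ℝ).compLinearMap
    fun k => (innerSL ℝ (w k) : TangentSpace (𝓡 m) x →L[ℝ] ℝ).toLinearMap).smulRight z

lemma simpleTensor_apply (w : Fin j → TangentSpace (𝓡 m) x) (z : V x)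
    (v : Fin j → TangentSpace (𝓡 m) x) :
    simpleTensor w z v = (∏ k, (inner ℝ (w k) (v k) : ℝ)) • z := by
  simp [simpleTensor]

/-- The simple tensor represents the functional `T ↦ ⟨z, T w⟩`, so pairing with suitable simple
tensors extracts a single component. -/
lemma tensorInner_simpleTensor (w : Fin j → TangentSpace (𝓡 m) x) (z : V x)
    (T : MultilinearMap ℝ (fun _ : Fin j => TangentSpace (𝓡 m) x) (V x)) :
    tensorInner (fun v => simpleTensor w z v) (fun v => T v) = inner ℂ z (T w) := by
  rw [tensor_expand_tangentONB T w, inner_sum]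
  refine Finset.sum_congr rfl fun a _ => ?_
  simp only [simpleTensor_apply]
  rw [← Complex.coe_smul, ← Complex.coe_smul, inner_smul_left,
    inner_smul_right, Complex.conj_ofReal]
  simp only [real_inner_comm]

variable {e : OpenPartialHomeomorph M (EuclideanSpace ℝ (Fin m))}

/-- The orthonormal bases are chosen pointwise without any regularity. Rewriting the inner product
with the inverse metric matrix makes its smooth dependence on the point visible. -/
lemma tensorInner_eq_sum_coordField [IsContMDiffRiemannianBundle (𝓡 m) ∞ (EuclideanSpace ℝ (Fin m))
      (fun x : M => TangentSpace (𝓡 m) x)] (he : e ∈ IsManifold.maximalAtlas (𝓡 m) ∞ M)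
    (hx : x ∈ e.source)
    (T S : MultilinearMap ℝ (fun _ : Fin j => TangentSpace (𝓡 m) x) (V x)) :
    tensorInner (fun v => T v) (fun v => S v) = ∑ α : Fin j → Fin m, ∑ β : Fin j → Fin m,
      ((∏ k, (metricMatrix e x)⁻¹ (α k) (β k) : ℝ) : ℂ) *
        inner ℂ (T fun k => coordField e (α k) x) (S fun k => coordField e (β k) x) := by
  have h : ∀ a : Fin j → Fin (Module.finrank ℝ (TangentSpace (𝓡 m) x)),
      inner ℂ (T fun k => tangentONB x (a k)) (S fun k => tangentONB x (a k))
      = ∑ α : Fin j → Fin m, ∑ β : Fin j → Fin m,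
        ((∏ k, (coordForm e (α k) x (tangentONB x (a k)) *
          coordForm e (β k) x (tangentONB x (a k))) : ℝ) : ℂ) *
        inner ℂ (T fun k => coordField e (α k) x) (S fun k => coordField e (β k) x) := by
    intro a
    rw [tensor_expand he hx T, tensor_expand he hx S, sum_inner]
    refine Finset.sum_congr rfl fun α _ => ?_
    rw [inner_sum]
    refine Finset.sum_congr rfl fun β _ => ?_
    rw [← Complex.coe_smul, ← Complex.coe_smul, inner_smul_left, inner_smul_right,
      Complex.conj_ofReal, Finset.prod_mul_distrib]
    push_cast
    ring
  unfold tensorInner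
  simp only [h]
  rw [Finset.sum_comm]
  refine Finset.sum_congr rfl fun α _ => ?_
  rw [Finset.sum_comm]
  refine Finset.sum_congr rfl fun β _ => ?_
  rw [← Finset.sum_mul]
  congr 1
  rw [← Complex.ofReal_sum]
  congr 1
  simp only [← sum_coordForm_mul_coordForm he hx]
  rw [Finset.prod_univ_sum, Fintype.piFinset_univ]

end TensorNorm

/-! ### Tensor inner products and norms in terms of components -/

section TensorComp

variable {m : ℕ} {M : Type*} [TopologicalSpace M] [ChartedSpace (EuclideanSpace ℝ (Fin m)) M]
  [IsManifold (𝓡 m) ∞ M]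
  {F : Type*} [NormedAddCommGroup F] [NormedSpace ℂ F]
  {V : M → Type*} [TopologicalSpace (TotalSpace F V)]
  [∀ x, NormedAddCommGroup (V x)] [∀ x, InnerProductSpace ℂ (V x)] [FiberBundle F V]
  [VectorBundle ℂ F V] [VectorBundle ℝ F V] [ContMDiffVectorBundle ∞ F V (𝓡 m)]
  [RiemannianBundle (fun x : M => TangentSpace (𝓡 m) x)]
  [IsContMDiffRiemannianBundle (𝓡 m) ∞ (EuclideanSpace ℝ (Fin m))
      (fun x : M => TangentSpace (𝓡 m) x)]
  {e : OpenPartialHomeomorph M (EuclideanSpace ℝ (Fin m))} {ℓ : ℕ}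
  {fr : Fin ℓ → Π x : M, V x}

lemma contMDiffOn_complex_mul {U : Set M} {c d : M → ℂ}
    (hc : ContMDiffOn (𝓡 m) 𝓘(ℝ, ℂ) ∞ c U) (hd : ContMDiffOn (𝓡 m) 𝓘(ℝ, ℂ) ∞ d U) :
    ContMDiffOn (𝓡 m) 𝓘(ℝ, ℂ) ∞ (fun x => c x * d x) U := fun x hx =>
  ContMDiffAt.comp_contMDiffWithinAt (g := fun q : ℂ × ℂ => q.1 * q.2) x
    (contDiff_mul (𝕜 := ℝ) (𝔸 := ℂ)).contMDiff.contMDiffAt ((hc x hx).prodMk_space (hd x hx))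

/-- The matrix of the Hermitian metric on tensors in a chart and a frame. -/
noncomputable def tensorGram (e : OpenPartialHomeomorph M (EuclideanSpace ℝ (Fin m)))
    (fr : Fin ℓ → Π x : M, V x) {j : ℕ} (κ κ' : Idx m ℓ j) (x : M) : ℂ :=
  ((∏ k, (metricMatrix e x)⁻¹ (κ.1 k) (κ'.1 k) : ℝ) : ℂ) * inner ℂ (fr κ.2 x) (fr κ'.2 x)

lemma contMDiffOn_tensorGram (hV : IsSmoothHermitian (m := m) F (V := V))
    (he : e ∈ IsManifold.maximalAtlas (𝓡 m) ∞ M) (hfr : IsSmoothFrameOn (m := m) F fr e.source)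
    {j : ℕ} (κ κ' : Idx m ℓ j) :
    ContMDiffOn (𝓡 m) 𝓘(ℝ, ℂ) ∞ (tensorGram e fr κ κ') e.source := by
  refine contMDiffOn_complex_mul (contMDiffOn_ofReal (contMDiffOn_finsetProd fun k _ =>
    contMDiffOn_metricMatrix_inv he _ _)) ?_
  exact SmoothSectionOn.inner hV (hfr.contMDiffOn _) (hfr.contMDiffOn _)

lemma tensorInner_eq_sum_tensorGram (he : e ∈ IsManifold.maximalAtlas (𝓡 m) ∞ M)
    (hfr : IsSmoothFrameOn (m := m) F fr e.source) {j : ℕ} (T S : TensorField (m := m) V j) {x : M}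
    (hx : x ∈ e.source) :
    tensorInner (fun v => T x v) (fun v => S x v) = ∑ κ : Idx m ℓ j, ∑ κ' : Idx m ℓ j,
      tensorGram e fr κ κ' x * (star (tensorComp e fr (fun x v => T x v) κ x) *
        tensorComp e fr (fun x v => S x v) κ' x) := by
  rw [tensorInner_eq_sum_coordField he hx]
  have h : ∀ α β : Fin j → Fin m,
      inner ℂ (T x fun k => coordField e (α k) x) (S x fun k => coordField e (β k) x)
      = ∑ a, ∑ b, inner ℂ (fr a x) (fr b x) *
        (star (tensorComp e fr (fun x v => T x v) (α, a) x) *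
        tensorComp e fr (fun x v => S x v) (β, b) x) := by
    intro α β
    have h1 := hfr.tensor_sum (fun x v => T x v) α hx
    have h2 := hfr.tensor_sum (fun x v => S x v) β hx
    rw [h1, h2, sum_inner]
    refine Finset.sum_congr rfl fun a _ => ?_
    rw [inner_sum]
    refine Finset.sum_congr rfl fun b _ => ?_
    rw [inner_smul_left, inner_smul_right, starRingEnd_apply]
    ring
  simp only [h]
  rw [Fintype.sum_prod_type]
  refine Finset.sum_congr rfl fun α _ => ?_
  simp only [Fintype.sum_prod_type]
  rw [Finset.sum_comm]
  refine Finset.sum_congr rfl fun β _ => ?_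
  rw [Finset.mul_sum]
  refine Finset.sum_congr rfl fun a _ => ?_
  rw [Finset.mul_sum]
  refine Finset.sum_congr rfl fun b _ => ?_
  simp only [tensorGram]
  ring

lemma continuousOn_norm_section (hV : IsSmoothHermitian (m := m) F (V := V)) {U : Set M}
    {σ : Π x : M, V x} (hσ : SmoothSectionOn m F σ U) : ContinuousOn (fun x => ‖σ x‖) U := by
  have h := (SmoothSectionOn.inner hV hσ hσ).continuousOn
  refine (Real.continuous_sqrt.comp_continuousOn (Complex.continuous_re.comp_continuousOn h)).congr
    fun x _ => ?_
  simp only [Function.comp]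
  rw [@norm_eq_sqrt_re_inner ℂ]
  rfl

lemma continuousOn_norm_coordField (he : e ∈ IsManifold.maximalAtlas (𝓡 m) ∞ M) (i : Fin m) :
    ContinuousOn (fun x => ‖coordField e i x‖) e.source := by
  have h := (contMDiffOn_metricMatrix he i i).continuousOn
  refine (Real.continuous_sqrt.comp_continuousOn h).congr fun x _ => ?_
  simp only [Function.comp]
  rw [@norm_eq_sqrt_re_inner ℝ]
  rfl

/-- On compact subsets of a chart the norm of a tensor is equivalent to the norm of its
components. -/
lemma exists_bound_tensorNorm (hV : IsSmoothHermitian (m := m) F (V := V))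
    (he : e ∈ IsManifold.maximalAtlas (𝓡 m) ∞ M) (hfr : IsSmoothFrameOn (m := m) F fr e.source)
    {K : Set M} (hK : IsCompact K) (hKe : K ⊆ e.source) (j : ℕ) :
    ∃ C : ℝ, 0 ≤ C ∧ ∀ x ∈ K, ∀ T : TensorField (m := m) V j,
      (tensorNorm (fun v => T x v)
        ≤ C * ∑ κ : Idx m ℓ j, ‖tensorComp e fr (fun x v => T x v) κ x‖) ∧
      ∀ κ : Idx m ℓ j, ‖tensorComp e fr (fun x v => T x v) κ x‖
        ≤ C * tensorNorm (fun v => T x v) := by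
  have hb : ∀ c : M → ℝ, ContinuousOn c e.source → ∃ C, ∀ x ∈ K, c x ≤ C := by
    intro c hc
    obtain ⟨C, hC⟩ := (hK.image_of_continuousOn (hc.mono hKe)).bddAbove
    exact ⟨C, fun x hx => hC ⟨x, hx, rfl⟩⟩
  -- `C1` bounds the Gram matrix and controls the norm by the components; `C2` bounds the dual frame
  -- and the coordinate fields and controls the components by the norm.
  obtain ⟨C1, hC1⟩ := hb (fun x => ∑ κ : Idx m ℓ j, ∑ κ' : Idx m ℓ j, ‖tensorGram e fr κ κ' x‖)
    (continuousOn_finsetSum _ fun κ _ => continuousOn_finsetSum _ fun κ' _ =>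
      (contMDiffOn_tensorGram hV he hfr κ κ').continuousOn.norm)
  obtain ⟨C2, hC2⟩ := hb (fun x => ∑ κ : Idx m ℓ j, ‖dualFrame fr κ.2 x‖ *
      ((m : ℝ) ^ j * ∏ k, ‖coordField e (κ.1 k) x‖))
    (continuousOn_finsetSum _ fun κ _ =>
      (continuousOn_norm_section hV (hfr.contMDiffOn_dualFrame hV _)).mul
      (continuousOn_const.mul (continuousOn_finsetProd _ fun k _ =>
        continuousOn_norm_coordField he _)))
  refine ⟨max (√(max C1 0)) (max C2 0), le_max_of_le_left (Real.sqrt_nonneg _),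
    fun x hx T => ⟨?_, fun κ => ?_⟩⟩
  · set S := ∑ κ : Idx m ℓ j, ‖tensorComp e fr (fun x v => T x v) κ x‖ with hS
    have hS0 : 0 ≤ S := Finset.sum_nonneg fun _ _ => norm_nonneg _
    refine le_trans ?_ (mul_le_mul_of_nonneg_right (le_max_left _ _) hS0)
    have hle : ∀ κ : Idx m ℓ j, ‖tensorComp e fr (fun x v => T x v) κ x‖ ≤ S := fun κ =>
      Finset.single_le_sum (f := fun κ : Idx m ℓ j => ‖tensorComp e fr (fun x v => T x v) κ x‖)
        (fun _ _ => norm_nonneg _) (Finset.mem_univ κ)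
    rw [← Real.sqrt_sq hS0, ← Real.sqrt_mul (le_max_right _ _), tensorNorm_eq_sqrt]
    refine Real.sqrt_le_sqrt ((Complex.re_le_norm _).trans ?_)
    rw [tensorInner_eq_sum_tensorGram he hfr T T (hKe hx)]
    refine (norm_sum_le _ _).trans ((Finset.sum_le_sum fun κ _ => norm_sum_le _ _).trans ?_)
    refine le_trans (b := ∑ κ : Idx m ℓ j, ∑ κ' : Idx m ℓ j,
      ‖tensorGram e fr κ κ' x‖ * S ^ 2) ?_ ?_
    · refine Finset.sum_le_sum fun κ _ => Finset.sum_le_sum fun κ' _ => ?_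
      rw [norm_mul, norm_mul, norm_star, sq]
      exact mul_le_mul_of_nonneg_left (mul_le_mul (hle κ) (hle κ') (norm_nonneg _) hS0)
        (norm_nonneg _)
    · simp only [← Finset.sum_mul]
      exact mul_le_mul_of_nonneg_right ((hC1 x hx).trans (le_max_left _ _)) (sq_nonneg _)
  · refine le_trans ?_ (mul_le_mul_of_nonneg_right (le_max_right _ _) (tensorNorm_nonneg _))
    refine le_trans ?_ (mul_le_mul_of_nonneg_right ((hC2 x hx).trans (le_max_left _ _))
      (tensorNorm_nonneg _))
    refine le_trans ?_ (mul_le_mul_of_nonneg_right (Finset.single_le_sum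
      (f := fun κ : Idx m ℓ j => ‖dualFrame fr κ.2 x‖ *
        ((m : ℝ) ^ j * ∏ k, ‖coordField e (κ.1 k) x‖))
      (fun κ _ => mul_nonneg (norm_nonneg _) (mul_nonneg (by positivity)
        (Finset.prod_nonneg fun _ _ => norm_nonneg _))) (Finset.mem_univ κ)) (tensorNorm_nonneg _))
    refine (norm_inner_le_norm _ _).trans ?_
    rw [mul_assoc]
    exact mul_le_mul_of_nonneg_left (norm_multilinear_apply_le (T x) _) (norm_nonneg _)

end TensorComp


/-! ### Framed charts, measurability and integration -/

section FramedCharts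

variable {m : ℕ} {M : Type*} [TopologicalSpace M] [ChartedSpace (EuclideanSpace ℝ (Fin m)) M]
  [IsManifold (𝓡 m) ∞ M]
  {F : Type*} [NormedAddCommGroup F] [NormedSpace ℂ F] [FiniteDimensional ℂ F]
  {V : M → Type*} [TopologicalSpace (TotalSpace F V)]
  [∀ x, NormedAddCommGroup (V x)] [∀ x, InnerProductSpace ℂ (V x)] [FiberBundle F V]
  [VectorBundle ℂ F V] [VectorBundle ℝ F V] [ContMDiffVectorBundle ∞ F V (𝓡 m)]

variable (m F V) in
/-- Near every point there is a chart over which the bundle has a smooth frame. -/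
theorem exists_framed_chart (x₀ : M) :
    ∃ e ∈ IsManifold.maximalAtlas (𝓡 m) ∞ M, x₀ ∈ e.source ∧
      ∃ fr : Fin (Module.finrank ℂ F) → Π x : M, V x, IsSmoothFrameOn (m := m) F fr e.source := by
  set t := trivializationAt F V x₀ with ht
  have hsub : ((chartAt (EuclideanSpace ℝ (Fin m)) x₀).restr t.baseSet).source ⊆ t.baseSet := by
    rw [OpenPartialHomeomorph.restr_source]
    exact Set.inter_subset_right.trans interior_subset
  refine ⟨(chartAt (EuclideanSpace ℝ (Fin m)) x₀).restr t.baseSet,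
    restr_mem_maximalAtlas _ (IsManifold.chart_mem_maximalAtlas x₀) t.open_baseSet, ?_, ?_⟩
  · rw [OpenPartialHomeomorph.restr_source, t.open_baseSet.interior_eq]
    exact ⟨mem_chart_source _ x₀, mem_baseSet_trivializationAt F V x₀⟩
  -- The frame is a fixed basis of the model fibre transported by the trivialization.
  · let b := Module.finBasis ℂ F
    have hL : ∀ x (hx : x ∈ t.baseSet), ∀ v, t.symm x v
        = (Trivialization.linearEquivAt ℂ t x hx).symm v := fun x hx v => rfl
    refine ⟨fun a x => t.symm x (b a), ⟨fun x hx => ?_, fun x hx => ?_, fun a => ?_⟩⟩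
    · simp only [hL x (hsub hx)]
      exact b.linearIndependent.map' _ (LinearEquiv.ker _)
    · simp only [hL x (hsub hx)]
      have : (Set.range fun a => (Trivialization.linearEquivAt ℂ t x (hsub hx)).symm (b a))
          = (Trivialization.linearEquivAt ℂ t x (hsub hx)).symm '' Set.range b := by
        rw [← Set.range_comp]; rfl
      have h2 := Submodule.map_span
        ((Trivialization.linearEquivAt ℂ t x (hsub hx)).symm : F →ₗ[ℂ] V x) (Set.range b)
      rw [b.span_eq, Submodule.map_top, LinearMap.range_eq_top.2
        (Trivialization.linearEquivAt ℂ t x (hsub hx)).symm.surjective] at h2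
      rw [this]
      exact h2.symm
    · refine ContMDiffOn.mono ?_ hsub
      rw [t.contMDiffOn_section_baseSet_iff]
      refine (contMDiffOn_const (c := b a)).congr fun x hx => ?_
      simp [t.apply_mk_symm hx]

end FramedCharts

/-! ### Measurability of sections -/

section Measurability

variable {m : ℕ} {M : Type*} [TopologicalSpace M] [ChartedSpace (EuclideanSpace ℝ (Fin m)) M]
  {F : Type*} [NormedAddCommGroup F] [NormedSpace ℂ F]
  {V : M → Type*} [TopologicalSpace (TotalSpace F V)]
  [∀ x, NormedAddCommGroup (V x)] [∀ x, InnerProductSpace ℂ (V x)] [FiberBundle F V]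
  [VectorBundle ℝ F V] [MeasurableSpace M]

lemma continuousOn_inner_totalSpace (hV : IsSmoothHermitian (m := m) F (V := V))
    {σ : Π x : M, V x} {U : Set M} (hσ : SmoothSectionOn m F σ U) :
    ContinuousOn (fun q : TotalSpace F V => inner ℂ (σ q.1) q.2)
      (TotalSpace.proj ⁻¹' U) := by
  rcases hV with ⟨g, g_smooth, hg⟩
  intro q hq
  simp only [hg]
  have hb : ContMDiffWithinAt ((𝓡 m).prod 𝓘(ℝ, F)) (𝓡 m) ∞ (TotalSpace.proj : TotalSpace F V → M)
      (TotalSpace.proj ⁻¹' U) q := (contMDiff_proj V).contMDiffAt.contMDiffWithinAt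
  have : ContMDiffWithinAt ((𝓡 m).prod 𝓘(ℝ, F)) ((𝓡 m).prod 𝓘(ℝ, ℂ)) ∞
      (fun q : TotalSpace F V => TotalSpace.mk' ℂ (E := Bundle.Trivial M ℂ) q.1
        (g q.1 (σ q.1) q.2)) (TotalSpace.proj ⁻¹' U) q := by
    apply ContMDiffWithinAt.clm_bundle_apply₂ (F₁ := F) (F₂ := F)
    · exact ContMDiffAt.comp_contMDiffWithinAt q g_smooth.contMDiffAt hb
    · exact (hσ _ hq).comp q hb (fun _ h => h)
    · exact contMDiffWithinAt_id
  simp only [contMDiffWithinAt_totalSpace] at this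
  exact this.2.continuousWithinAt

/-- Pairing with `σ` is a continuous function on the part of the total space above `U`; its
extension by zero is Borel and can be composed with the Borel section. -/
lemma IsBorelSection.aestronglyMeasurable_inner (hV : IsSmoothHermitian (m := m) F (V := V))
    [BorelSpace M]
    {f : Π x : M, V x} (hf : IsBorelSection F f) {σ : Π x : M, V x} {U : Set M} (hU : IsOpen U)
    (hσ : SmoothSectionOn m F σ U) (μ : Measure M) :
    AEStronglyMeasurable (fun x => inner ℂ (σ x) (f x)) (μ.restrict U) := by
  classical
  let _ : MeasurableSpace (TotalSpace F V) := borel _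
  have : BorelSpace (TotalSpace F V) := ⟨rfl⟩
  have hW : IsOpen ((TotalSpace.proj : TotalSpace F V → M) ⁻¹' U) :=
    hU.preimage (FiberBundle.continuous_proj F V)
  have h1 : Measurable ((TotalSpace.proj ⁻¹' U).piecewise
      (fun q : TotalSpace F V => inner ℂ (σ q.1) q.2) fun _ => (0 : ℂ)) :=
    (continuousOn_inner_totalSpace hV hσ).measurable_piecewise continuousOn_const hW.measurableSet
  refine ((h1.comp hf).aestronglyMeasurable).congr ?_
  filter_upwards [ae_restrict_mem hU.measurableSet] with x hx
  exact Set.piecewise_eq_of_mem _ _ _ hx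

lemma IsSmoothSection.isBorelSection [BorelSpace M] {f : Π x : M, V x}
    (hf : IsSmoothSection (m := m) F f) : IsBorelSection F f := by
  let _ : MeasurableSpace (TotalSpace F V) := borel _
  have : BorelSpace (TotalSpace F V) := ⟨rfl⟩
  exact hf.continuous.measurable

/-- Subtraction from a smooth section is a continuous self-map of the total space, so the difference
is a composition and no joint measurability of two Borel sections is involved. -/
lemma IsBorelSection.smooth_sub {u f : Π x : M, V x}
    (hu : IsSmoothSection (m := m) F u) (hf : IsBorelSection F f) :
    IsBorelSection F (fun x => u x - f x) := by
  let _ : MeasurableSpace (TotalSpace F V) := borel _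
  have : BorelSpace (TotalSpace F V) := ⟨rfl⟩
  have hc : Continuous (fun q : TotalSpace F V => (⟨q.1, u q.1 - q.2⟩ : TotalSpace F V)) := by
    rw [continuous_iff_continuousAt]
    intro q
    have hq : ContinuousAt (fun q : TotalSpace F V => q) q := continuousAt_id
    have hu' : ContinuousAt (fun q : TotalSpace F V => (⟨q.1, u q.1⟩ : TotalSpace F V)) q :=
      (hu.continuous.comp (FiberBundle.continuous_proj F V)).continuousAt
    rw [FiberBundle.continuousAt_totalSpace] at hq hu' ⊢
    refine ⟨hq.1, (hu'.2.sub hq.2).congr ?_⟩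
    filter_upwards [hq.1.preimage_mem_nhds ((trivializationAt F V q.1).open_baseSet.mem_nhds
      (mem_baseSet_trivializationAt F V q.1))] with z hz
    exact ((Trivialization.linear ℝ (trivializationAt F V q.1) hz).mk' _ |>.map_sub _ _).symm
  exact hc.measurable.comp hf

end Measurability

/-! ### Measurability of tensor fields -/

section TensorMeasurability

variable {m : ℕ} {M : Type*} [TopologicalSpace M] [T2Space M] [SecondCountableTopology M]
  [ChartedSpace (EuclideanSpace ℝ (Fin m)) M]
  [IsManifold (𝓡 m) ∞ M] [MeasurableSpace M] [BorelSpace M]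
  {F : Type*} [NormedAddCommGroup F] [NormedSpace ℂ F]
  {V : M → Type*} [TopologicalSpace (TotalSpace F V)]
  [∀ x, NormedAddCommGroup (V x)] [∀ x, InnerProductSpace ℂ (V x)] [FiberBundle F V]
  [VectorBundle ℂ F V] [VectorBundle ℝ F V] [ContMDiffVectorBundle ∞ F V (𝓡 m)]
  {e : OpenPartialHomeomorph M (EuclideanSpace ℝ (Fin m))} {ℓ : ℕ}
  {fr : Fin ℓ → Π x : M, V x}

lemma aestronglyMeasurable_of_local {E : Type*} [TopologicalSpace E]
    [TopologicalSpace.PseudoMetrizableSpace E] {μ : Measure M} {f : M → E} {U : Set M}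
    (h : ∀ x ∈ U, ∃ O : Set M, IsOpen O ∧ x ∈ O ∧ AEStronglyMeasurable f (μ.restrict O)) :
    AEStronglyMeasurable f (μ.restrict U) := by
  choose! O hO hxO hf using h
  obtain ⟨s, hsU, hsc, hs⟩ := TopologicalSpace.countable_cover_nhdsWithin
    (f := O) (s := U) fun x hx => mem_nhdsWithin_of_mem_nhds ((hO x hx).mem_nhds (hxO x hx))
  have : Countable s := hsc.to_subtype
  have h2 : AEStronglyMeasurable f (μ.restrict (⋃ x : s, O x)) :=
    aestronglyMeasurable_iUnion_iff.2 fun x => hf x (hsU x.2)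
  refine h2.mono_measure (Measure.restrict_mono ?_ le_rfl)
  rw [Set.iUnion_subtype]
  exact hs

/-- Smooth and Borel tensor fields are defined through globally smooth vector fields, whereas
coordinate fields live on a chart only; a cutoff makes them global without changing them near the
point. -/
lemma exists_smoothVF_eq (he : e ∈ IsManifold.maximalAtlas (𝓡 m) ∞ M) {x : M} (hx : x ∈ e.source) :
    ∃ (O : Set M) (X : Fin m → Π x : M, TangentSpace (𝓡 m) x), IsOpen O ∧ x ∈ O ∧ O ⊆ e.source ∧
      (∀ i, IsSmoothVF (X i)) ∧ ∀ i, ∀ y ∈ O, X i y = coordField e i y := by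
  obtain ⟨χ, hχ, hs, -, h1⟩ := exists_bump (m := m) e.open_source hx
  obtain ⟨O, hO1, hO, hxO⟩ := eventually_nhds_iff.1 h1
  refine ⟨O ∩ e.source, fun i y => χ y • coordField e i y, hO.inter e.open_source, ⟨hxO, hx⟩,
    Set.inter_subset_right, fun i => ?_, fun i y hy => ?_⟩
  · exact ContMDiffOn.smul_section_of_tsupport (V := fun x : M => TangentSpace (𝓡 m) x)
      hχ.contMDiffOn e.open_source hs (contMDiffOn_coordField he i)
  · simp only [hO1 y hy.1, one_smul]

lemma IsSmoothTensor.isLocSmoothTensor {j : ℕ} {T : TensorField (m := m) V j}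
    (hT : IsSmoothTensor F T) : IsLocSmoothTensor F T := by
  intro e he α x hx
  obtain ⟨O, X, hO, hxO, hOe, hX, hXe⟩ := exists_smoothVF_eq he hx
  have h := hT (fun k => X (α k)) (fun k => hX (α k))
  have h2 : SmoothSectionOn m F (fun x => T x fun k => coordField e (α k) x) O := by
    refine (ContMDiff.contMDiffOn h).congr fun y hy => ?_
    simp only [hXe _ y hy]
  exact (h2.contMDiffAt (hO.mem_nhds hxO)).contMDiffWithinAt

lemma IsBorelTensor.aestronglyMeasurable_comp (hV : IsSmoothHermitian (m := m) F (V := V))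
    (he : e ∈ IsManifold.maximalAtlas (𝓡 m) ∞ M) (hfr : IsSmoothFrameOn (m := m) F fr e.source)
    {j : ℕ} {T : TensorField (m := m) V j} (hT : IsBorelTensor F T) (κ : Idx m ℓ j)
    (μ : Measure M) :
    AEStronglyMeasurable (tensorComp e fr (fun x v => T x v) κ) (μ.restrict e.source) := by
  refine aestronglyMeasurable_of_local fun x hx => ?_
  obtain ⟨O, X, hO, hxO, hOe, hX, hXe⟩ := exists_smoothVF_eq he hx
  refine ⟨O, hO, hxO, ?_⟩
  refine (IsBorelSection.aestronglyMeasurable_inner hV (hT (fun k => X (κ.1 k))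
    (fun k => hX _)) hO ((hfr.contMDiffOn_dualFrame hV κ.2).mono hOe) μ).congr ?_
  filter_upwards [ae_restrict_mem hO.measurableSet] with y hy
  simp only [tensorComp, hXe _ y hy]

variable [RiemannianBundle (fun x : M => TangentSpace (𝓡 m) x)]
  [IsContMDiffRiemannianBundle (𝓡 m) ∞ (EuclideanSpace ℝ (Fin m))
      (fun x : M => TangentSpace (𝓡 m) x)]

lemma IsLocSmoothTensor.isSmoothTensor {j : ℕ} {T : TensorField (m := m) V j}
    (hT : IsLocSmoothTensor F T) : IsSmoothTensor F T := fun X hX =>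
  contMDiffOn_univ.1 (hT.smooth_apply isOpen_univ fun k => (hX k).contMDiffOn)

lemma IsSmoothTensor.isBorelTensor {j : ℕ} {T : TensorField (m := m) V j}
    (hT : IsSmoothTensor F T) : IsBorelTensor F T := fun X hX => (hT X hX).isBorelSection

lemma IsBorelTensor.smooth_sub {j : ℕ} {S T : TensorField (m := m) V j}
    (hS : IsSmoothTensor F S) (hT : IsBorelTensor F T) : IsBorelTensor F (fun x => S x - T x) :=
  fun X hX => (hT X hX).smooth_sub (hS X hX)

variable [FiniteDimensional ℂ F]

lemma IsBorelTensor.aestronglyMeasurable_tensorInner (hV : IsSmoothHermitian (m := m) F (V := V))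
    {j : ℕ} {S T : TensorField (m := m) V j} (hS : IsBorelTensor F S) (hT : IsBorelTensor F T)
    (μ : Measure M) :
    AEStronglyMeasurable (fun x => tensorInner (fun v => S x v) (fun v => T x v)) μ := by
  rw [← Measure.restrict_univ (μ := μ)]
  refine aestronglyMeasurable_of_local fun x _ => ?_
  obtain ⟨e, he, hxe, fr, hfr⟩ := exists_framed_chart m F V x
  refine ⟨e.source, e.open_source, hxe, ?_⟩
  refine AEStronglyMeasurable.congr (f := fun x => ∑ κ : Idx m _ j, ∑ κ' : Idx m _ j,
      tensorGram e fr κ κ' x * (star (tensorComp e fr (fun x v => S x v) κ x) *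
        tensorComp e fr (fun x v => T x v) κ' x)) ?_ ?_
  · refine Finset.aestronglyMeasurable_fun_sum _ fun κ _ =>
      Finset.aestronglyMeasurable_fun_sum _ fun κ' _ => ?_
    refine AEStronglyMeasurable.mul ?_ (AEStronglyMeasurable.mul ?_ ?_)
    · exact (contMDiffOn_tensorGram hV he hfr κ κ').continuousOn.aestronglyMeasurable
        e.open_source.measurableSet
    · exact (hS.aestronglyMeasurable_comp hV he hfr κ μ).star
    · exact hT.aestronglyMeasurable_comp hV he hfr κ' μ
  · filter_upwards [ae_restrict_mem e.open_source.measurableSet] with y hy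
    exact (tensorInner_eq_sum_tensorGram he hfr S T hy).symm

lemma IsBorelTensor.aestronglyMeasurable_tensorNorm (hV : IsSmoothHermitian (m := m) F (V := V))
    {j : ℕ} {T : TensorField (m := m) V j} (hT : IsBorelTensor F T) (μ : Measure M) :
    AEStronglyMeasurable (fun x => tensorNorm (fun v => T x v)) μ := by
  have h := hT.aestronglyMeasurable_tensorInner hV hT μ
  simp only [tensorNorm_eq_sqrt]
  exact (Real.continuous_sqrt.comp Complex.continuous_re).comp_aestronglyMeasurable h

lemma IsLocSmoothTensor.continuous_tensorNorm (hV : IsSmoothHermitian (m := m) F (V := V))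
    {j : ℕ} {T : TensorField (m := m) V j} (hT : IsLocSmoothTensor F T) :
    Continuous (fun x => tensorNorm (fun v => T x v)) := by
  rw [continuous_iff_continuousAt]
  intro x
  obtain ⟨e, he, hxe, fr, hfr⟩ := exists_framed_chart m F V x
  have h : ContinuousOn (fun x => ∑ κ : Idx m _ j, ∑ κ' : Idx m _ j,
      tensorGram e fr κ κ' x * (star (tensorComp e fr (fun x v => T x v) κ x) *
        tensorComp e fr (fun x v => T x v) κ' x)) e.source := by
    refine continuousOn_finsetSum _ fun κ _ => continuousOn_finsetSum _ fun κ' _ => ?_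
    refine ContinuousOn.mul (contMDiffOn_tensorGram hV he hfr κ κ').continuousOn
      (ContinuousOn.mul ?_ (hT.contMDiffOn_tensorComp hV he hfr κ').continuousOn)
    exact (hT.contMDiffOn_tensorComp hV he hfr κ).continuousOn.star
  simp only [tensorNorm_eq_sqrt]
  refine (Real.continuous_sqrt.comp Complex.continuous_re).continuousAt.comp ?_
  refine (h.continuousAt (e.open_source.mem_nhds hxe)).congr ?_
  filter_upwards [e.open_source.mem_nhds hxe] with y hy
  exact (tensorInner_eq_sum_tensorGram he hfr T T hy).symm

end TensorMeasurability

/-! ### Integration against the Riemannian volume in charts -/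

section Integration

variable {m : ℕ} {M : Type*} [TopologicalSpace M] [ChartedSpace (EuclideanSpace ℝ (Fin m)) M]
  [IsManifold (𝓡 m) ∞ M] [MeasurableSpace M] [BorelSpace M]
  [RiemannianBundle (fun x : M => TangentSpace (𝓡 m) x)]
  [IsContMDiffRiemannianBundle (𝓡 m) ∞ (EuclideanSpace ℝ (Fin m))
      (fun x : M => TangentSpace (𝓡 m) x)]
  {e : OpenPartialHomeomorph M (EuclideanSpace ℝ (Fin m))}

lemma integral_volG_eq (he : e ∈ IsManifold.maximalAtlas (𝓡 m) ∞ M) {f : M → ℂ}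
    (hf : AEStronglyMeasurable f ((volG (m := m) M).restrict e.source))
    (h0 : ∀ x, x ∉ e.source → f x = 0) :
    ∫ x, f x ∂(volG (m := m) M)
      = ∫ y in e.target, (metricDensity e (e.symm y) : ℂ) * f (e.symm y) := by
  rw [← setIntegral_eq_integral_of_forall_compl_eq_zero h0]
  rw [volG_restrict_source he, chartVol] at hf ⊢
  rw [integral_map aemeasurable_symm hf, integral_withDensity_eq_integral_toReal_smul₀]
  · refine setIntegral_congr_fun e.open_target.measurableSet fun y hy => ?_
    rw [volDensity_eq hy, ENNReal.toReal_ofReal (metricDensity_pos he (e.map_target hy)).le,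
      Complex.real_smul]
  · exact ((continuousOn_volDensity he).aemeasurable e.open_target.measurableSet).ennreal_ofReal
  · exact Filter.Eventually.of_forall fun y => ENNReal.ofReal_lt_top

/-- On compact subsets of a chart, the Riemannian volume is comparable to Lebesgue measure. -/
lemma exists_measure_bounds [T2Space M] (he : e ∈ IsManifold.maximalAtlas (𝓡 m) ∞ M)
    {K : Set (EuclideanSpace ℝ (Fin m))} (hK : IsCompact K) (hKe : K ⊆ e.target) :
    ∃ C : ℝ≥0∞, C ≠ ⊤ ∧
      (volG (m := m) M).restrict (e.symm '' K) ≤ C • Measure.map e.symm (volume.restrict K) ∧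
      Measure.map e.symm (volume.restrict K) ≤ C • (volG (m := m) M).restrict (e.symm '' K) := by
  have hc := (continuousOn_metricDensity_symm he).mono hKe
  -- `C1` bounds the density on `K` and `C2` its inverse.
  obtain ⟨C1, hC1⟩ := (hK.image_of_continuousOn hc).bddAbove
  have hpos : ∀ y ∈ K, metricDensity e (e.symm y) ≠ 0 := fun y hy =>
    (metricDensity_pos he (e.map_target (hKe hy))).ne'
  obtain ⟨C2, hC2⟩ := (hK.image_of_continuousOn (hc.inv₀ hpos)).bddAbove
  have hLm : MeasurableSet (e.symm '' K) :=
    (hK.image_of_continuousOn (e.continuousOn_symm.mono hKe)).isClosed.measurableSet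
  have hae : AEMeasurable e.symm (volume.restrict K) :=
    (e.continuousOn_symm.mono hKe).aemeasurable hK.measurableSet
  have hS : ∀ A : Set M, e.target ∩ e.symm ⁻¹' (A ∩ e.symm '' K) = K ∩ e.symm ⁻¹' A := by
    intro A; ext y; constructor
    · rintro ⟨h1, h2, z, hz, hzy⟩
      have : z = y := by
        have := congrArg e hzy
        rwa [e.right_inv (hKe hz), e.right_inv h1] at this
      exact ⟨this ▸ hz, h2⟩
    · rintro ⟨h1, h2⟩
      exact ⟨hKe h1, h2, y, h1, rfl⟩
  have hvol : ∀ A : Set M, MeasurableSet A → (volG (m := m) M).restrict (e.symm '' K) A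
      = ∫⁻ y in K ∩ e.symm ⁻¹' A, ENNReal.ofReal (metricDensity e (e.symm y)) := by
    intro A hA
    rw [Measure.restrict_apply hA, volG_apply_of_subset he (hA.inter hLm), chartVol_apply
      (hA.inter hLm), hS]
    rintro x ⟨-, y, hy, rfl⟩
    exact e.map_target (hKe hy)
  have hmap : ∀ A : Set M, MeasurableSet A → Measure.map e.symm (volume.restrict K) A
      = volume (K ∩ e.symm ⁻¹' A) := by
    intro A hA
    rw [Measure.map_apply_of_aemeasurable hae hA, Measure.restrict_apply₀' hK.measurableSet.nullMeasurableSet,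
      Set.inter_comm]
  have hm : ∀ A : Set M, MeasurableSet A → MeasurableSet (K ∩ e.symm ⁻¹' A) := by
    intro A hA
    rw [← hS]; exact measurableSet_target_inter (hA.inter hLm)
  refine ⟨max (ENNReal.ofReal C1) (ENNReal.ofReal C2), by simp, ?_, ?_⟩
  · refine Measure.le_iff.2 fun A hA => ?_
    rw [hvol A hA, Measure.smul_apply, hmap A hA, smul_eq_mul]
    refine le_trans ?_ (mul_le_mul_left (le_max_left _ _) _)
    rw [← setLIntegral_const]
    exact setLIntegral_mono' (hm A hA) fun y hy =>
      ENNReal.ofReal_le_ofReal (hC1 ⟨y, hy.1, rfl⟩)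
  · refine Measure.le_iff.2 fun A hA => ?_
    rw [Measure.smul_apply, hvol A hA, hmap A hA, smul_eq_mul]
    refine le_trans ?_ (mul_le_mul_left (le_max_right _ _) _)
    rw [← lintegral_const_mul' _ _ ENNReal.ofReal_ne_top]
    calc volume (K ∩ e.symm ⁻¹' A) = ∫⁻ y in K ∩ e.symm ⁻¹' A, 1 := by simp
      _ ≤ _ := setLIntegral_mono' (hm A hA) fun y hy => ?_
    have h1 := metricDensity_pos he (e.map_target (hKe hy.1))
    have h2 : (metricDensity e (e.symm y))⁻¹ ≤ C2 := hC2 ⟨y, hy.1, rfl⟩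
    rw [← ENNReal.ofReal_mul (le_trans (inv_pos.2 h1).le h2), ← ENNReal.ofReal_one]
    refine ENNReal.ofReal_le_ofReal ?_
    rw [← inv_mul_cancel₀ h1.ne']
    exact mul_le_mul_of_nonneg_right h2 h1.le

lemma isLocallyFiniteMeasure_volG [T2Space M] : IsLocallyFiniteMeasure (volG (m := m) M) := by
  refine ⟨fun x => ?_⟩
  have he := IsManifold.chart_mem_maximalAtlas (I := 𝓡 m) (n := ∞) x
  set e := chartAt (EuclideanSpace ℝ (Fin m)) x
  have hx : x ∈ e.source := mem_chart_source _ x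
  obtain ⟨K, hK, hxK, hKe⟩ := exists_compact_subset e.open_target (e.map_source hx)
  refine ⟨e.symm '' K, ?_, ?_⟩
  · have h1 : e.source ∩ e ⁻¹' (interior K) ∈ 𝓝 x :=
      (e.isOpen_inter_preimage isOpen_interior).mem_nhds ⟨hx, hxK⟩
    filter_upwards [h1] with y hy
    exact ⟨e y, interior_subset hy.2, e.left_inv hy.1⟩
  · obtain ⟨C, hC, h1, -⟩ := exists_measure_bounds he hK hKe
    have h2 := h1 Set.univ
    rw [Measure.restrict_apply_univ, Measure.smul_apply, smul_eq_mul,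
      Measure.map_apply_of_aemeasurable
        ((e.continuousOn_symm.mono hKe).aemeasurable hK.measurableSet) MeasurableSet.univ,
      Set.preimage_univ, Measure.restrict_apply_univ] at h2
    exact h2.trans_lt (ENNReal.mul_lt_top hC.lt_top hK.measure_lt_top)

end Integration


/-! ### Test tensors supported in a chart -/

section TestTensors

variable {m : ℕ} {M : Type*} [TopologicalSpace M] [T2Space M]
  [ChartedSpace (EuclideanSpace ℝ (Fin m)) M]
  [IsManifold (𝓡 m) ∞ M]
  {F : Type*} [NormedAddCommGroup F] [NormedSpace ℂ F]
  {V : M → Type*} [TopologicalSpace (TotalSpace F V)]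
  [∀ x, NormedAddCommGroup (V x)] [∀ x, InnerProductSpace ℂ (V x)] [FiberBundle F V]
  [VectorBundle ℂ F V] [VectorBundle ℝ F V] [ContMDiffVectorBundle ∞ F V (𝓡 m)]
  {e : OpenPartialHomeomorph M (EuclideanSpace ℝ (Fin m))} {ℓ : ℕ}
  {fr : Fin ℓ → Π x : M, V x}

/-- A section which is smooth on an open set and vanishes outside a compact subset of it is smooth. -/
lemma SmoothSectionOn.isSmoothSection {σ : Π x : M, V x} {U K : Set M} (hU : IsOpen U)
    (hσ : SmoothSectionOn m F σ U) (hK : IsCompact K) (hKU : K ⊆ U) (h0 : ∀ x, x ∉ K → σ x = 0) :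
    IsSmoothSection (m := m) F σ := by
  intro x
  by_cases hx : x ∈ U
  · exact hσ.contMDiffAt (hU.mem_nhds hx)
  · have h : ContMDiffAt (𝓡 m) ((𝓡 m).prod 𝓘(ℝ, F)) ∞ (fun x => TotalSpace.mk' F x (0 : V x)) x :=
      (contMDiff_zeroSection ℝ V).contMDiffAt
    refine h.congr_of_eventuallyEq ?_
    filter_upwards [hK.isClosed.isOpen_compl.mem_nhds fun h => hx (hKU h)] with y hy
    rw [h0 y hy]

/-- A section as a tensor field without arguments. -/
noncomputable def constTensor (f : Π x : M, V x) : TensorField (m := m) V 0 := fun x =>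
  MultilinearMap.constOfIsEmpty ℝ _ (f x)

lemma constTensor_apply (f : Π x : M, V x) (x : M) (v : Fin 0 → TangentSpace (𝓡 m) x) :
    constTensor (m := m) f x v = f x := rfl

variable [RiemannianBundle (fun x : M => TangentSpace (𝓡 m) x)]

lemma tensorInner_zero_index {x : M} (A B : (Fin 0 → TangentSpace (𝓡 m) x) → V x)
    (v : Fin 0 → TangentSpace (𝓡 m) x) : tensorInner A B = inner ℂ (A v) (B v) := by
  have h : ∀ w : Fin 0 → TangentSpace (𝓡 m) x, w = v := fun w => Subsingleton.elim _ _
  unfold tensorInner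
  simp [h (fun k => tangentONB x _)]

lemma tensorNorm_constTensor (f : Π x : M, V x) (x : M) :
    tensorNorm (fun v => constTensor (m := m) f x v) = ‖f x‖ :=
  tensorNorm_zero_index _ 0

/-- The coefficient on `M` of a test function in a chart, relative to the Riemannian volume. -/
noncomputable def testCoef (e : OpenPartialHomeomorph M (EuclideanSpace ℝ (Fin m)))
    (η : EuclideanSpace ℝ (Fin m) → ℂ) (x : M) : ℂ :=
  e.source.indicator (fun x => star (η (e x)) * ((metricDensity e x)⁻¹ : ℝ)) x

/-- The tensor field which pairs with tensors as a family of test functions with the components. -/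
noncomputable def testTensor (e : OpenPartialHomeomorph M (EuclideanSpace ℝ (Fin m)))
    (fr : Fin ℓ → Π x : M, V x) {j : ℕ} (η : Idx m ℓ j → EuclideanSpace ℝ (Fin m) → ℂ) :
    TensorField (m := m) V j := fun x =>
  ∑ κ, simpleTensor (fun k => coordField e (κ.1 k) x) (testCoef e (η κ) x • dualFrame fr κ.2 x)

lemma isCompact_symm_image_tsupport {η : EuclideanSpace ℝ (Fin m) → ℂ} (hη : IsTest e.target η) :
    IsCompact (e.symm '' tsupport η) :=
  hη.2.isCompact.image_of_continuousOn (e.continuousOn_symm.mono hη.3)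

lemma testCoef_eq_zero {η : EuclideanSpace ℝ (Fin m) → ℂ} {x : M} (hx : x ∉ e.symm '' tsupport η) :
    testCoef e η x = 0 := by
  unfold testCoef
  by_cases h : x ∈ e.source
  · rw [Set.indicator_of_mem h]
    have : η (e x) = 0 := by
      by_contra h0
      exact hx ⟨e x, subset_tsupport _ h0, e.left_inv h⟩
    simp [this]
  · rw [Set.indicator_of_notMem h]

lemma isCompact_iUnion_tsupport {j : ℕ} {η : Idx m ℓ j → EuclideanSpace ℝ (Fin m) → ℂ}
    (hη : ∀ κ, IsTest e.target (η κ)) : IsCompact (⋃ κ, e.symm '' tsupport (η κ)) :=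
  isCompact_iUnion fun κ => isCompact_symm_image_tsupport (hη κ)

lemma iUnion_tsupport_subset {j : ℕ} {η : Idx m ℓ j → EuclideanSpace ℝ (Fin m) → ℂ}
    (hη : ∀ κ, IsTest e.target (η κ)) : (⋃ κ, e.symm '' tsupport (η κ)) ⊆ e.source := by
  rintro x hx
  obtain ⟨κ, y, hy, rfl⟩ := Set.mem_iUnion.1 hx
  exact e.map_target ((hη κ).3 hy)

lemma testTensor_eq_zero {j : ℕ} {η : Idx m ℓ j → EuclideanSpace ℝ (Fin m) → ℂ} {x : M}
    (hx : x ∉ ⋃ κ, e.symm '' tsupport (η κ)) : testTensor e fr η x = 0 := by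
  refine Finset.sum_eq_zero fun κ _ => ?_
  have : testCoef e (η κ) x = 0 := testCoef_eq_zero fun h => hx (Set.mem_iUnion.2 ⟨κ, h⟩)
  rw [this, zero_smul]
  ext v
  simp [simpleTensor_apply]

lemma hasCompactSupp_testTensor {j : ℕ} {η : Idx m ℓ j → EuclideanSpace ℝ (Fin m) → ℂ}
    (hη : ∀ κ, IsTest e.target (η κ)) :
    HasCompactSupp (testTensor (V := V) e fr η) :=
  ⟨_, isCompact_iUnion_tsupport hη, fun _ hx => testTensor_eq_zero hx⟩

lemma tensorInner_testTensor {j : ℕ} (η : Idx m ℓ j → EuclideanSpace ℝ (Fin m) → ℂ)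
    (T : TensorField (m := m) V j) (x : M) :
    tensorInner (fun v => testTensor e fr η x v) (fun v => T x v)
      = ∑ κ, star (testCoef e (η κ) x) * tensorComp e fr (fun x v => T x v) κ x := by
  have h1 : tensorInner (fun v => testTensor e fr η x v) (fun v => T x v)
      = ∑ κ : Idx m ℓ j, tensorInner (fun v => simpleTensor (fun k => coordField e (κ.1 k) x)
        (testCoef e (η κ) x • dualFrame fr κ.2 x) v) (fun v => T x v) := by
    simp only [tensorInner, testTensor, sum_apply, sum_inner]
    rw [Finset.sum_comm]
  rw [h1]
  refine Finset.sum_congr rfl fun κ _ => ?_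
  rw [tensorInner_simpleTensor, inner_smul_left]
  rfl

variable [IsContMDiffRiemannianBundle (𝓡 m) ∞ (EuclideanSpace ℝ (Fin m))
      (fun x : M => TangentSpace (𝓡 m) x)]

lemma contMDiffOn_testCoef (he : e ∈ IsManifold.maximalAtlas (𝓡 m) ∞ M)
    {η : EuclideanSpace ℝ (Fin m) → ℂ} (hη : IsTest e.target η) :
    ContMDiffOn (𝓡 m) 𝓘(ℝ, ℂ) ∞ (testCoef e η) e.source := by
  have h1 : ContMDiffOn (𝓡 m) 𝓘(ℝ, ℝ) ∞ (fun x => (metricDensity e x)⁻¹) e.source :=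
    (contMDiffOn_metricDensity he).inv₀ fun x hx => (metricDensity_pos he hx).ne'
  refine (contMDiffOn_complex_mul (contMDiffOn_star (contMDiffOn_comp_chart (c := η) he hη.1.contDiffOn))
    (contMDiffOn_ofReal h1)).congr fun x hx => ?_
  rw [testCoef, Set.indicator_of_mem hx]

lemma isSmoothTensor_testTensor (hV : IsSmoothHermitian (m := m) F (V := V))
    (he : e ∈ IsManifold.maximalAtlas (𝓡 m) ∞ M) (hfr : IsSmoothFrameOn (m := m) F fr e.source)
    {j : ℕ} {η : Idx m ℓ j → EuclideanSpace ℝ (Fin m) → ℂ} (hη : ∀ κ, IsTest e.target (η κ)) :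
    IsSmoothTensor F (testTensor (V := V) e fr η) := by
  intro X hX
  have h1 : SmoothSectionOn m F (fun x => ∑ κ : Idx m ℓ j,
      (∏ k, (inner ℝ (coordField e (κ.1 k) x) (X k x) : ℝ)) •
        (testCoef e (η κ) x • dualFrame fr κ.2 x)) e.source := by
    refine SmoothSectionOn.sum fun κ _ => ContMDiffOn.smul_section ?_
      ((hfr.contMDiffOn_dualFrame hV _).smul (contMDiffOn_testCoef he (hη κ)))
    exact contMDiffOn_finsetProd fun k _ =>
      (contMDiffOn_coordField he _).inner_bundle (hX k).contMDiffOn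
  refine SmoothSectionOn.isSmoothSection e.open_source (h1.congr fun x _ => ?_)
    (isCompact_iUnion_tsupport hη) (iUnion_tsupport_subset hη) fun x hx => ?_
  · simp only [testTensor, sum_apply, simpleTensor_apply]
  · rw [testTensor_eq_zero hx, zero_apply]

variable [SecondCountableTopology M] [MeasurableSpace M] [BorelSpace M] [FiniteDimensional ℂ F]

/-- The normalization of `testCoef` is made for this formula: its conjugate undoes the conjugate
linearity of the inner product in the first slot, and its factor `1/√det g` cancels the Riemannian
density. -/
lemma integral_tensorInner_testTensor (hV : IsSmoothHermitian (m := m) F (V := V))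
    (he : e ∈ IsManifold.maximalAtlas (𝓡 m) ∞ M) (hfr : IsSmoothFrameOn (m := m) F fr e.source)
    {j : ℕ} {η : Idx m ℓ j → EuclideanSpace ℝ (Fin m) → ℂ} (hη : ∀ κ, IsTest e.target (η κ))
    {T : TensorField (m := m) V j} (hT : IsBorelTensor F T)
    (hL : ∀ κ, MemLpLocOn 1 e.target (fun y => tensorComp e fr (fun x v => T x v) κ (e.symm y))) :
    ∫ x, tensorInner (fun v => testTensor e fr η x v) (fun v => T x v) ∂(volG (m := m) M)
      = ∑ κ, ∫ y, η κ y * tensorComp e fr (fun x v => T x v) κ (e.symm y) := by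
  rw [integral_volG_eq he]
  · rw [← integral_finsetSum _ fun κ _ => (hη κ).integrable_mul le_rfl (hL κ),
      ← setIntegral_eq_integral_of_forall_compl_eq_zero (s := e.target) (f := fun y =>
        ∑ κ, η κ y * tensorComp e fr (fun x v => T x v) κ (e.symm y))]
    · refine setIntegral_congr_fun e.open_target.measurableSet fun y hy => ?_
      simp only [tensorInner_testTensor, Finset.mul_sum]
      refine Finset.sum_congr rfl fun κ _ => ?_
      have hx := e.map_target hy
      have h0 : (metricDensity e (e.symm y) : ℂ) ≠ 0 := by
        exact_mod_cast (metricDensity_pos he hx).ne'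
      rw [testCoef, Set.indicator_of_mem hx, e.right_inv hy]
      simp only [star_mul', Complex.star_def, Complex.conj_conj, Complex.conj_ofReal,
        Complex.ofReal_inv, map_inv₀]
      field_simp
    · intro y hy
      refine Finset.sum_eq_zero fun κ (_ : κ ∈ Finset.univ) => ?_
      have : η κ y = 0 := by
        by_contra h
        exact hy ((hη κ).3 (subset_tsupport _ h))
      rw [this, zero_mul]
  · exact (isSmoothTensor_testTensor hV he hfr hη).isBorelTensor.aestronglyMeasurable_tensorInner
      hV hT _
  · intro x hx
    rw [testTensor_eq_zero fun h => hx (iUnion_tsupport_subset hη h)]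
    simp [tensorInner]

/-- On a compact subset of a chart the components are bounded by the tensor norm, and Lebesgue
measure is bounded by the Riemannian volume. -/
lemma memLpLocOn_tensorComp (hV : IsSmoothHermitian (m := m) F (V := V))
    (he : e ∈ IsManifold.maximalAtlas (𝓡 m) ∞ M) (hfr : IsSmoothFrameOn (m := m) F fr e.source)
    {j : ℕ} {T : TensorField (m := m) V j} (hT : IsBorelTensor F T) {p : ℝ≥0∞}
    (hp : ∀ K : Set M, IsCompact K →
      MemLp (fun x => tensorNorm (fun v => T x v)) p ((volG (m := m) M).restrict K)) (κ : Idx m ℓ j) :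
    MemLpLocOn p e.target (fun y => tensorComp e fr (fun x v => T x v) κ (e.symm y)) := by
  intro K hK hKe
  obtain ⟨C, hC, -, hle⟩ := exists_measure_bounds he hK hKe
  have hL : IsCompact (e.symm '' K) := hK.image_of_continuousOn (e.continuousOn_symm.mono hKe)
  have hLe : e.symm '' K ⊆ e.source := by
    rintro _ ⟨y, hy, rfl⟩; exact e.map_target (hKe hy)
  obtain ⟨B, -, hB⟩ := exists_bound_tensorNorm hV he hfr hL hLe j
  have hm : AEStronglyMeasurable (tensorComp e fr (fun x v => T x v) κ)
      ((volG (m := m) M).restrict (e.symm '' K)) :=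
    (hT.aestronglyMeasurable_comp hV he hfr κ _).mono_measure (Measure.restrict_mono hLe le_rfl)
  have h1 : MemLp (tensorComp e fr (fun x v => T x v) κ) p
      ((volG (m := m) M).restrict (e.symm '' K)) := by
    refine (hp _ hL).of_le_mul (c := B) hm ?_
    filter_upwards [ae_restrict_mem hL.isClosed.measurableSet] with x hx
    rw [Real.norm_of_nonneg (tensorNorm_nonneg _)]
    exact (hB x hx T).2 κ
  have h2 := (h1.smul_measure hC).mono_measure hle
  exact (memLp_map_measure_iff h2.1
    ((e.continuousOn_symm.mono hKe).aemeasurable hK.measurableSet)).1 h2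

end TestTensors

/-! ### Weak covariant derivatives as weak solutions of the first order system -/

section WeakTower

variable {m : ℕ} {M : Type*} [TopologicalSpace M] [T2Space M] [SecondCountableTopology M]
  [ChartedSpace (EuclideanSpace ℝ (Fin m)) M]
  [IsManifold (𝓡 m) ∞ M] [MeasurableSpace M] [BorelSpace M]
  {F : Type*} [NormedAddCommGroup F] [NormedSpace ℂ F] [FiniteDimensional ℂ F]
  {V : M → Type*} [TopologicalSpace (TotalSpace F V)]
  [∀ x, NormedAddCommGroup (V x)] [∀ x, InnerProductSpace ℂ (V x)] [FiberBundle F V]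
  [VectorBundle ℂ F V] [VectorBundle ℝ F V] [ContMDiffVectorBundle ∞ F V (𝓡 m)]
  [RiemannianBundle (fun x : M => TangentSpace (𝓡 m) x)]
  [IsContMDiffRiemannianBundle (𝓡 m) ∞ (EuclideanSpace ℝ (Fin m))
      (fun x : M => TangentSpace (𝓡 m) x)]
  {cov : CovariantDerivative (𝓡 m) F V} [cov.ContMDiffCovariantDerivative ∞]
  {e : OpenPartialHomeomorph M (EuclideanSpace ℝ (Fin m))} {ℓ : ℕ}
  {fr : Fin ℓ → Π x : M, V x}

/-- `IsWeakCovDeriv` speaks only about pairs consisting of a test tensor and its formal adjoint, so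
the adjoint has to be exhibited. Repeated integration by parts in the chart shows that it is the
test section built from `adj`. -/
lemma isFormalAdjoint_testTensor (hcov : IsComplexLinear cov)
    (hV : IsSmoothHermitian (m := m) F (V := V))
    (he : e ∈ IsManifold.maximalAtlas (𝓡 m) ∞ M) (hfr : IsSmoothFrameOn (m := m) F fr e.source)
    {j : ℕ} {η : Idx m ℓ j → EuclideanSpace ℝ (Fin m) → ℂ} (hη : ∀ κ, IsTest e.target (η κ)) :
    IsFormalAdjoint cov j (testTensor e fr η)
      (fun x => testTensor e fr (adj (chartCoefs cov e fr) j η) x 0) := by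
  intro φ hφ
  have hQ := fun j i κ κ' => contDiffOn_chartCoefs (cov := cov) hV he hfr j i κ κ'
  have hη' := IsTest.adj e.open_target hQ hη
  have htow := isTower_derivComps hcov hV he hfr hφ
  obtain ⟨T, hT, hTe⟩ := exists_tensorField_iterCovDeriv cov hφ j
  obtain ⟨T0, hT0, hT0e⟩ := exists_tensorField_iterCovDeriv cov hφ 0
  have h : iterCovDeriv cov φ j = fun x v => T x v := funext fun x => (hTe x).symm
  have h0 : iterCovDeriv cov φ 0 = fun x v => T0 x v := funext fun x => (hT0e x).symm
  have h1 := integral_tensorInner_testTensor hV he hfr hη hT.isSmoothTensor.isBorelTensor fun κ => by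
    have := htow.smooth j κ
    unfold derivComps at this
    rw [h] at this
    exact MemLpLocOn.of_continuousOn this.continuousOn
  have h2 := integral_tensorInner_testTensor hV he hfr hη' hT0.isSmoothTensor.isBorelTensor
    fun κ => by
      have := htow.smooth 0 κ
      unfold derivComps at this
      rw [h0] at this
      exact MemLpLocOn.of_continuousOn this.continuousOn
  have h3 := htow.sum_integral_adj e.open_target hQ hη
  unfold derivComps at h3
  rw [h, h0] at h3
  rw [h, h1, h3, ← h2]
  refine integral_congr_ae (Filter.Eventually.of_forall fun x => ?_)
  simp only
  rw [tensorInner_zero_index _ _ 0]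
  exact congrArg (inner ℂ _) (congrFun (hT0e x) 0).symm

/-- Sections and their weak covariant derivatives up to order `s`, all of them in `L^p_loc`. -/
structure IsCovJet (cov : CovariantDerivative (𝓡 m) F V) (s : ℕ) (p : ℝ≥0∞) (f : Π x : M, V x)
    (g : ∀ j, TensorField (m := m) V j) : Prop where
  isBorelSection : IsBorelSection F f
  zero : g 0 = constTensor f
  isWeakCovDeriv : ∀ j ∈ Finset.Icc 1 s, IsWeakCovDeriv cov j f (g j)
  memLp : ∀ j ≤ s, ∀ K : Set M, IsCompact K →
    MemLp (fun x => tensorNorm (fun v => g j x v)) p ((volG (m := m) M).restrict K)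

variable {s : ℕ} {p : ℝ≥0∞} {f : Π x : M, V x} {g : ∀ j, TensorField (m := m) V j}

lemma IsCovJet.isBorelTensor (h : IsCovJet cov s p f g) {j : ℕ} (hj : j ≤ s) :
    IsBorelTensor F (g j) := by
  rcases Nat.eq_zero_or_pos j with rfl | hj0
  · rw [h.zero]
    exact fun _ _ => h.isBorelSection
  · exact (h.isWeakCovDeriv j (Finset.mem_Icc.2 ⟨hj0, hj⟩)).2.2.1

/-- The components of a section and of its weak covariant derivatives. -/
noncomputable def jetComps (e : OpenPartialHomeomorph M (EuclideanSpace ℝ (Fin m)))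
    (fr : Fin ℓ → Π x : M, V x) (g : ∀ j, TensorField (m := m) V j) : Comps m ℓ :=
  fun j κ y => tensorComp e fr (fun x v => g j x v) κ (e.symm y)

lemma memLp_one_of_locallyIntegrable {f : M → ℝ} (h : LocallyIntegrable f (volG (m := m) M))
    {K : Set M} (hK : IsCompact K) : MemLp f 1 ((volG (m := m) M).restrict K) :=
  memLp_one_iff_integrable.2 (h.integrableOn_isCompact hK)

/-- Tested with tensors supported in the chart, the distributional identities become the integrated
form of the system, which `IsWeakTower.of_adj` splits into single steps. -/
theorem IsCovJet.isWeakTower (h : IsCovJet cov s p f g) (hcov : IsComplexLinear cov)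
    (hV : IsSmoothHermitian (m := m) F (V := V)) (hp : 1 ≤ p)
    (he : e ∈ IsManifold.maximalAtlas (𝓡 m) ∞ M) (hfr : IsSmoothFrameOn (m := m) F fr e.source) :
    IsWeakTower e.target (chartCoefs cov e fr) s p (jetComps e fr g) := by
  have hQ := fun j i κ κ' => contDiffOn_chartCoefs (cov := cov) hV he hfr j i κ κ'
  refine IsWeakTower.of_adj e.open_target hQ hp
    (fun j hj κ => memLpLocOn_tensorComp hV he hfr (h.isBorelTensor hj) (h.memLp j hj) κ) ?_
  intro j hj η hη
  rcases Nat.eq_zero_or_pos j with rfl | hj0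
  · rfl
  obtain ⟨-, hf, hgb, hgi, hw⟩ := h.isWeakCovDeriv j (Finset.mem_Icc.2 ⟨hj0, hj⟩)
  have hη' := IsTest.adj e.open_target hQ hη
  have h1 := integral_tensorInner_testTensor hV he hfr hη hgb
    (memLpLocOn_tensorComp hV he hfr hgb fun K hK => memLp_one_of_locallyIntegrable hgi hK)
  have hb0 := h.isBorelTensor (Nat.zero_le s)
  have h2 := integral_tensorInner_testTensor hV he hfr hη' hb0
    (memLpLocOn_tensorComp hV he hfr hb0 fun K hK => by
      rw [h.zero]
      simp only [tensorNorm_constTensor]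
      exact memLp_one_of_locallyIntegrable hf hK)
  have hsm : IsSmoothSection (m := m) F
      (fun x => testTensor e fr (adj (chartCoefs cov e fr) j η) x 0) := by
    have := isSmoothTensor_testTensor hV he hfr hη' (fun k => k.elim0) fun k => k.elim0
    convert this using 4
  have h3 := hw _ _ (isSmoothTensor_testTensor hV he hfr hη) (hasCompactSupp_testTensor hη)
    hsm ?_ (isFormalAdjoint_testTensor hcov hV he hfr hη)
  · unfold jetComps
    refine h1.symm.trans (h3.symm.trans (Eq.trans ?_ h2))
    refine integral_congr_ae (Filter.Eventually.of_forall fun x => ?_)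
    simp only
    rw [tensorInner_zero_index _ _ 0, h.zero]
    rfl
  · obtain ⟨K, hK, h0⟩ := hasCompactSupp_testTensor (V := V) (fr := fr) hη'
    refine ⟨K, hK, fun x hx => ?_⟩
    simp only [h0 x hx, zero_apply]

theorem IsCovJet.memSobolevLoc (h : IsCovJet cov s p f g) (hcov : IsComplexLinear cov)
    (hV : IsSmoothHermitian (m := m) F (V := V)) (hp : 1 ≤ p) :
    MemSobolevLoc (m := m) F s p f := by
  refine ⟨h.isBorelSection, fun e he ℓ fr hfr c hc a => ?_⟩
  have hQ := fun j i κ κ' => contDiffOn_chartCoefs (cov := cov) hV he hfr j i κ κ'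
  have h1 := ((h.isWeakTower hcov hV hp he hfr).sob e.open_target hQ hp s 0 (by omega)
    (fun k => k.elim0, a)).memSobolevLocOn
  -- The prescribed coefficients are forced on the source of the chart, where the dual frame
  -- recovers them.
  have h2 : ∀ y ∈ e.target, c a (e.symm y) = jetComps e fr g 0 (fun k => k.elim0, a) y := by
    intro y hy
    have hx := e.map_target hy
    simp only [jetComps, tensorComp, h.zero, constTensor_apply]
    rw [hc _ hx, hfr.inner_dualFrame_sum hx (fun a => c a (e.symm y))]
  refine ⟨h1.1.congr ?_, fun k hk α => ?_⟩
  · exact Filter.Eventually.of_forall fun y hy => (h2 y hy).symm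
  · obtain ⟨v, hv, hv'⟩ := h1.2 k hk α
    refine ⟨v, hv, fun η hη hηc hηs => ?_⟩
    rw [← hv' η hη hηc hηs]
    refine integral_congr_ae (Filter.Eventually.of_forall fun y => ?_)
    by_cases hy : y ∈ e.target
    · simp only [h2 y hy]
    · have : partialDeriv α η y = 0 := by
        by_contra h3
        exact hy (hηs (tsupport_partialDeriv_subset α η (subset_tsupport _ h3)))
      simp [this]

lemma MemCovSobolevLoc.exists_isCovJet (h : MemCovSobolevLoc cov s p f) :
    ∃ g, IsCovJet cov s p f g := by
  classical
  obtain ⟨hb, hf, hg⟩ := h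
  choose! g hg hg' using hg
  -- The choice function carries information only for `1 ≤ j ≤ s`; order zero is filled with `f`
  -- itself.
  refine ⟨fun j => if h : j = 0 then h ▸ constTensor f else g j, hb, rfl, fun j hj => ?_,
    fun j hj K hK => ?_⟩
  · have : j ≠ 0 := by have := (Finset.mem_Icc.1 hj).1; omega
    simp only [this, dif_neg, not_false_eq_true]
    exact hg j hj
  · by_cases h0 : j = 0
    · subst h0
      simp only [dif_pos]
      simp only [tensorNorm_constTensor]
      exact hf K hK
    · simp only [h0, dif_neg, not_false_eq_true]
      exact hg' j (Finset.mem_Icc.2 ⟨by omega, hj⟩) K hK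

lemma MemCovSobolev.memCovSobolevLoc (h : MemCovSobolev cov s p f) : MemCovSobolevLoc cov s p f :=
  ⟨h.1, fun _ _ => h.2.1.restrict _, fun j hj => by
    obtain ⟨g, hg, hg'⟩ := h.2.2 j hj
    exact ⟨g, hg, fun _ _ => hg'.restrict _⟩⟩

end WeakTower


section IteratedDerivatives

variable {m : ℕ} {M : Type*} [TopologicalSpace M] [T2Space M]
  [ChartedSpace (EuclideanSpace ℝ (Fin m)) M] [IsManifold (𝓡 m) ∞ M]
  {F : Type*} [NormedAddCommGroup F] [NormedSpace ℂ F]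
  {V : M → Type*} [TopologicalSpace (TotalSpace F V)]
  [∀ x, NormedAddCommGroup (V x)] [∀ x, InnerProductSpace ℂ (V x)] [FiberBundle F V]
  [VectorBundle ℂ F V] [VectorBundle ℝ F V] [ContMDiffVectorBundle ∞ F V (𝓡 m)]
  [RiemannianBundle (fun x : M => TangentSpace (𝓡 m) x)]
  [IsContMDiffRiemannianBundle (𝓡 m) ∞ (EuclideanSpace ℝ (Fin m))
      (fun x : M => TangentSpace (𝓡 m) x)]
  {cov : CovariantDerivative (𝓡 m) F V} [cov.ContMDiffCovariantDerivative ∞]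
  {u w : Π x : M, V x}

/-! ### Iterated covariant derivatives of smooth sections -/

variable (cov) in
/-- The iterated covariant derivative of a smooth section as a tensor field. -/
noncomputable def derivTensor (hu : IsSmoothSection (m := m) F u) (j : ℕ) :
    TensorField (m := m) V j :=
  (exists_tensorField_iterCovDeriv cov hu j).choose

lemma isLocSmoothTensor_derivTensor (hu : IsSmoothSection (m := m) F u) (j : ℕ) :
    IsLocSmoothTensor F (derivTensor cov hu j) :=
  (exists_tensorField_iterCovDeriv cov hu j).choose_spec.1

lemma derivTensor_eq (hu : IsSmoothSection (m := m) F u) (j : ℕ) :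
    iterCovDeriv cov u j = fun x v => derivTensor cov hu j x v :=
  funext fun x => ((exists_tensorField_iterCovDeriv cov hu j).choose_spec.2 x).symm

lemma derivTensor_zero (hu : IsSmoothSection (m := m) F u) :
    derivTensor cov hu 0 = constTensor u := by
  funext x
  ext v
  exact (congrFun (congrFun (derivTensor_eq (cov := cov) hu 0) x) v).symm

lemma diffSectionAt_iterCovDeriv (hu : IsSmoothSection (m := m) F u) (j : ℕ)
    {X : Fin j → Π x : M, TangentSpace (𝓡 m) x} {x : M} (hX : ∀ k, DiffVFAt (X k) x) :
    DiffSectionAt m F (fun y => iterCovDeriv cov u j y fun k => X k y) x := by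
  rw [derivTensor_eq hu]
  exact (isLocSmoothTensor_derivTensor hu j).diff_apply hX

lemma IsSmoothSection.sub (hu : IsSmoothSection (m := m) F u) (hw : IsSmoothSection (m := m) F w) :
    IsSmoothSection (m := m) F (fun x => u x - w x) := ContMDiff.sub_section hu hw

lemma IsSmoothSection.sum {ι : Type*} {s : Finset ι} {u : ι → Π x : M, V x}
    (hu : ∀ i ∈ s, IsSmoothSection (m := m) F (u i)) :
    IsSmoothSection (m := m) F (fun x => ∑ i ∈ s, u i x) := ContMDiff.sum_section hu

lemma IsSmoothSection.zero : IsSmoothSection (m := m) F (fun x => (0 : V x)) :=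
  contMDiff_zeroSection ℝ V

lemma IsSmoothSection.smul {θ : M → ℝ} (hθ : ContMDiff (𝓡 m) 𝓘(ℝ, ℝ) ∞ θ)
    (hu : IsSmoothSection (m := m) F u) : IsSmoothSection (m := m) F (fun x => θ x • u x) :=
  ContMDiff.smul_section hθ hu

/-- Additivity of the connection holds for differentiable sections; smoothness of `u` and `w`
guarantees it at every stage of the iteration. -/
lemma iterCovDeriv_add (hu : IsSmoothSection (m := m) F u) (hw : IsSmoothSection (m := m) F w)
    (j : ℕ) : iterCovDeriv cov (fun x => u x + w x) j
      = fun x v => iterCovDeriv cov u j x v + iterCovDeriv cov w j x v := by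
  induction j with
  | zero => rfl
  | succ j ih =>
    funext x v
    simp only [iterCovDeriv, ih, covDerivTensor]
    rw [cov_add (diffSectionAt_iterCovDeriv hu j fun k => diffVFAt_extend _)
      (diffSectionAt_iterCovDeriv hw j fun k => diffVFAt_extend _), Finset.sum_add_distrib,
      add_apply]
    abel

lemma iterCovDeriv_zero (j : ℕ) (x : M) (v : Fin j → TangentSpace (𝓡 m) x) :
    iterCovDeriv cov (fun x => (0 : V x)) j x v = 0 := by
  have h := iterCovDeriv_add (cov := cov) IsSmoothSection.zero IsSmoothSection.zero j
  simp only [add_zero] at h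
  simpa using congrFun (congrFun h x) v

lemma iterCovDeriv_sub (hu : IsSmoothSection (m := m) F u) (hw : IsSmoothSection (m := m) F w)
    (j : ℕ) (x : M) (v : Fin j → TangentSpace (𝓡 m) x) :
    iterCovDeriv cov (fun x => u x - w x) j x v
      = iterCovDeriv cov u j x v - iterCovDeriv cov w j x v := by
  have h := congrFun (congrFun (iterCovDeriv_add (cov := cov) (hu.sub hw) hw j) x) v
  simp only [sub_add_cancel] at h
  rw [h, add_sub_cancel_right]

lemma iterCovDeriv_sum {ι : Type*} (s : Finset ι) {u : ι → Π x : M, V x}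
    (hu : ∀ i ∈ s, IsSmoothSection (m := m) F (u i)) (j : ℕ) (x : M)
    (v : Fin j → TangentSpace (𝓡 m) x) :
    iterCovDeriv cov (fun x => ∑ i ∈ s, u i x) j x v = ∑ i ∈ s, iterCovDeriv cov (u i) j x v := by
  classical
  induction s using Finset.induction_on with
  | empty => simp only [Finset.sum_empty]; exact iterCovDeriv_zero j x v
  | insert a s ha ih =>
    simp only [Finset.mem_insert, forall_eq_or_imp] at hu
    simp only [Finset.sum_insert ha, ← ih hu.2]
    exact congrFun (congrFun (iterCovDeriv_add hu.1 (IsSmoothSection.sum hu.2) j) x) v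

/-- The conclusion is kept on a neighbourhood and not only at `x`, since the induction
differentiates again. -/
lemma iterCovDeriv_congr (hu : IsSmoothSection (m := m) F u) {x : M}
    (h : ∀ᶠ y in 𝓝 x, u y = w y) (j : ℕ) :
    ∀ᶠ y in 𝓝 x, iterCovDeriv cov u j y = iterCovDeriv cov w j y := by
  induction j with
  | zero => filter_upwards [h] with y hy; simp only [iterCovDeriv, hy]
  | succ j ih =>
    filter_upwards [ih.eventually_nhds] with y hy
    funext v
    simp only [iterCovDeriv, covDerivTensor]
    rw [cov_congr (diffSectionAt_iterCovDeriv hu j fun k => diffVFAt_extend _)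
      (hy.mono fun z hz => by rw [hz]), hy.self_of_nhds]

lemma tensorNorm_zero {j : ℕ} {x : M} :
    tensorNorm (fun _ : Fin j → TangentSpace (𝓡 m) x => (0 : V x)) = 0 := by
  simp [tensorNorm]

lemma tensorNorm_sum_le {j : ℕ} {x : M} {ι : Type*} (s : Finset ι)
    (A : ι → (Fin j → TangentSpace (𝓡 m) x) → V x) :
    tensorNorm (fun v => ∑ i ∈ s, A i v) ≤ ∑ i ∈ s, tensorNorm (A i) := by
  classical
  induction s using Finset.induction_on with
  | empty => simp only [Finset.sum_empty, tensorNorm_zero, le_refl]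
  | insert a s ha ih =>
    simp only [Finset.sum_insert ha]
    exact (tensorNorm_add_le _ _).trans (add_le_add le_rfl ih)

/-- Multiplication with a smooth function is a bounded operation on derivatives up to order `j`. -/
lemma exists_bound_iterCovDeriv_smul (hcov : IsComplexLinear cov)
    (hV : IsSmoothHermitian (m := m) F (V := V))
    {e : OpenPartialHomeomorph M (EuclideanSpace ℝ (Fin m))} {ℓ : ℕ} {fr : Fin ℓ → Π x : M, V x}
    (he : e ∈ IsManifold.maximalAtlas (𝓡 m) ∞ M) (hfr : IsSmoothFrameOn (m := m) F fr e.source)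
    {θ : M → ℝ} (hθ : ContMDiff (𝓡 m) 𝓘(ℝ, ℝ) ∞ θ) {K : Set M} (hK : IsCompact K)
    (hKe : K ⊆ e.source) (j : ℕ) :
    ∃ C : ℝ, 0 ≤ C ∧ ∀ w : Π x : M, V x, IsSmoothSection (m := m) F w → ∀ x ∈ K,
      tensorNorm (iterCovDeriv cov (fun x => θ x • w x) j x)
        ≤ C * ∑ j' ∈ Finset.range (j + 1), tensorNorm (iterCovDeriv cov w j' x) := by
  have hL : IsCompact (e '' K) := hK.image_of_continuousOn (e.continuousOn.mono hKe)
  have hLe : e '' K ⊆ e.target := by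
    rintro _ ⟨x, hx, rfl⟩; exact e.map_source (hKe hx)
  have hQ := fun j i κ κ' => contDiffOn_chartCoefs (cov := cov) hV he hfr j i κ κ'
  obtain ⟨C, hC, hCb⟩ := exists_bound_tower_mul e.open_target hQ
    (contDiffOn_comp_symm he (contMDiffOn_ofReal hθ.contMDiffOn)) hL hLe j
  choose B hB hBb using exists_bound_tensorNorm hV he hfr hK hKe
  have hD : 0 ≤ ∑ j' ∈ Finset.range (j + 1), Fintype.card (Idx m ℓ j') * B j' :=
    Finset.sum_nonneg fun j' _ => mul_nonneg (Nat.cast_nonneg _) (hB j')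
  set D := ∑ j' ∈ Finset.range (j + 1), Fintype.card (Idx m ℓ j') * B j' with hDdef
  -- `B j` passes from components to the norm at order `j`, `C` is the bound for multiplication in
  -- components, and `D` returns from components to norms at all orders up to `j`; the cardinality
  -- counts the components.
  refine ⟨B j * (Fintype.card (Idx m ℓ j) * (C * D)), mul_nonneg (hB j)
    (mul_nonneg (Nat.cast_nonneg _) (mul_nonneg hC hD)), fun w hw x hx => ?_⟩
  have hθw := IsSmoothSection.smul hθ hw
  have h1 := hCb _ _ (isTower_derivComps hcov hV he hfr hw) (isTower_derivComps hcov hV he hfr hθw)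
    (fun κ y _ => by
      simp only [derivComps, tensorComp, iterCovDeriv]
      rw [← Complex.coe_smul, inner_smul_right])
  have hex : e.symm (e x) = x := e.left_inv (hKe hx)
  have hcomp : ∀ (u : Π x : M, V x) (hu : IsSmoothSection (m := m) F u) (j' : ℕ) (κ : Idx m ℓ j'),
      derivComps cov e fr u j' κ (e x)
        = tensorComp e fr (fun x v => derivTensor cov hu j' x v) κ x := by
    intro u hu j' κ
    rw [derivComps, hex, derivTensor_eq hu]
  have h2 : ∀ j', ∑ κ' : Idx m ℓ j', ‖derivComps cov e fr w j' κ' (e x)‖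
      ≤ Fintype.card (Idx m ℓ j') * B j' * tensorNorm (iterCovDeriv cov w j' x) := by
    intro j'
    calc _ ≤ ∑ κ' : Idx m ℓ j', B j' * tensorNorm (iterCovDeriv cov w j' x) := by
          refine Finset.sum_le_sum fun κ' _ => ?_
          rw [hcomp w hw, derivTensor_eq hw]
          exact (hBb j' x hx (derivTensor cov hw j')).2 κ'
      _ = _ := by rw [Finset.sum_const, Finset.card_univ, nsmul_eq_mul, mul_assoc]
  have h3 : ∑ j' ∈ Finset.range (j + 1), ∑ κ' : Idx m ℓ j', ‖derivComps cov e fr w j' κ' (e x)‖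
      ≤ D * ∑ j' ∈ Finset.range (j + 1), tensorNorm (iterCovDeriv cov w j' x) := by
    rw [Finset.mul_sum]
    refine Finset.sum_le_sum fun j' hj' => (h2 j').trans ?_
    refine mul_le_mul_of_nonneg_right ?_ (tensorNorm_nonneg _)
    exact Finset.single_le_sum
      (f := fun j' => (Fintype.card (Idx m ℓ j') : ℝ) * B j')
      (fun j' _ => mul_nonneg (Nat.cast_nonneg _) (hB j')) hj'
  calc _ ≤ B j * ∑ κ : Idx m ℓ j, ‖derivComps cov e fr (fun x => θ x • w x) j κ (e x)‖ := by
        simp only [hcomp _ hθw]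
        rw [derivTensor_eq hθw]
        exact (hBb j x hx (derivTensor cov hθw j)).1
    _ ≤ B j * ∑ _κ : Idx m ℓ j, C * (D * ∑ j' ∈ Finset.range (j + 1),
          tensorNorm (iterCovDeriv cov w j' x)) := by
        refine mul_le_mul_of_nonneg_left (Finset.sum_le_sum fun κ _ => ?_) (hB j)
        exact (h1 κ (e x) ⟨x, hx, rfl⟩).trans (mul_le_mul_of_nonneg_left h3 hC)
    _ = _ := by rw [Finset.sum_const, Finset.card_univ, nsmul_eq_mul]; ring

end IteratedDerivatives

section SmoothMembership

variable {m : ℕ} {M : Type*} [TopologicalSpace M] [T2Space M] [SecondCountableTopology M]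
  [ChartedSpace (EuclideanSpace ℝ (Fin m)) M]
  [IsManifold (𝓡 m) ∞ M] [MeasurableSpace M] [BorelSpace M]
  {F : Type*} [NormedAddCommGroup F] [NormedSpace ℂ F] [FiniteDimensional ℂ F]
  {V : M → Type*} [TopologicalSpace (TotalSpace F V)]
  [∀ x, NormedAddCommGroup (V x)] [∀ x, InnerProductSpace ℂ (V x)] [FiberBundle F V]
  [VectorBundle ℂ F V] [VectorBundle ℝ F V] [ContMDiffVectorBundle ∞ F V (𝓡 m)]
  [RiemannianBundle (fun x : M => TangentSpace (𝓡 m) x)]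
  [IsContMDiffRiemannianBundle (𝓡 m) ∞ (EuclideanSpace ℝ (Fin m))
      (fun x : M => TangentSpace (𝓡 m) x)]
  {cov : CovariantDerivative (𝓡 m) F V} [cov.ContMDiffCovariantDerivative ∞]
  {u f : Π x : M, V x}

/-! ### Weak derivatives of smooth sections -/

lemma isBorelTensor_derivTensor (hu : IsSmoothSection (m := m) F u) (j : ℕ) :
    IsBorelTensor F (derivTensor cov hu j) :=
  (isLocSmoothTensor_derivTensor hu j).isSmoothTensor.isBorelTensor

lemma integrable_tensorInner (hV : IsSmoothHermitian (m := m) F (V := V)) {j : ℕ}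
    {S T : TensorField (m := m) V j} (hS : IsSmoothTensor F S) (hSc : HasCompactSupp S)
    (hT : IsBorelTensor F T)
    (hTl : LocallyIntegrable (fun x => tensorNorm (T x)) (volG (m := m) M)) :
    Integrable (fun x => tensorInner (fun v => S x v) (fun v => T x v)) (volG (m := m) M) := by
  obtain ⟨K, hK, h0⟩ := hSc
  obtain ⟨C, hC⟩ := hK.bddAbove_image (hS.isLocSmoothTensor.continuous_tensorNorm hV).continuousOn
  have hm := hS.isBorelTensor.aestronglyMeasurable_tensorInner hV hT (volG (m := m) M)
  have h1 : IntegrableOn (fun x => tensorInner (fun v => S x v) (fun v => T x v)) K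
      (volG (m := m) M) := by
    refine Integrable.mono' ((hTl.integrableOn_isCompact hK).const_mul C) hm.restrict ?_
    filter_upwards [ae_restrict_mem hK.isClosed.measurableSet] with x hx
    exact (norm_tensorInner_le _ _).trans
      (mul_le_mul_of_nonneg_right (hC ⟨x, hx, rfl⟩) (tensorNorm_nonneg _))
  refine (integrableOn_iff_integrable_of_support_subset (s := K) fun x hx => ?_).1 h1
  by_contra hxK
  refine hx ?_
  simp [tensorInner, h0 x hxK]

/-- `IsFormalAdjoint` is tested with arbitrary smooth sections, compactly supported or not, so `u`
itself is admissible and the integral identity is immediate. -/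
lemma isWeakCovDeriv_derivTensor (hV : IsSmoothHermitian (m := m) F (V := V))
    (hu : IsSmoothSection (m := m) F u) (j : ℕ) :
    IsWeakCovDeriv cov j u (derivTensor cov hu j) := by
  have := isLocallyFiniteMeasure_volG (m := m) (M := M)
  have hc : ∀ j, Continuous fun x => tensorNorm (derivTensor cov hu j x) := fun j =>
    (isLocSmoothTensor_derivTensor hu j).continuous_tensorNorm hV
  have hc0 := hc 0
  rw [derivTensor_zero] at hc0
  refine ⟨hu.isBorelSection, ?_, isBorelTensor_derivTensor hu j, (hc j).locallyIntegrable, ?_⟩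
  · exact (hc0.congr fun x => tensorNorm_constTensor u x).locallyIntegrable
  · intro ψ χ _ _ _ _ h
    rw [h u hu, derivTensor_eq hu]

lemma isBorelTensor_constTensor (hf : IsBorelSection F f) :
    IsBorelTensor F (constTensor (m := m) f) := fun _ _ => hf

lemma isSmoothTensor_constTensor (hf : IsSmoothSection (m := m) F f) :
    IsSmoothTensor F (constTensor (m := m) f) := fun _ _ => hf

lemma integrable_inner (hV : IsSmoothHermitian (m := m) F (V := V)) {χ : Π x : M, V x}
    (hχ : IsSmoothSection (m := m) F χ) (hχc : HasCompactSupp χ) (hf : IsBorelSection F f)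
    (hfl : LocallyIntegrable (fun x => ‖f x‖) (volG (m := m) M)) :
    Integrable (fun x => inner ℂ (χ x) (f x)) (volG (m := m) M) := by
  obtain ⟨K, hK, h0⟩ := hχc
  have h := integrable_tensorInner hV (isSmoothTensor_constTensor hχ)
    ⟨K, hK, fun x hx => by ext v; simp [constTensor_apply, h0 x hx]⟩
    (isBorelTensor_constTensor (m := m) hf)
    (hfl.congr (Filter.Eventually.of_forall fun x => (tensorNorm_constTensor f x).symm))
  refine h.congr (Filter.Eventually.of_forall fun x => ?_)
  simp only
  rw [tensorInner_zero_index _ _ 0]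
  rfl

lemma IsWeakCovDeriv.smooth_sub (hV : IsSmoothHermitian (m := m) F (V := V)) {j : ℕ}
    {g : TensorField (m := m) V j} (hu : IsSmoothSection (m := m) F u)
    (h : IsWeakCovDeriv cov j f g) :
    IsWeakCovDeriv cov j (fun x => u x - f x) (fun x => derivTensor cov hu j x - g x) := by
  obtain ⟨hub, hul, hTb, hTl, hu'⟩ := isWeakCovDeriv_derivTensor (cov := cov) hV hu j
  obtain ⟨hfb, hfl, hgb, hgl, hf'⟩ := h
  have hb := hfb.smooth_sub hu
  have hb' := hgb.smooth_sub (isLocSmoothTensor_derivTensor (cov := cov) hu j).isSmoothTensor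
  refine ⟨hb, (hul.add hfl).mono ?_ (Filter.Eventually.of_forall fun x => ?_), hb',
    (hTl.add hgl).mono (hb'.aestronglyMeasurable_tensorNorm hV _)
      (Filter.Eventually.of_forall fun x => ?_), fun ψ χ hψ hψc hχ hχc hadj => ?_⟩
  · exact ((isBorelTensor_constTensor (m := m) hb).aestronglyMeasurable_tensorNorm hV _).congr
      (Filter.Eventually.of_forall fun x => tensorNorm_constTensor _ x)
  · simp only [Pi.add_apply]
    rw [norm_norm, Real.norm_of_nonneg (by positivity)]
    exact norm_sub_le _ _
  · simp only [Pi.add_apply]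
    rw [Real.norm_of_nonneg (tensorNorm_nonneg _),
      Real.norm_of_nonneg (add_nonneg (tensorNorm_nonneg _) (tensorNorm_nonneg _))]
    exact tensorNorm_sub_le _ _
  · have h1 := hu' ψ χ hψ hψc hχ hχc hadj
    have h2 := hf' ψ χ hψ hψc hχ hχc hadj
    simp only [inner_sub_right]
    rw [integral_sub (integrable_inner hV hχ hχc hub hul) (integrable_inner hV hχ hχc hfb hfl),
      h1, h2, ← integral_sub (integrable_tensorInner hV hψ hψc hTb hTl)
        (integrable_tensorInner hV hψ hψc hgb hgl)]
    exact integral_congr_ae (Filter.Eventually.of_forall fun x =>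
      (tensorInner_sub_right _ _ _).symm)

/-- The pointwise distance of the `j`-th derivative of a section from a tensor field. -/
noncomputable def derivDist (cov : CovariantDerivative (𝓡 m) F V) (g : ∀ j, TensorField (m := m) V j)
    (u : Π x : M, V x) (j : ℕ) (x : M) : ℝ :=
  tensorNorm (fun v => iterCovDeriv cov u j x v - g j x v)

variable {g : ∀ j, TensorField (m := m) V j} {s : ℕ} {p : ℝ≥0∞}

lemma derivDist_nonneg (j : ℕ) (x : M) : 0 ≤ derivDist cov g u j x := tensorNorm_nonneg _

lemma derivDist_eq (hu : IsSmoothSection (m := m) F u) (j : ℕ) :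
    derivDist cov g u j = fun x => tensorNorm (fun v => (derivTensor cov hu j x - g j x) v) := by
  funext x
  rw [derivDist, derivTensor_eq hu]
  rfl

lemma IsCovJet.aestronglyMeasurable_derivDist (h : IsCovJet cov s p f g)
    (hV : IsSmoothHermitian (m := m) F (V := V)) (hu : IsSmoothSection (m := m) F u) {j : ℕ}
    (hj : j ≤ s) (μ : Measure M) : AEStronglyMeasurable (derivDist cov g u j) μ := by
  rw [derivDist_eq hu]
  exact IsBorelTensor.aestronglyMeasurable_tensorNorm hV ((h.isBorelTensor hj).smooth_sub
    (isLocSmoothTensor_derivTensor (cov := cov) hu j).isSmoothTensor) μ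

/-- The infimum in `weakCovDerivNorm` is bounded by the candidate `∇^j u - g_j`, so uniqueness of
weak derivatives plays no role. -/
lemma IsCovJet.covSobolevNorm_sub_le (h : IsCovJet cov s p f g)
    (hV : IsSmoothHermitian (m := m) F (V := V)) (hu : IsSmoothSection (m := m) F u) :
    covSobolevNorm cov s p (u - f) ≤ (∑ j ∈ Finset.range (s + 1),
      eLpNorm (derivDist cov g u j) p (volG (m := m) M) ^ p.toReal) ^ (1 / p.toReal) := by
  have hsum : ∑ j ∈ Finset.range (s + 1), eLpNorm (derivDist cov g u j) p (volG (m := m) M) ^ p.toReal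
      = eLpNorm (derivDist cov g u 0) p (volG (m := m) M) ^ p.toReal
        + ∑ j ∈ Finset.Icc 1 s, eLpNorm (derivDist cov g u j) p (volG (m := m) M) ^ p.toReal := by
    rw [Finset.range_eq_Ico, Finset.sum_eq_sum_Ico_succ_bot (by omega)]
    rfl
  rw [hsum, covSobolevNorm]
  refine ENNReal.rpow_le_rpow (add_le_add (le_of_eq ?_) (Finset.sum_le_sum fun j hj => ?_))
    (by positivity)
  · congr 2
    funext x
    rw [derivDist, tensorNorm_zero_index _ 0, h.zero]
    rfl
  · refine ENNReal.rpow_le_rpow ?_ ENNReal.toReal_nonneg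
    rw [derivDist_eq hu]
    exact iInf₂_le_of_le _ ((h.isWeakCovDeriv j hj).smooth_sub hV hu) le_rfl

lemma memLp_restrict_of_continuous {φ : M → ℝ} (hφ : Continuous φ) {K : Set M} (hK : IsCompact K) :
    MemLp φ p ((volG (m := m) M).restrict K) := by
  have := isLocallyFiniteMeasure_volG (m := m) (M := M)
  have : IsFiniteMeasure ((volG (m := m) M).restrict K) := ⟨by simpa using hK.measure_lt_top⟩
  obtain ⟨C, hC⟩ := hK.exists_bound_of_continuousOn hφ.continuousOn
  exact MemLp.of_bound hφ.aestronglyMeasurable C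
    ((ae_restrict_iff' hK.isClosed.measurableSet).2 (Filter.Eventually.of_forall hC))

lemma memCovSobolevLoc_of_smooth (hV : IsSmoothHermitian (m := m) F (V := V))
    (hu : IsSmoothSection (m := m) F u) : MemCovSobolevLoc cov s p u := by
  have hc : ∀ j, Continuous fun x => tensorNorm (derivTensor cov hu j x) := fun j =>
    (isLocSmoothTensor_derivTensor hu j).continuous_tensorNorm hV
  have hc0 := hc 0
  rw [derivTensor_zero] at hc0
  exact ⟨hu.isBorelSection, fun _ => memLp_restrict_of_continuous
    (hc0.congr fun x => tensorNorm_constTensor u x),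
    fun j _ => ⟨_, isWeakCovDeriv_derivTensor hV hu j, fun _ => memLp_restrict_of_continuous (hc j)⟩⟩

/-- A smooth section whose derivatives are at finite `L^p` distance from `L^p` tensors has
derivatives in `L^p`. -/
lemma IsCovJet.memCovSobolev_of_smooth (h : IsCovJet cov s p f g)
    (hV : IsSmoothHermitian (m := m) F (V := V)) (hu : IsSmoothSection (m := m) F u)
    (hg : ∀ j ≤ s, MemLp (fun x => tensorNorm (fun v => g j x v)) p (volG (m := m) M))
    (hd : ∀ j ≤ s, eLpNorm (derivDist cov g u j) p (volG (m := m) M) ≠ ⊤) :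
    MemCovSobolev cov s p u := by
  have key : ∀ j ≤ s, MemLp (fun x => tensorNorm (derivTensor cov hu j x)) p (volG (m := m) M) := by
    intro j hj
    have h1 : MemLp (derivDist cov g u j) p (volG (m := m) M) :=
      ⟨h.aestronglyMeasurable_derivDist hV hu hj _, (hd j hj).lt_top⟩
    refine (h1.add (hg j hj)).mono
      ((isBorelTensor_derivTensor hu j).aestronglyMeasurable_tensorNorm hV _)
      (Filter.Eventually.of_forall fun x => ?_)
    simp only [Pi.add_apply]
    rw [Real.norm_of_nonneg (tensorNorm_nonneg _),
      Real.norm_of_nonneg (add_nonneg (derivDist_nonneg _ _) (tensorNorm_nonneg _)),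
      derivDist, derivTensor_eq hu]
    refine le_trans (le_of_eq ?_) (tensorNorm_add_le _ _)
    simp
  have h0 := key 0 (Nat.zero_le s)
  rw [derivTensor_zero] at h0
  exact ⟨hu.isBorelSection, (memLp_congr_ae (Filter.Eventually.of_forall
    fun x => tensorNorm_constTensor u x)).1 h0,
    fun j hj => ⟨_, isWeakCovDeriv_derivTensor hV hu j, key j (Finset.mem_Icc.1 hj).2⟩⟩

end SmoothMembership


section LocalApproximation

variable {m : ℕ} {M : Type*} [TopologicalSpace M] [T2Space M] [SecondCountableTopology M]
  [ChartedSpace (EuclideanSpace ℝ (Fin m)) M]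
  [IsManifold (𝓡 m) ∞ M] [MeasurableSpace M] [BorelSpace M]
  {F : Type*} [NormedAddCommGroup F] [NormedSpace ℂ F] [FiniteDimensional ℂ F]
  {V : M → Type*} [TopologicalSpace (TotalSpace F V)]
  [∀ x, NormedAddCommGroup (V x)] [∀ x, InnerProductSpace ℂ (V x)] [FiberBundle F V]
  [VectorBundle ℂ F V] [VectorBundle ℝ F V] [ContMDiffVectorBundle ∞ F V (𝓡 m)]
  [RiemannianBundle (fun x : M => TangentSpace (𝓡 m) x)]
  [IsContMDiffRiemannianBundle (𝓡 m) ∞ (EuclideanSpace ℝ (Fin m))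
      (fun x : M => TangentSpace (𝓡 m) x)]
  {cov : CovariantDerivative (𝓡 m) F V} [cov.ContMDiffCovariantDerivative ∞]
  {u f : Π x : M, V x}
  {g : ∀ j, TensorField (m := m) V j} {s : ℕ} {p : ℝ≥0∞}
  {e : OpenPartialHomeomorph M (EuclideanSpace ℝ (Fin m))} {ℓ : ℕ} {fr : Fin ℓ → Π x : M, V x}

/-! ### Approximation by smooth sections near a compact subset of a chart -/

-- Multiplication with a cutoff equal to `1` on the closure of `O` makes the section global and
-- leaves the prescribed components on `O` unchanged.
variable (cov) in
lemma exists_smoothSection_of_comps (he : e ∈ IsManifold.maximalAtlas (𝓡 m) ∞ M)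
    (hfr : IsSmoothFrameOn (m := m) F fr e.source) {O : Set (EuclideanSpace ℝ (Fin m))}
    (hO : IsCompact (closure O)) (hOe : closure O ⊆ e.target)
    {c : Idx m ℓ 0 → EuclideanSpace ℝ (Fin m) → ℂ} (hc : ∀ κ, ContDiff ℝ ∞ (c κ)) :
    ∃ u : Π x : M, V x, IsSmoothSection (m := m) F u ∧
      ∀ κ, ∀ y ∈ O, derivComps cov e fr u 0 κ y = c κ y := by
  obtain ⟨K', hK'c, hKK', hK'e⟩ := exists_compact_between hO e.open_target hOe
  obtain ⟨χ, h1, h0, -⟩ := exists_contMDiffMap_one_nhds_of_subset_interior (n := (⊤ : ℕ∞))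
    𝓘(ℝ, EuclideanSpace ℝ (Fin m)) isClosed_closure hKK'
  have hχ : ContDiff ℝ ∞ χ := contMDiff_iff_contDiff.1 χ.contMDiff
  have hK : IsCompact (e.symm '' K') :=
    hK'c.image_of_continuousOn (e.continuousOn_symm.mono hK'e)
  have hKe : e.symm '' K' ⊆ e.source := by
    rintro _ ⟨y, hy, rfl⟩; exact e.map_target (hK'e hy)
  set b : Fin ℓ → M → ℂ := fun a => e.source.indicator
    fun x => (χ (e x) : ℂ) * c (Fin.elim0, a) (e x) with hb
  have hbs : ∀ a, ∀ x ∈ e.source, b a x = (χ (e x) : ℂ) * c (Fin.elim0, a) (e x) :=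
    fun a x hx => Set.indicator_of_mem hx _
  refine ⟨fun x => ∑ a, b a x • fr a x, SmoothSectionOn.isSmoothSection e.open_source
    (SmoothSectionOn.sum fun a _ => SmoothSectionOn.smul ?_ (hfr.contMDiffOn a)) hK hKe
    fun x hx => Finset.sum_eq_zero fun a _ => ?_, fun κ y hy => ?_⟩
  · refine (contMDiffOn_comp_chart (c := fun y => (χ y : ℂ) * c (Fin.elim0, a) y) he
      ((Complex.ofRealCLM.contDiff.comp hχ).mul (hc _)).contDiffOn).congr fun x hx => ?_
    exact hbs a x hx
  · have : b a x = 0 := by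
      by_cases hxe : x ∈ e.source
      · rw [hbs a x hxe, h0 _ fun h => hx ⟨e x, h, e.left_inv hxe⟩]
        simp
      · exact Set.indicator_of_notMem hxe _
    rw [this, zero_smul]
  · have hyt : y ∈ e.target := hOe (subset_closure hy)
    have hx := e.map_target hyt
    have hχ1 : χ y = 1 := h1.self_of_nhdsSet _ (subset_closure hy)
    simp only [derivComps, tensorComp, iterCovDeriv]
    rw [hfr.inner_dualFrame_sum hx (fun a => b a (e.symm y)), hbs _ _ hx,
      e.right_inv hyt, hχ1, Complex.ofReal_one, one_mul]
    congr 1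
    exact Prod.ext (Subsingleton.elim _ _) rfl

/-- The sections whose components are the mollified components of `f` near `K` form towers, so their
derivatives of all orders converge in components; comparison of norms and measures on `K` carries
this over to the manifold. -/
lemma IsCovJet.exists_local_approx (h : IsCovJet cov s p f g) (hcov : IsComplexLinear cov)
    (hV : IsSmoothHermitian (m := m) F (V := V)) (hp : 1 ≤ p) (hp' : p ≠ ⊤)
    (he : e ∈ IsManifold.maximalAtlas (𝓡 m) ∞ M) (hfr : IsSmoothFrameOn (m := m) F fr e.source)
    {K : Set M} (hK : IsCompact K) (hKe : K ⊆ e.source) :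
    ∃ v : ℕ → Π x : M, V x, (∀ n, IsSmoothSection (m := m) F (v n)) ∧ ∀ j ≤ s,
      Filter.Tendsto (fun n => eLpNorm (derivDist cov g (v n) j) p ((volG (m := m) M).restrict K))
        Filter.atTop (𝓝 0) := by
  have hL : IsCompact (e '' K) := hK.image_of_continuousOn (e.continuousOn.mono hKe)
  have hLe : e '' K ⊆ e.target := by
    rintro _ ⟨x, hx, rfl⟩; exact e.map_source (hKe hx)
  have hKL : e.symm '' (e '' K) = K := by
    rw [Set.image_image]
    exact (Set.image_congr fun x hx => e.left_inv (hKe hx)).trans (Set.image_id' K)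
  have hQ := fun j i κ κ' => contDiffOn_chartCoefs (cov := cov) hV he hfr j i κ κ'
  have hw := h.isWeakTower hcov hV hp he hfr
  obtain ⟨O, c, hO, -, hOc, hOe, hc, hlim⟩ := hw.exists_approx e.open_target hp hp' hL hLe hQ
  choose v hv hvc using fun n => exists_smoothSection_of_comps cov he hfr hOc hOe (hc n)
  refine ⟨v, hv, fun j hj => ?_⟩
  have hlim' := hlim _ (fun n => isTower_derivComps hcov hV he hfr (hv n)) hvc j hj
  obtain ⟨C, hC, hle, -⟩ := exists_measure_bounds he hL hLe
  rw [hKL] at hle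
  obtain ⟨B, hB, hBb⟩ := exists_bound_tensorNorm hV he hfr hK hKe j
  have haem : AEMeasurable e.symm (volume.restrict (e '' K)) :=
    (e.continuousOn_symm.mono hLe).aemeasurable hL.measurableSet
  -- The constant `C` compares the volume with Lebesgue measure, hence enters with exponent `1/p`;
  -- `B` compares the tensor norm with the components, whose sum is split by Minkowski's inequality.
  have hbound : ∀ n, eLpNorm (derivDist cov g (v n) j) p ((volG (m := m) M).restrict K)
      ≤ C ^ (1 / p).toReal * (ENNReal.ofReal B *
        ∑ κ, eLpNorm (derivComps cov e fr (v n) j κ - jetComps e fr g j κ) p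
          (volume.restrict (e '' K))) := by
    intro n
    refine (eLpNorm_mono_measure _ hle).trans ?_
    rw [eLpNorm_smul_measure_of_ne_top hp', smul_eq_mul]
    refine mul_le_mul_right ?_ _
    rw [eLpNorm_map_measure (h.aestronglyMeasurable_derivDist hV (hv n) hj _) haem]
    have hmeas : ∀ κ, AEStronglyMeasurable (derivComps cov e fr (v n) j κ - jetComps e fr g j κ)
        (volume.restrict (e '' K)) := fun κ =>
      (((isTower_derivComps hcov hV he hfr (hv n)).smooth j κ).continuousOn.mono
        hLe |>.aestronglyMeasurable hL.measurableSet).sub (hw.memLp j hj κ _ hL hLe).1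
    have h1 : eLpNorm (derivDist cov g (v n) j ∘ e.symm) p (volume.restrict (e '' K))
        ≤ ENNReal.ofReal B * eLpNorm (∑ κ, fun y =>
          ‖(derivComps cov e fr (v n) j κ - jetComps e fr g j κ) y‖) p
          (volume.restrict (e '' K)) := by
      refine eLpNorm_le_mul_eLpNorm_of_ae_le_mul ?_ p
      filter_upwards [ae_restrict_mem hL.measurableSet] with y hy
      obtain ⟨x, hx, rfl⟩ := hy
      have hex : e.symm (e x) = x := e.left_inv (hKe hx)
      rw [Function.comp_apply, hex, Real.norm_of_nonneg (derivDist_nonneg _ _), Finset.sum_apply,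
        Real.norm_of_nonneg (Finset.sum_nonneg fun κ _ => norm_nonneg _), derivDist_eq (hv n)]
      refine ((hBb x hx fun x => derivTensor cov (hv n) j x - g j x).1).trans (le_of_eq ?_)
      congr 1
      refine Finset.sum_congr rfl fun κ _ => ?_
      rw [Pi.sub_apply, derivComps, jetComps, hex, derivTensor_eq (hv n)]
      simp only [tensorComp, sub_apply, inner_sub_right]
    refine h1.trans (mul_le_mul_right ((eLpNorm_sum_le (fun κ _ => (hmeas κ).norm) hp).trans
      (Finset.sum_le_sum fun κ _ => ?_)) _)
    rw [eLpNorm_norm]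
  refine tendsto_of_tendsto_of_tendsto_of_le_of_le tendsto_const_nhds ?_ (fun _ => zero_le)
    hbound
  have h2 := ENNReal.Tendsto.const_mul (a := ENNReal.ofReal B)
    (tendsto_finsetSum Finset.univ fun κ _ => hlim' κ) (Or.inr ENNReal.ofReal_ne_top)
  have h3 := ENNReal.Tendsto.const_mul (a := C ^ (1 / p).toReal) h2
    (Or.inr (ENNReal.rpow_ne_top_of_nonneg ENNReal.toReal_nonneg hC))
  simpa using h3

/-- Convergence in `L^p` implies convergence in measure and hence almost everywhere along a
subsequence. Gluing needs the pointwise form. -/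
lemma IsCovJet.exists_local_approx_ae (h : IsCovJet cov s p f g) (hcov : IsComplexLinear cov)
    (hV : IsSmoothHermitian (m := m) F (V := V)) (hp : 1 ≤ p) (hp' : p ≠ ⊤)
    (he : e ∈ IsManifold.maximalAtlas (𝓡 m) ∞ M) (hfr : IsSmoothFrameOn (m := m) F fr e.source)
    {K : Set M} (hK : IsCompact K) (hKe : K ⊆ e.source) :
    ∃ v : ℕ → Π x : M, V x, (∀ n, IsSmoothSection (m := m) F (v n)) ∧
      ∀ᵐ x ∂(volG (m := m) M).restrict K, ∀ j ≤ s,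
        Filter.Tendsto (fun n => derivDist cov g (v n) j x) Filter.atTop (𝓝 0) := by
  obtain ⟨v, hv, hlim⟩ := h.exists_local_approx hcov hV hp hp' he hfr hK hKe
  have hm : ∀ n, ∀ j ∈ Finset.range (s + 1), AEStronglyMeasurable (derivDist cov g (v n) j)
      ((volG (m := m) M).restrict K) := fun n j hj =>
    h.aestronglyMeasurable_derivDist hV (hv n) (Finset.mem_range_succ_iff.1 hj) _
  -- The nonnegative errors of all orders are added first, so that one subsequence serves every `j ≤
  -- s`.
  have h1 : Filter.Tendsto (fun n => eLpNorm ((∑ j ∈ Finset.range (s + 1),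
      derivDist cov g (v n) j) - fun _ => 0) p ((volG (m := m) M).restrict K))
      Filter.atTop (𝓝 0) := by
    have h2 := tendsto_finsetSum (Finset.range (s + 1))
      fun j hj => hlim j (Finset.mem_range_succ_iff.1 hj)
    simp only [Finset.sum_const_zero] at h2
    refine tendsto_of_tendsto_of_tendsto_of_le_of_le tendsto_const_nhds h2 (fun _ => zero_le)
      fun n => ?_
    change eLpNorm ((∑ j ∈ Finset.range (s + 1), derivDist cov g (v n) j) - 0) _ _ ≤ _
    rw [sub_zero]
    exact eLpNorm_sum_le (hm n) hp
  obtain ⟨ns, -, hns⟩ := (tendstoInMeasure_of_tendsto_eLpNorm (by positivity)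
    (fun n => Finset.aestronglyMeasurable_sum _ (hm n)) aestronglyMeasurable_const
      h1).exists_seq_tendsto_ae
  refine ⟨fun n => v (ns n), fun n => hv _, ?_⟩
  filter_upwards [hns] with x hx j hj
  refine tendsto_of_tendsto_of_tendsto_of_le_of_le tendsto_const_nhds hx
    (fun n => derivDist_nonneg _ _) fun n => ?_
  simp only [Finset.sum_apply]
  exact Finset.single_le_sum (f := fun j => derivDist cov g (v (ns n)) j x)
    (fun j _ => derivDist_nonneg _ _) (Finset.mem_range_succ_iff.2 hj)

/-- If `f` vanishes almost everywhere on an open set, then so do its weak derivatives. -/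
lemma IsCovJet.ae_eq_zero (h : IsCovJet cov s p f g) (hcov : IsComplexLinear cov)
    (hV : IsSmoothHermitian (m := m) F (V := V)) (hp : 1 ≤ p) {U : Set M} (hU : IsOpen U)
    (h0 : ∀ᵐ x ∂(volG (m := m) M).restrict U, f x = 0) :
    ∀ᵐ x ∂(volG (m := m) M).restrict U, ∀ j ≤ s, g j x = 0 := by
  have hloc : ∀ x ∈ U, ∃ O : Set M, IsOpen O ∧ x ∈ O ∧
      ∀ᵐ x ∂(volG (m := m) M).restrict O, ∀ j ≤ s, g j x = 0 := by
    intro x hx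
    obtain ⟨e, he, hxe, fr, hfr⟩ := exists_framed_chart m F V x
    -- After shrinking the chart to `U`, the zeroth components vanish almost everywhere on its whole
    -- target and the uniqueness statement for weak towers applies.
    have he' := restr_mem_maximalAtlas (contDiffGroupoid ∞ (𝓡 m)) he hU
    have hsrc : (e.restr U).source = e.source ∩ U := by
      rw [OpenPartialHomeomorph.restr_source, hU.interior_eq]
    have hfr' := hfr.mono (hsrc ▸ Set.inter_subset_left : (e.restr U).source ⊆ e.source)
    have hQ := fun j i κ κ' => contDiffOn_chartCoefs (cov := cov) hV he' hfr' j i κ κ'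
    refine ⟨(e.restr U).source, (e.restr U).open_source, hsrc ▸ ⟨hxe, hx⟩, ?_⟩
    have h1 : ∀ᵐ x ∂(volG (m := m) M).restrict (e.restr U).source, f x = 0 :=
      ae_restrict_of_ae_restrict_of_subset (hsrc ▸ Set.inter_subset_right) h0
    have hw := h.isWeakTower hcov hV hp he' hfr'
    have hz := hw.eq_zero (e.restr U).open_target hp hQ fun κ => by
      rw [← ae_restrict_iff' (e.restr U).open_target.measurableSet]
      filter_upwards [(ae_target_iff he').2 h1] with y hy
      simp only [jetComps, tensorComp, h.zero, constTensor_apply, hy, inner_zero_right]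
    rw [← ae_target_iff he']
    have hz' : ∀ᵐ y ∂volume.restrict (e.restr U).target, ∀ j, j ≤ s → ∀ κ,
        jetComps (e.restr U) fr g j κ y = 0 := by
      refine ae_all_iff.2 fun j => ?_
      by_cases hj : j ≤ s
      · filter_upwards [ae_all_iff.2 fun κ =>
          (ae_restrict_iff' (e.restr U).open_target.measurableSet).2 (hz j hj κ)] with y hy _
        exact hy
      · exact Filter.Eventually.of_forall fun y hj' => absurd hj' hj
    filter_upwards [hz', ae_restrict_mem (e.restr U).open_target.measurableSet] with y hy hyt j hj
    have hx := (e.restr U).map_target hyt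
    ext v
    rw [tensor_expand he' hx]
    refine Finset.sum_eq_zero fun α _ => ?_
    have h2 : (g j ((e.restr U).symm y) fun k => coordField (e.restr U) (α k) ((e.restr U).symm y))
        = 0 := by
      refine hfr'.ext_inner hx fun a => ?_
      rw [inner_zero_right]
      exact hy j hj (α, a)
    rw [h2, smul_zero]
  choose! O hO hxO hOz using hloc
  obtain ⟨t, htU, htc, ht⟩ := TopologicalSpace.countable_cover_nhdsWithin
    (f := O) (s := U) fun x hx => mem_nhdsWithin_of_mem_nhds ((hO x hx).mem_nhds (hxO x hx))
  exact ae_restrict_of_ae_restrict_of_subset ht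
    ((ae_restrict_biUnion_iff O htc _).2 fun x hx => hOz x (htU hx))

end LocalApproximation


/-! ### Gluing local approximations -/

/-- Minkowski's inequality for a countable pointwise finite family. -/
lemma eLpNorm_le_tsum_of_forall_exists_finset {α ι : Type*} [Countable ι] [MeasurableSpace α]
    {μ : Measure α} {p : ℝ≥0∞} (hp : 1 ≤ p) {D : α → ℝ} {B : ι → α → ℝ}
    (hD : AEStronglyMeasurable D μ) (hB : ∀ i, AEStronglyMeasurable (B i) μ)
    (hB0 : ∀ i x, 0 ≤ B i x) (h : ∀ᵐ x ∂μ, ∃ S : Finset ι, ‖D x‖ ≤ ∑ i ∈ S, B i x) :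
    eLpNorm D p μ ≤ ∑' i, eLpNorm (B i) p μ := by
  -- Finite index sets are exhausted by a sequence. Truncating `‖D‖` by the finite sums over it
  -- gives functions that are eventually equal to `‖D‖` at almost every point, so the Fatou-type
  -- bound for limits in `L^p` applies.
  obtain ⟨T, hT⟩ := Filter.exists_seq_tendsto (Filter.atTop : Filter (Finset ι))
  have hm : ∀ n, AEStronglyMeasurable (∑ i ∈ T n, B i) μ := fun n =>
    Finset.aestronglyMeasurable_sum _ fun i _ => hB i
  have hlim : ∀ᵐ x ∂μ, Filter.Tendsto (fun n => min ‖D x‖ ((∑ i ∈ T n, B i) x)) Filter.atTop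
      (𝓝 ‖D x‖) := by
    filter_upwards [h] with x ⟨S, hS⟩
    refine tendsto_const_nhds.congr' ?_
    filter_upwards [hT.eventually (Filter.eventually_ge_atTop S)] with n hn
    rw [Finset.sum_apply, min_eq_left]
    exact hS.trans (Finset.sum_le_sum_of_subset_of_nonneg hn fun i _ _ => hB0 i x)
  have hm' : ∀ n, AEStronglyMeasurable (fun x => min ‖D x‖ ((∑ i ∈ T n, B i) x)) μ := fun n =>
    (hD.norm.aemeasurable.min (hm n).aemeasurable).aestronglyMeasurable
  have h1 := Lp.eLpNorm_lim_le_liminf_eLpNorm (p := p) hm' _ hlim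
  rw [eLpNorm_norm] at h1
  have h2 : ∀ n, eLpNorm (fun x => min ‖D x‖ ((∑ i ∈ T n, B i) x)) p μ
      ≤ ∑' i, eLpNorm (B i) p μ := by
    intro n
    have h3 : eLpNorm (fun x => min ‖D x‖ ((∑ i ∈ T n, B i) x)) p μ
        ≤ eLpNorm (∑ i ∈ T n, B i) p μ := by
      refine eLpNorm_mono fun x => ?_
      have h2 : 0 ≤ (∑ i ∈ T n, B i) x := by
        rw [Finset.sum_apply]; exact Finset.sum_nonneg fun i _ => hB0 i x
      rw [Real.norm_of_nonneg (le_min (norm_nonneg _) h2), Real.norm_of_nonneg h2]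
      exact min_le_right _ _
    exact (h3.trans (eLpNorm_sum_le (fun i _ => hB i) hp)).trans (ENNReal.sum_le_tsum (T n))
  refine h1.trans ((Filter.liminf_le_liminf (Filter.Eventually.of_forall h2)).trans ?_)
  rw [Filter.liminf_const]

section Gluing

variable {m : ℕ} {M : Type*} [TopologicalSpace M] [T2Space M] [SecondCountableTopology M]
  [ChartedSpace (EuclideanSpace ℝ (Fin m)) M]
  [IsManifold (𝓡 m) ∞ M] [MeasurableSpace M] [BorelSpace M]
  {F : Type*} [NormedAddCommGroup F] [NormedSpace ℂ F] [FiniteDimensional ℂ F]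
  {V : M → Type*} [TopologicalSpace (TotalSpace F V)]
  [∀ x, NormedAddCommGroup (V x)] [∀ x, InnerProductSpace ℂ (V x)] [FiberBundle F V]
  [VectorBundle ℂ F V] [VectorBundle ℝ F V] [ContMDiffVectorBundle ∞ F V (𝓡 m)]
  [RiemannianBundle (fun x : M => TangentSpace (𝓡 m) x)]
  [IsContMDiffRiemannianBundle (𝓡 m) ∞ (EuclideanSpace ℝ (Fin m))
      (fun x : M => TangentSpace (𝓡 m) x)]
  {cov : CovariantDerivative (𝓡 m) F V} [cov.ContMDiffCovariantDerivative ∞]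
  {f : Π x : M, V x}
  {g : ∀ j, TensorField (m := m) V j} {s : ℕ} {p : ℝ≥0∞}

/-- A section glued from `u i` by a partition of unity is compared with `g` through any section
`v`. -/
lemma derivDist_finsum_le {ι : Type*} {θ : SmoothPartitionOfUnity ι (𝓡 m) M Set.univ}
    {u : ι → Π x : M, V x} (hu : ∀ i, IsSmoothSection (m := m) F (u i))
    (hU : IsSmoothSection (m := m) F (fun x => ∑ᶠ i, θ i x • u i x)) {j : ℕ} {A : ι → ℝ}
    (hA0 : ∀ i, 0 ≤ A i)
    (hA : ∀ i, ∀ w : Π x : M, V x, IsSmoothSection (m := m) F w → ∀ x ∈ tsupport (θ i),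
      tensorNorm (iterCovDeriv cov (fun x => θ i x • w x) j x)
        ≤ A i * ∑ j' ∈ Finset.range (j + 1), tensorNorm (iterCovDeriv cov w j' x)) (x : M) :
    ∃ S : Finset ι, ∀ v : Π x : M, V x, IsSmoothSection (m := m) F v →
      derivDist cov g (fun x => ∑ᶠ i, θ i x • u i x) j x
        ≤ ∑ i ∈ S, (tsupport (θ i)).indicator (fun x => A i * ∑ j' ∈ Finset.range (j + 1),
            derivDist cov g (u i) j' x) x
          + (derivDist cov g v j x + ∑ i ∈ S, A i * ∑ j' ∈ Finset.range (j + 1),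
            derivDist cov g v j' x) := by
  classical
  obtain ⟨W, hW, hWf⟩ := θ.locallyFinite x
  set S := hWf.toFinset with hS
  -- `S` depends on the point but not on `v`; this is what allows `v` to vary in a sequence at a
  -- fixed point afterwards.
  refine ⟨S, fun v hv => ?_⟩
  have hsupp : ∀ y ∈ W, Function.support (fun i => θ i y) ⊆ S := by
    intro y hy i hi
    rw [hS, Set.Finite.coe_toFinset]
    exact ⟨y, hi, hy⟩
  -- The functions `θ i` with `i ∈ S` sum to one near `x`, so `v` may be brought under the sum.
  have hloc : ∀ᶠ y in 𝓝 x, (∑ᶠ i, θ i y • u i y) - v y = ∑ i ∈ S, θ i y • (u i y - v y) := by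
    filter_upwards [hW] with y hy
    have h1 : ∑ᶠ i, θ i y • u i y = ∑ i ∈ S, θ i y • u i y :=
      finsum_eq_sum_of_support_subset _ fun i hi => hsupp y hy (left_ne_zero_of_smul hi)
    have h2 : ∑ i ∈ S, θ i y = 1 := by
      rw [← finsum_eq_sum_of_support_subset _ (hsupp y hy)]
      exact θ.sum_eq_one (Set.mem_univ y)
    simp only [smul_sub, Finset.sum_sub_distrib]
    rw [← Finset.sum_smul, h2, one_smul, h1]
  have hterm : ∀ i, IsSmoothSection (m := m) F (fun y => θ i y • (u i y - v y)) := fun i =>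
    IsSmoothSection.smul (θ i).contMDiff ((hu i).sub hv)
  have heq := (iterCovDeriv_congr (cov := cov) (hU.sub hv) hloc j).self_of_nhds
  have h1 : derivDist cov g (fun x => ∑ᶠ i, θ i x • u i x) j x
      ≤ tensorNorm (iterCovDeriv cov (fun y => (∑ᶠ i, θ i y • u i y) - v y) j x)
        + derivDist cov g v j x := by
    refine le_trans (le_of_eq ?_) (tensorNorm_add_le _ _)
    unfold derivDist
    congr 1
    funext w
    rw [iterCovDeriv_sub hU hv]
    abel
  have h2 : tensorNorm (iterCovDeriv cov (fun y => (∑ᶠ i, θ i y • u i y) - v y) j x)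
      ≤ ∑ i ∈ S, tensorNorm (iterCovDeriv cov (fun y => θ i y • (u i y - v y)) j x) := by
    rw [heq]
    refine le_trans (le_of_eq ?_) (tensorNorm_sum_le S _)
    congr 1
    funext w
    exact iterCovDeriv_sum S (fun i _ => hterm i) j x w
  -- On the support of `θ i` the multiplication bound applies and `∇^{j'} (u_i - v)` is split
  -- through `g`. Off the support the section vanishes near `x`.
  have h3 : ∀ i ∈ S, tensorNorm (iterCovDeriv cov (fun y => θ i y • (u i y - v y)) j x)
      ≤ (tsupport (θ i)).indicator (fun x => A i * ∑ j' ∈ Finset.range (j + 1),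
            derivDist cov g (u i) j' x) x
        + A i * ∑ j' ∈ Finset.range (j + 1), derivDist cov g v j' x := by
    intro i _
    by_cases hx : x ∈ tsupport (θ i)
    · rw [Set.indicator_of_mem hx, ← mul_add, ← Finset.sum_add_distrib]
      refine (hA i _ ((hu i).sub hv) x hx).trans
        (mul_le_mul_of_nonneg_left (Finset.sum_le_sum fun j' _ => ?_) (hA0 i))
      refine le_trans (le_of_eq ?_) (tensorNorm_sub_le _ _)
      congr 1
      funext w
      rw [iterCovDeriv_sub (hu i) hv]
      abel
    · rw [Set.indicator_of_notMem hx, zero_add]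
      have h0 : ∀ᶠ y in 𝓝 x, (fun y => θ i y • (u i y - v y)) y = (fun y => (0 : V y)) y := by
        filter_upwards [(isClosed_tsupport _).isOpen_compl.mem_nhds hx] with y hy
        simp only [image_eq_zero_of_notMem_tsupport hy, zero_smul]
      rw [(iterCovDeriv_congr (cov := cov) (hterm i) h0 j).self_of_nhds]
      have : iterCovDeriv cov (fun y => (0 : V y)) j x = fun _ => 0 :=
        funext fun w => iterCovDeriv_zero j x w
      rw [this, tensorNorm_zero]
      exact mul_nonneg (hA0 i) (Finset.sum_nonneg fun _ _ => derivDist_nonneg _ _)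
  have h4 := Finset.sum_le_sum h3
  rw [Finset.sum_add_distrib] at h4
  linarith

/-- Smooth sections approximate a section together with its weak derivatives up to order `s`, and
the approximation is supported near the support of the section. -/
theorem IsCovJet.exists_smooth_approx (h : IsCovJet cov s p f g) (hcov : IsComplexLinear cov)
    (hV : IsSmoothHermitian (m := m) F (V := V)) (hp : 1 ≤ p) (hp' : p ≠ ⊤) {ε : ℝ≥0∞}
    (hε : ε ≠ 0) :
    ∃ u : Π x : M, V x, IsSmoothSection (m := m) F u ∧
      (∀ j ≤ s, eLpNorm (derivDist cov g u j) p (volG (m := m) M) ≤ ε) ∧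
      ∀ K : Set M, IsCompact K → (∀ᵐ x ∂(volG (m := m) M).restrict Kᶜ, ∀ j ≤ s, g j x = 0) →
        HasCompactSupp u := by
  classical
  have : LocallyCompactSpace M := ChartedSpace.locallyCompactSpace (EuclideanSpace ℝ (Fin m)) M
  choose e he hxe fr hfr using exists_framed_chart m F V
  choose C hC hxC hCe using fun x => exists_compact_subset (e x).open_source (hxe x)
  obtain ⟨t, htc, ht⟩ := TopologicalSpace.countable_cover_nhds
    (f := fun x => interior (C x)) fun x => isOpen_interior.mem_nhds (hxC x)
  have : Countable t := htc.to_subtype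
  rw [Set.biUnion_eq_iUnion] at ht
  obtain ⟨θ, hθ⟩ := SmoothPartitionOfUnity.exists_isSubordinate (𝓡 m) isClosed_univ
    (fun i : t => interior (C i)) (fun i => isOpen_interior) ht.ge
  have hKC : ∀ i : t, tsupport (θ i) ⊆ C i := fun i => (hθ i).trans interior_subset
  have hK : ∀ i : t, IsCompact (tsupport (θ i)) := fun i =>
    (hC i).of_isClosed_subset (isClosed_tsupport _) (hKC i)
  have hKm : ∀ i : t, MeasurableSet (tsupport (θ i)) := fun i => (isClosed_tsupport _).measurableSet
  have hKe : ∀ i : t, tsupport (θ i) ⊆ (e i).source := fun i => (hKC i).trans (hCe i)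
  choose A hA0 hA using fun (i : t) (j : ℕ) => exists_bound_iterCovDeriv_smul hcov hV (he i) (hfr i)
    (θ i).contMDiff (hK i) (hKe i) j
  -- The error budget is distributed over the countably many charts.
  obtain ⟨δ, hδ0, hδ⟩ := ENNReal.exists_pos_sum_of_countable' hε t
  -- The local error is made small after multiplication with the bound `A i j` for `θ i`. Where all
  -- `g_j` vanish the section zero is taken, which later yields compact support.
  have hex : ∀ i : t, ∃ u : Π x : M, V x, IsSmoothSection (m := m) F u ∧
      (∀ j ≤ s, ENNReal.ofReal (A i j) * ∑ j' ∈ Finset.range (j + 1),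
        eLpNorm (derivDist cov g u j') p ((volG (m := m) M).restrict (tsupport (θ i))) ≤ δ i) ∧
      ((∀ᵐ x ∂(volG (m := m) M).restrict (tsupport (θ i)), ∀ j ≤ s, g j x = 0) → u = 0) := by
    intro i
    by_cases hz : ∀ᵐ x ∂(volG (m := m) M).restrict (tsupport (θ i)), ∀ j ≤ s, g j x = 0
    · refine ⟨fun x => 0, IsSmoothSection.zero, fun j hj => ?_, fun _ => rfl⟩
      rw [Finset.sum_eq_zero, mul_zero]
      · exact zero_le
      · intro j' hj'
        have hj's : j' ≤ s := (Finset.mem_range_succ_iff.1 hj').trans hj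
        refine (eLpNorm_congr_ae (g := fun _ => (0 : ℝ)) ?_).trans eLpNorm_zero'
        filter_upwards [hz] with x hx
        simp only [derivDist, hx j' hj's, iterCovDeriv_zero, zero_apply, sub_zero, tensorNorm_zero]
    · obtain ⟨v, hv, hlim⟩ := h.exists_local_approx hcov hV hp hp' (he i) (hfr i) (hK i) (hKe i)
      have h1 : ∀ j ∈ Finset.range (s + 1), ∀ᶠ n in Filter.atTop, ENNReal.ofReal (A i j) *
          ∑ j' ∈ Finset.range (j + 1), eLpNorm (derivDist cov g (v n) j') p
            ((volG (m := m) M).restrict (tsupport (θ i))) ≤ δ i := by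
        intro j hj
        have h2 := tendsto_finsetSum (Finset.range (j + 1)) fun j' hj' => hlim j'
          ((Finset.mem_range_succ_iff.1 hj').trans (Finset.mem_range_succ_iff.1 hj))
        have h3 := ENNReal.Tendsto.const_mul (a := ENNReal.ofReal (A i j)) h2
          (Or.inr ENNReal.ofReal_ne_top)
        simp only [Finset.sum_const_zero, mul_zero] at h3
        exact (h3.eventually (gt_mem_nhds (hδ0 i))).mono fun n hn => hn.le
      obtain ⟨n, hn⟩ := ((Filter.eventually_all_finset _).2 h1).exists
      exact ⟨v n, hv n, fun j hj => hn j (Finset.mem_range_succ_iff.2 hj), fun h => absurd h hz⟩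
  choose u hu huδ hu0 using hex
  have hU : IsSmoothSection (m := m) F (fun x => ∑ᶠ i, θ i x • u i x) := by
    refine ContMDiff.finsum_section_of_locallyFinite ?_
      fun i => IsSmoothSection.smul (θ i).contMDiff (hu i)
    exact θ.locallyFinite.subset fun i x hx => left_ne_zero_of_smul hx
  refine ⟨_, hU, fun j hj => ?_, fun K hKc hz => ?_⟩
  · have hpt : ∀ᵐ x ∂(volG (m := m) M), ∃ S : Finset t,
        ‖derivDist cov g (fun x => ∑ᶠ i, θ i x • u i x) j x‖ ≤ ∑ i ∈ S,
          (tsupport (θ i)).indicator (fun x => A i j * ∑ j' ∈ Finset.range (j + 1),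
            derivDist cov g (u i) j' x) x := by
      have hae : ∀ P : M → Prop, (∀ i : t, ∀ᵐ x ∂(volG (m := m) M).restrict (interior (C i)), P x) →
          ∀ᵐ x ∂(volG (m := m) M), P x := by
        intro P hP
        rw [← Measure.restrict_univ (μ := volG (m := m) M), ← ht, ae_restrict_iUnion_iff]
        exact hP
      refine hae _ fun i₀ => ?_
      refine ae_restrict_of_ae_restrict_of_subset (interior_subset (s := C i₀)) ?_
      -- These comparison sections are independent of the `u i`. Their distances from `g` tend to
      -- zero at almost every point of `C i₀`, and in the limit only the local errors of the `u i`
      -- remain.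
      obtain ⟨v, hv, hlim⟩ := h.exists_local_approx_ae hcov hV hp hp' (he i₀) (hfr i₀) (hC i₀)
        (hCe i₀)
      filter_upwards [hlim] with x hx
      obtain ⟨S, hS⟩ := derivDist_finsum_le (g := g) hu hU (fun i => hA0 i j)
        (fun i => hA i j) x
      refine ⟨S, ?_⟩
      rw [Real.norm_of_nonneg (derivDist_nonneg _ _)]
      have h2 := tendsto_finsetSum (Finset.range (j + 1)) fun j' hj' => hx j'
          ((Finset.mem_range_succ_iff.1 hj').trans hj)
      simp only [Finset.sum_const_zero] at h2
      have h3 := (hx j hj).add (tendsto_finsetSum S fun i _ => h2.const_mul (A i j))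
      have h4 := h3.const_add (∑ i ∈ S, (tsupport (θ i)).indicator
        (fun x => A i j * ∑ j' ∈ Finset.range (j + 1), derivDist cov g (u i) j' x) x)
      simp only [mul_zero, Finset.sum_const_zero, add_zero] at h4
      exact ge_of_tendsto' h4 fun n => hS (v n) (hv n)
    have hm : ∀ i : t, ∀ j' ∈ Finset.range (j + 1), ∀ μ : Measure M,
        AEStronglyMeasurable (derivDist cov g (u i) j') μ := fun i j' hj' μ =>
      h.aestronglyMeasurable_derivDist hV (hu i) ((Finset.mem_range_succ_iff.1 hj').trans hj) μ
    refine (eLpNorm_le_tsum_of_forall_exists_finset hp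
      (h.aestronglyMeasurable_derivDist hV hU hj _) (fun i => ?_) (fun i x => ?_) hpt).trans
      ((ENNReal.tsum_le_tsum fun i => ?_).trans hδ.le)
    · exact ((Finset.aestronglyMeasurable_fun_sum _ fun j' hj' => hm i j' hj' _).const_mul
        _).indicator (hKm i)
    · exact Set.indicator_nonneg (fun x _ => mul_nonneg (hA0 i j)
        (Finset.sum_nonneg fun _ _ => derivDist_nonneg _ _)) x
    · rw [eLpNorm_indicator_eq_eLpNorm_restrict (hKm i)]
      refine le_trans ?_ (huδ i j hj)
      refine (eLpNorm_le_mul_eLpNorm_of_ae_le_mul (c := A i j)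
        (g := ∑ j' ∈ Finset.range (j + 1), derivDist cov g (u i) j')
        (Filter.Eventually.of_forall fun x => ?_) p).trans
        (mul_le_mul_right (eLpNorm_sum_le (fun j' hj' => hm i j' hj' _) hp) _)
      rw [norm_mul, Real.norm_of_nonneg (hA0 i j), Finset.sum_apply]
  -- Only finitely many supports meet `K`; for every other index `g` vanishes almost everywhere on
  -- the support of `θ i`, so `u i = 0`.
  · have hfin := θ.locallyFinite.closure.finite_nonempty_inter_compact hKc
    refine ⟨⋃ i ∈ hfin.toFinset, tsupport (θ i),
      hfin.toFinset.isCompact_biUnion fun i _ => hK i, fun x hx => ?_⟩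
    refine finsum_eq_zero_of_forall_eq_zero fun i => ?_
    by_cases hi : (tsupport (θ i) ∩ K).Nonempty
    · have : x ∉ tsupport (θ i) := fun hxi => hx (Set.mem_biUnion (hfin.mem_toFinset.2 hi) hxi)
      rw [image_eq_zero_of_notMem_tsupport this, zero_smul]
    · have hsub : tsupport (θ i) ⊆ Kᶜ := fun y hy hyK => hi ⟨y, hy, hyK⟩
      rw [hu0 i (ae_restrict_of_ae_restrict_of_subset hsub hz)]
      exact smul_zero _

end Gluing


section Density

variable {m : ℕ} {M : Type*} [TopologicalSpace M] [T2Space M] [SecondCountableTopology M]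
  [ChartedSpace (EuclideanSpace ℝ (Fin m)) M]
  [IsManifold (𝓡 m) ∞ M] [MeasurableSpace M] [BorelSpace M]
  {F : Type*} [NormedAddCommGroup F] [NormedSpace ℂ F] [FiniteDimensional ℂ F]
  {V : M → Type*} [TopologicalSpace (TotalSpace F V)]
  [∀ x, NormedAddCommGroup (V x)] [∀ x, InnerProductSpace ℂ (V x)] [FiberBundle F V]
  [VectorBundle ℂ F V] [VectorBundle ℝ F V] [ContMDiffVectorBundle ∞ F V (𝓡 m)]
  [RiemannianBundle (fun x : M => TangentSpace (𝓡 m) x)]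
  [IsContMDiffRiemannianBundle (𝓡 m) ∞ (EuclideanSpace ℝ (Fin m))
      (fun x : M => TangentSpace (𝓡 m) x)]
  {cov : CovariantDerivative (𝓡 m) F V} [cov.ContMDiffCovariantDerivative ∞]
  {f : Π x : M, V x}
  {g : ∀ j, TensorField (m := m) V j} {s : ℕ} {p : ℝ≥0∞}

/-! ### Density of smooth sections -/

/-- The approximating sequence, which serves the global and the local space simultaneously. -/
theorem IsCovJet.exists_approx (h : IsCovJet cov s p f g) (hcov : IsComplexLinear cov)
    (hV : IsSmoothHermitian (m := m) F (V := V)) (hp : 1 ≤ p) (hp' : p ≠ ⊤) :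
    ∃ u : ℕ → Π x : M, V x, (∀ n, IsSmoothSection (m := m) F (u n)) ∧
      (∀ n, ∀ j ≤ s, eLpNorm (derivDist cov g (u n) j) p (volG (m := m) M) ≠ ⊤) ∧
      (HasCompactEssSupp (m := m) f → ∀ n, HasCompactSupp (u n)) ∧
      Filter.Tendsto (fun n => covSobolevNorm cov s p (u n - f)) Filter.atTop (𝓝 0) := by
  have hε : ∀ n : ℕ, ((n : ℝ≥0∞) + 1)⁻¹ ≠ 0 := fun n =>
    ENNReal.inv_ne_zero.2 (by finiteness)
  choose u hu hd hc using fun n : ℕ => h.exists_smooth_approx hcov hV hp hp' (hε n)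
  have hlim : Filter.Tendsto (fun n : ℕ => ((n : ℝ≥0∞) + 1)⁻¹) Filter.atTop (𝓝 0) := by
    have := (Filter.tendsto_add_atTop_iff_nat 1).2 ENNReal.tendsto_inv_nat_nhds_zero
    simpa using this
  have hp0 : 0 < p.toReal := ENNReal.toReal_pos (by positivity) hp'
  refine ⟨u, hu, fun n j hj => ne_top_of_le_ne_top (by simp) (hd n j hj), fun hf n => ?_, ?_⟩
  · obtain ⟨K, hK, hfK⟩ := hf
    -- Essential support is a condition on `f` alone; locality of weak derivatives extends the
    -- vanishing to all `g_j`.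
    refine hc n K hK (h.ae_eq_zero hcov hV hp hK.isClosed.isOpen_compl ?_)
    exact (ae_restrict_iff' hK.isClosed.isOpen_compl.measurableSet).2 hfK
  · have h1 : ∀ j ∈ Finset.range (s + 1), Filter.Tendsto (fun n =>
        eLpNorm (derivDist cov g (u n) j) p (volG (m := m) M) ^ p.toReal) Filter.atTop (𝓝 0) := by
      intro j hj
      have h2 := tendsto_of_tendsto_of_tendsto_of_le_of_le tendsto_const_nhds hlim
        (fun _ => zero_le) fun n => hd n j (Finset.mem_range_succ_iff.1 hj)
      have h3 := ((ENNReal.continuous_rpow_const (y := p.toReal)).tendsto 0).comp h2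
      rwa [ENNReal.zero_rpow_of_pos hp0] at h3
    have h2 := tendsto_finsetSum (Finset.range (s + 1)) h1
    rw [Finset.sum_const_zero] at h2
    have h3 := ((ENNReal.continuous_rpow_const (y := 1 / p.toReal)).tendsto 0).comp h2
    rw [ENNReal.zero_rpow_of_pos (by positivity)] at h3
    exact tendsto_of_tendsto_of_tendsto_of_le_of_le tendsto_const_nhds h3 (fun _ => zero_le)
      fun n => h.covSobolevNorm_sub_le hV (hu n)

lemma MemCovSobolev.exists_isCovJet (h : MemCovSobolev cov s p f) :
    ∃ g, IsCovJet cov s p f g ∧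
      ∀ j ≤ s, MemLp (fun x => tensorNorm (fun v => g j x v)) p (volG (m := m) M) := by
  classical
  obtain ⟨hb, hf, hg⟩ := h
  choose! g hg hg' using hg
  have key : ∀ j ≤ s, MemLp (fun x => tensorNorm (fun v =>
      (if h : j = 0 then h ▸ constTensor f else g j : TensorField (m := m) V j) x v)) p
        (volG (m := m) M) := by
    intro j hj
    by_cases h0 : j = 0
    · subst h0
      simp only [dif_pos]
      simp only [tensorNorm_constTensor]
      exact hf
    · simp only [h0, dif_neg, not_false_eq_true]
      exact hg' j (Finset.mem_Icc.2 ⟨by omega, hj⟩)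
  refine ⟨fun j => if h : j = 0 then h ▸ constTensor f else g j, ⟨hb, rfl, fun j hj => ?_,
    fun j hj K _ => (key j hj).restrict K⟩, key⟩
  have : j ≠ 0 := by have := (Finset.mem_Icc.1 hj).1; omega
  simp only [this, dif_neg, not_false_eq_true]
  exact hg j hj

/-- Compactly supported smooth sections belong to the global space. -/
lemma memCovSobolev_of_hasCompactSupp (hV : IsSmoothHermitian (m := m) F (V := V))
    (hf : IsSmoothSection (m := m) F f) (hc : HasCompactSupp f) : MemCovSobolev cov s p f := by
  obtain ⟨hb, h0, hj⟩ := memCovSobolevLoc_of_smooth (cov := cov) (s := s) (p := p) hV hf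
  obtain ⟨K, hK, hfK⟩ := hc
  have key : ∀ φ : M → ℝ, MemLp φ p ((volG (m := m) M).restrict K) → (∀ x, x ∉ K → φ x = 0) →
      MemLp φ p (volG (m := m) M) := by
    intro φ hφ hφ0
    have := (memLp_indicator_iff_restrict hK.isClosed.measurableSet).2 hφ
    rwa [Set.indicator_eq_self.2 fun x hx => by_contra fun h => hx (hφ0 x h)] at this
  refine ⟨hb, key _ (h0 K hK) fun x hx => by simp [hfK x hx], fun j _ =>
    ⟨derivTensor cov hf j, isWeakCovDeriv_derivTensor hV hf j, key _ ?_ fun x hx => ?_⟩⟩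
  · exact memLp_restrict_of_continuous
      ((isLocSmoothTensor_derivTensor (cov := cov) hf j).continuous_tensorNorm hV) hK
  · have h1 : ∀ᶠ y in 𝓝 x, f y = (fun y => (0 : V y)) y := by
      filter_upwards [hK.isClosed.isOpen_compl.mem_nhds hx] with y hy using hfK y hy
    have h2 := (iterCovDeriv_congr (cov := cov) hf h1 j).self_of_nhds
    rw [derivTensor_eq hf] at h2
    have h3 : iterCovDeriv cov (fun y => (0 : V y)) j x = fun _ => 0 :=
      funext fun w => iterCovDeriv_zero j x w
    exact (congrArg tensorNorm (h2.trans h3)).trans tensorNorm_zero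

end Density

end CovSobolev

/-! ### The main theorem -/

theorem mainTheorem4 {m : ℕ} {M : Type*} [TopologicalSpace M] [T2Space M]
    [SecondCountableTopology M] [ChartedSpace (EuclideanSpace ℝ (Fin m)) M]
    [IsManifold (𝓡 m) ∞ M] [MeasurableSpace M] [BorelSpace M]
    -- the Riemannian metric
    [RiemannianBundle (fun x : M => TangentSpace (𝓡 m) x)]
    [IsContMDiffRiemannianBundle (𝓡 m) ∞ (EuclideanSpace ℝ (Fin m))
      (fun x : M => TangentSpace (𝓡 m) x)]
    -- the smooth Hermitian vector bundle
    {F : Type*} [NormedAddCommGroup F] [NormedSpace ℂ F] [FiniteDimensional ℂ F]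
    {V : M → Type*} [TopologicalSpace (TotalSpace F V)] [∀ x, NormedAddCommGroup (V x)]
    [∀ x, InnerProductSpace ℂ (V x)] [FiberBundle F V] [VectorBundle ℂ F V] [VectorBundle ℝ F V]
    [ContMDiffVectorBundle ∞ F V (𝓡 m)] (hV : CovSobolev.IsSmoothHermitian (m := m) F (V := V))
    -- the smooth covariant derivative
    (cov : CovariantDerivative (𝓡 m) F V) [CovariantDerivative.ContMDiffCovariantDerivative cov ∞]
    (hcov : CovSobolev.IsComplexLinear cov)
    (s : ℕ) (p : ℝ≥0∞) (hp : 1 ≤ p) (hp' : p ≠ ⊤) :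
    -- both the global and the local covariant Sobolev space are contained in `W^{s,p}_loc`
    (∀ f : Π x : M, V x, CovSobolev.MemCovSobolev cov s p f →
      CovSobolev.MemSobolevLoc (m := m) F s p f) ∧
    (∀ f : Π x : M, V x, CovSobolev.MemCovSobolevLoc cov s p f →
      CovSobolev.MemSobolevLoc (m := m) F s p f) ∧
    -- smooth sections are dense in the global space
    (∀ f : Π x : M, V x, CovSobolev.MemCovSobolev cov s p f →
      ∃ u : ℕ → Π x : M, V x,
        (∀ n, CovSobolev.IsSmoothSection (m := m) F (u n) ∧
          CovSobolev.MemCovSobolev cov s p (u n)) ∧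
        Filter.Tendsto (fun n => CovSobolev.covSobolevNorm cov s p (u n - f)) Filter.atTop (𝓝 0)) ∧
    -- the same for the local space
    (∀ f : Π x : M, V x, CovSobolev.MemCovSobolevLoc cov s p f →
      ∃ u : ℕ → Π x : M, V x,
        (∀ n, CovSobolev.IsSmoothSection (m := m) F (u n) ∧
          CovSobolev.MemCovSobolevLoc cov s p (u n)) ∧
        Filter.Tendsto (fun n => CovSobolev.covSobolevNorm cov s p (u n - f)) Filter.atTop (𝓝 0)) ∧
    -- compactly supported elements (of either space) are limits of compactly supported smooth ones
    (∀ f : Π x : M, V x,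
      CovSobolev.MemCovSobolev cov s p f ∨ CovSobolev.MemCovSobolevLoc cov s p f →
      CovSobolev.HasCompactEssSupp (m := m) f →
      ∃ u : ℕ → Π x : M, V x,
        (∀ n, CovSobolev.IsSmoothSection (m := m) F (u n) ∧ CovSobolev.HasCompactSupp (u n) ∧
          CovSobolev.MemCovSobolev cov s p (u n)) ∧
        Filter.Tendsto (fun n => CovSobolev.covSobolevNorm cov s p (u n - f)) Filter.atTop (𝓝 0)) := by
  have key : ∀ f : Π x : M, V x, CovSobolev.MemCovSobolevLoc cov s p f →
      CovSobolev.MemSobolevLoc (m := m) F s p f := fun f hf => by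
    obtain ⟨g, hg⟩ := hf.exists_isCovJet
    exact hg.memSobolevLoc hcov hV hp
  refine ⟨fun f hf => key f hf.memCovSobolevLoc, key, fun f hf => ?_, fun f hf => ?_,
    fun f hf hc => ?_⟩
  · obtain ⟨g, hg, hgp⟩ := hf.exists_isCovJet
    obtain ⟨u, hu, hd, -, hlim⟩ := hg.exists_approx hcov hV hp hp'
    exact ⟨u, fun n => ⟨hu n, hg.memCovSobolev_of_smooth hV (hu n) hgp (hd n)⟩, hlim⟩
  · obtain ⟨g, hg⟩ := hf.exists_isCovJet
    obtain ⟨u, hu, -, -, hlim⟩ := hg.exists_approx hcov hV hp hp'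
    exact ⟨u, fun n => ⟨hu n, CovSobolev.memCovSobolevLoc_of_smooth hV (hu n)⟩, hlim⟩
  -- Both cases reduce to the local space; the approximants return to the global space because they
  -- are smooth with compact support.
  · obtain ⟨g, hg⟩ := (hf.elim (fun h => h.memCovSobolevLoc) id).exists_isCovJet
    obtain ⟨u, hu, -, hs, hlim⟩ := hg.exists_approx hcov hV hp hp'
    exact ⟨u, fun n => ⟨hu n, hs hc n,
      CovSobolev.memCovSobolev_of_hasCompactSupp hV (hu n) (hs hc n)⟩, hlim⟩
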